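/- Let $k$ be a commutative ring with $1$ and $\lambda\in k$. All algebras are commutative unital $k$-algebras and all operators are $k$-linear. A differential operator (of weight $\lambda$) on $R$ is an operator $d$ with $d(1)=0$ and $d(xy)=d(x)y+xd(y)+\lambda d(x)d(y)$; a Rota–Baxter operator (of weight $\lambda$) is an operator $P$ with $P(x)P(y)=P(P(x)y)+P(xP(y))+\lambda P(xy)$. Let $\phi,\psi\in k[x]$ and $\omega=xy-(\phi(x)+y\psi(x))\in k\langle x,y\rangle$; for operators $q,Q$ on $R$ the relation $\omega(q,Q)=0$ means $qQ=\phi(q)+Q\psi(q)$. Categories (morphisms are the algebra homomorphisms commuting with the given operators): $\mathrm{ALG}$: algebras; $\mathrm{OA}$: pairs $(R,Q)$ with $Q$ any operator; $\mathrm{OA}_0\subset\mathrm{OA}$: those with $Q(1)=0$; $\mathrm{DIF}$ and $\mathrm{RBA}$: differential and Rota–Baxter algebras; $\mathrm{ODA}_\omega$: triples $(R,d,Q)$ with $d$ differential, $Q$ any operator and $\omega(d,Q)=0$; $\mathrm{ORB}_\omega$: triples $(R,q,P)$ with $q(1)=0$, $P$ Rota–Baxter and $\omega(q,P)=0$; $\mathrm{DRB}_\omega$: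 triples $(R,d,P)$ with $d$ differential, $P$ Rota–Baxter and $\omega(d,P)=0$. $R^{\mathbb N}$ is the algebra of $\lambda$-Hurwitz series: sequences in $R$ with product $(fg)_n=\sum_{i=0}^n\sum_{j=0}^{n-i}\binom ni\binom{n-i}j\lambda^i f_{n-j}g_{i+j}$, and $(\partial f)_n=f_{n+1}$; $(R^{\mathbb N},\partial)$ is the cofree differential algebra on $R$. An operator $Q$ on $R$ has a unique coextension $\hat Q$ to $R^{\mathbb N}$, i.e. an operator with $\hat Q(f)_0=Q(f_0)$, such that $\omega(\partial,\hat Q)=0$. $Ш(R)=\bigoplus_{n\ge1}R^{\otimes n}$ with the mixable shuffle product of weight $\lambda$ and $P_R(u)=1\otimes u$ is the free Rota–Baxter algebra on $R$. An operator $q$ on $R$ with $q(1)=0$ has a unique extension $\hat q$ to $Ш(R)$ such that $\hat q(u_0\otimes u')=q(u_0)\otimes u'+(u_0+\lambda q(u_0))(\phi(\hat q)+P_R\psi(\hat q))(u')$ for $u_0\in R$, $u'\in R^{\otimes n}$, and $\hat q(\bigoplus_{i\le n}R^{\otimes i})\subseteq\bigoplus_{i\le n}R^{\otimes i}$. These give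 functors $G_\omega:\mathrm{OA}\to\mathrm{ODA}_\omega$, $(R,Q)\mapsto(R^{\mathbb N},\partial,\hat Q)$, and $F_\omega:\mathrm{OA}_0\to\mathrm{ORB}_\omega$, $(R,q)\mapsto(Ш(R),\hat q,P_R)$. Let $\mathbf C$ be the comonad on $\mathrm{ALG}$ with functor $R\mapsto R^{\mathbb N}$ given by the adjunction between the forgetful functor $\mathrm{DIF}\to\mathrm{ALG}$ and $R\mapsto(R^{\mathbb N},\partial)$, and $\mathbf T$ the monad on $\mathrm{ALG}$ with functor $R\mapsto Ш(R)$ given by the adjunction between $R\mapsto(Ш(R),P_R)$ and the forgetful functor $\mathrm{RBA}\to\mathrm{ALG}$. A lifting of a (co)monad along a functor $U$ is a (co)monad whose functor, (co)unit and (co)multiplication are carried by $U$ strictly to the given ones. For $(R,d,P)\in\mathrm{DRB}_\omega$ put $\theta:R\to R^{\mathbb N}$, $\theta(u)_n=d^n(u)$, and $\vartheta:Ш(R)\to R$, $\vartheta(v_0\otimes\cdots\otimes v_m)=v_0P(v_1P(\cdots P(v_m)\cdots))$. **Theorem.** The following statements are equivalent. (i) For every Rota–Baxter operator $P$ on every algebra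 $R$, the coextension $\hat P$ to $R^{\mathbb N}$ is a Rota–Baxter operator. (ii) For every differential operator $d$ on every algebra $R$, the extension $\hat d$ to $Ш(R)$ is a differential operator. (iii) $G_\omega$ restricts to a functor $\mathrm{RBA}\to\mathrm{DRB}_\omega$. (iv) $F_\omega$ restricts to a functor $\mathrm{DIF}\to\mathrm{DRB}_\omega$. (v) There are a lifting $\tilde{\mathbf C}$ of $\mathbf C$ along $\mathrm{RBA}\to\mathrm{ALG}$ and an isomorphism of categories $\mathrm{DRB}_\omega\to\mathrm{RBA}_{\tilde{\mathbf C}}$ over $\mathrm{RBA}$ (onto the category of $\tilde{\mathbf C}$-coalgebras) given by $(R,d,P)\mapsto\langle(R,P),\theta\rangle$. (vi) There are a lifting $\tilde{\mathbf T}$ of $\mathbf T$ along $\mathrm{DIF}\to\mathrm{ALG}$ and an isomorphism of categories $\mathrm{DRB}_\omega\to\mathrm{DIF}^{\tilde{\mathbf T}}$ over $\mathrm{DIF}$ (onto the category of $\tilde{\mathbf T}$-algebras) given by $(R,d,P)\mapsto\langle(R,d),\vartheta\rangle$. (vii) There are a mixed distributive law of $\mathbf T$ over $\mathbf C$, i.e.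 a natural transformation $\beta:TC\to CT$ with $\beta\circ\eta C=C\eta$, $\varepsilon T\circ\beta=T\varepsilon$, $\delta T\circ\beta=C\beta\circ\beta C\circ T\delta$ and $\beta\circ\mu C=C\mu\circ\beta T\circ T\beta$, and, for the lifting $\tilde{\mathbf T}_\beta$ of $\mathbf T$ to the category $\mathrm{ALG}_{\mathbf C}$ of $\mathbf C$-coalgebras given by $\tilde T_\beta\langle A,f\rangle=\langle TA,\beta_A\circ Tf\rangle$, an isomorphism of categories $\mathrm{DRB}_\omega\to(\mathrm{ALG}_{\mathbf C})^{\tilde{\mathbf T}_\beta}$ given by $(R,d,P)\mapsto\langle\langle R,\theta\rangle,\vartheta\rangle$ and by the identity on underlying algebra homomorphisms. -/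

import Mathlib

open CategoryTheory Polynomial
open scoped TensorProduct DirectSum

universe u v

namespace DiffRB

set_option linter.unusedSectionVars false

noncomputable section Operators

variable {k : Type u} [CommRing k]

/-- `d` is a differential operator of weight `lam` on the commutative algebra `R`. -/
def IsDifferential (lam : k) {R : Type v} [CommRing R] [Algebra k R] (d : Module.End k R) : Prop :=
  d 1 = 0 ∧ ∀ x y : R, d (x * y) = d x * y + x * d y + lam • (d x * d y)

/-- `P` is a Rota-Baxter operator of weight `lam` on the commutative algebra `R`. -/
def IsRotaBaxter (lam : k) {R : Type v} [CommRing R] [Algebra k R] (P : Module.End k R) : Prop :=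
  ∀ x y : R, P x * P y = P (P x * y) + P (x * P y) + lam • P (x * y)

/-- The element `xy - (φ(x) + y ψ(x))` of the free algebra `k⟨x, y⟩`, where `x` and `y` are the
generators of index `0` and `1`. -/
def omega (φ ψ : k[X]) : FreeAlgebra k (Fin 2) :=
  FreeAlgebra.ι k 0 * FreeAlgebra.ι k 1 -
    (aeval (FreeAlgebra.ι k (0 : Fin 2)) φ +
      FreeAlgebra.ι k 1 * aeval (FreeAlgebra.ι k (0 : Fin 2)) ψ)

/-- The relation `ω(q, Q) = 0` for two operators `q`, `Q` on an algebra: the noncommutative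
polynomial `ω` vanishes at `x = q`, `y = Q`. -/
def Coupled (ω : FreeAlgebra k (Fin 2)) {R : Type v} [CommRing R] [Algebra k R]
    (q Q : Module.End k R) : Prop :=
  FreeAlgebra.lift k ![q, Q] ω = 0

theorem coupled_omega_iff (φ ψ : k[X]) {R : Type v} [CommRing R] [Algebra k R]
    (q Q : Module.End k R) :
    Coupled (omega φ ψ) q Q ↔ q * Q = aeval q φ + Q * aeval q ψ := by
  have h : ∀ p : k[X], FreeAlgebra.lift k ![q, Q] (aeval (FreeAlgebra.ι k (0 : Fin 2)) p) =
      aeval q p := by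
    intro p
    rw [← aeval_algHom_apply]
    simp
  unfold Coupled omega
  rw [map_sub, map_add, map_mul, map_mul, h, h, sub_eq_zero]
  simp

end Operators

noncomputable section Hurwitz

variable {k : Type u} [CommRing k]

/-- The underlying type of the algebra of `lam`-Hurwitz series over `A`: all sequences in `A`. -/
@[ext] structure Hurwitz {k : Type u} (lam : k) (A : Type v) : Type v where
  /-- The `n`-th term of the sequence. -/
  coeff : ℕ → A

namespace Hurwitz

variable (lam : k) (A : Type v) [CommRing A] [Algebra k A]

instance : Zero (Hurwitz lam A) := ⟨⟨fun _ => 0⟩⟩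
instance : Add (Hurwitz lam A) := ⟨fun f g => ⟨fun n => f.coeff n + g.coeff n⟩⟩
instance : Neg (Hurwitz lam A) := ⟨fun f => ⟨fun n => - f.coeff n⟩⟩
instance : Sub (Hurwitz lam A) := ⟨fun f g => ⟨fun n => f.coeff n - g.coeff n⟩⟩
instance : SMul ℕ (Hurwitz lam A) := ⟨fun c f => ⟨fun n => c • f.coeff n⟩⟩
instance : SMul ℤ (Hurwitz lam A) := ⟨fun c f => ⟨fun n => c • f.coeff n⟩⟩
instance : SMul k (Hurwitz lam A) := ⟨fun c f => ⟨fun n => c • f.coeff n⟩⟩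

variable {A}

theorem coeff_injective :
    Function.Injective (Hurwitz.coeff : Hurwitz lam A → ℕ → A) := fun _ _ h => Hurwitz.ext h

theorem ext' {f g : Hurwitz lam A} (h : ∀ n, f.coeff n = g.coeff n) : f = g :=
  Hurwitz.ext (funext h)

@[simp] theorem coeff_add (f g : Hurwitz lam A) (n : ℕ) :
    (f + g).coeff n = f.coeff n + g.coeff n := rfl
@[simp] theorem coeff_zero (n : ℕ) : (0 : Hurwitz lam A).coeff n = 0 := rfl
@[simp] theorem coeff_smul (c : k) (f : Hurwitz lam A) (n : ℕ) :
    (c • f).coeff n = c • f.coeff n := rfl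

instance : AddCommGroup (Hurwitz lam A) :=
  (coeff_injective lam).addCommGroup _ rfl (fun _ _ => rfl) (fun _ => rfl) (fun _ _ => rfl)
    (fun _ _ => rfl) (fun _ _ => rfl)

instance : Module k (Hurwitz lam A) :=
  (coeff_injective lam).module k ⟨⟨Hurwitz.coeff, rfl⟩, fun _ _ => rfl⟩ (fun _ _ => rfl)

/-- The `lam`-Hurwitz product. -/
instance : Mul (Hurwitz lam A) where
  mul f g := ⟨fun n => ∑ i ∈ Finset.range (n + 1), ∑ j ∈ Finset.range (n - i + 1),
    (n.choose i * (n - i).choose j) • (lam ^ i • (f.coeff (n - j) * g.coeff (i + j)))⟩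

theorem mul_apply (f g : Hurwitz lam A) (n : ℕ) :
    (f * g).coeff n = ∑ i ∈ Finset.range (n + 1), ∑ j ∈ Finset.range (n - i + 1),
      (n.choose i * (n - i).choose j) • (lam ^ i • (f.coeff (n - j) * g.coeff (i + j))) := rfl

/-- The constant sequence `(1, 0, 0, …)`. -/
instance : One (Hurwitz lam A) where
  one := ⟨fun n => if n = 0 then 1 else 0⟩

theorem one_apply (n : ℕ) : (1 : Hurwitz lam A).coeff n = if n = 0 then 1 else 0 := rfl

variable (A) in
/-- The shift operator `∂`. -/
def shift : Module.End k (Hurwitz lam A) where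
  toFun f := ⟨fun n => f.coeff (n + 1)⟩
  map_add' _ _ := rfl
  map_smul' _ _ := rfl

@[simp] theorem shift_apply (f : Hurwitz lam A) (n : ℕ) : (shift lam A f).coeff n = f.coeff (n + 1) := rfl

variable (A) in
/-- The linear map `f ↦ f n`. -/
def ev (n : ℕ) : Hurwitz lam A →ₗ[k] A where
  toFun f := f.coeff n
  map_add' _ _ := rfl
  map_smul' _ _ := rfl

@[simp] theorem ev_apply (f : Hurwitz lam A) (n : ℕ) : ev lam A n f = f.coeff n := rfl

theorem mul_zero_apply (f g : Hurwitz lam A) : (f * g).coeff 0 = f.coeff 0 * g.coeff 0 := by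
  simp [mul_apply]

/-- The shift in the first and in the second index of a double sequence. -/
def sh₁ : Module.End k (ℕ → ℕ → A) where
  toFun F := fun a b => F (a + 1) b
  map_add' _ _ := rfl
  map_smul' _ _ := rfl

def sh₂ : Module.End k (ℕ → ℕ → A) where
  toFun F := fun a b => F a (b + 1)
  map_add' _ _ := rfl
  map_smul' _ _ := rfl

theorem sh₁_pow (n : ℕ) (F : ℕ → ℕ → A) (a b : ℕ) :
    ((sh₁ (k := k)) ^ n) F a b = F (a + n) b := by
  induction n generalizing F with
  | zero => rfl
  | succ n ih => rw [pow_succ, Module.End.mul_apply, ih]; simp [sh₁, add_assoc]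

theorem sh₂_pow (n : ℕ) (F : ℕ → ℕ → A) (a b : ℕ) :
    ((sh₂ (k := k)) ^ n) F a b = F a (b + n) := by
  induction n generalizing F with
  | zero => rfl
  | succ n ih => rw [pow_succ, Module.End.mul_apply, ih]; simp [sh₂, add_assoc]

theorem mul_eq_pow (f g : Hurwitz lam A) (n : ℕ) :
    (f * g).coeff n = ((lam • (sh₁ * sh₂) + (sh₂ + sh₁) : Module.End k (ℕ → ℕ → A)) ^ n)
      (fun a b => f.coeff a * g.coeff b) 0 0 := by
  have c0 : Commute (sh₁ (k := k) (A := A)) sh₂ := rfl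
  have c1 : Commute (lam • (sh₁ * sh₂) : Module.End k (ℕ → ℕ → A)) (sh₂ + sh₁) := by
    apply Commute.smul_left
    exact ((c0.mul_left (Commute.refl _)).add_right ((Commute.refl _).mul_left c0.symm))
  rw [c1.add_pow, mul_apply, LinearMap.sum_apply, Finset.sum_apply, Finset.sum_apply]
  refine Finset.sum_congr rfl fun i hi => ?_
  rw [c0.symm.add_pow, Finset.mul_sum, Finset.sum_mul, LinearMap.sum_apply, Finset.sum_apply,
    Finset.sum_apply]
  refine Finset.sum_congr rfl fun j hj => ?_
  have hi' : i ≤ n := Nat.lt_succ_iff.mp (Finset.mem_range.mp hi)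
  have hj' : j ≤ n - i := Nat.lt_succ_iff.mp (Finset.mem_range.mp hj)
  rw [_root_.smul_pow, c0.mul_pow]
  have e : (lam ^ i • (sh₁ ^ i * sh₂ ^ i) * (sh₂ ^ j * sh₁ ^ (n - i - j) *
      (((n - i).choose j : ℕ) : Module.End k (ℕ → ℕ → A))) *
      ((n.choose i : ℕ) : Module.End k (ℕ → ℕ → A))) =
      (n.choose i * (n - i).choose j) • (lam ^ i • (sh₁ ^ (n - j) * sh₂ ^ (i + j))) := by
    rw [mul_comm (n.choose i), mul_smul, ← nsmul_eq_mul', ← nsmul_eq_mul', smul_comm]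
    congr 1
    rw [mul_smul_comm]
    congr 1
    rw [smul_mul_assoc]
    congr 1
    have h1 : n - j = i + (n - i - j) := by omega
    rw [h1, pow_add, pow_add]
    rw [mul_assoc, mul_assoc]
    congr 1
    rw [← mul_assoc, ← mul_assoc]
    rw [((c0.pow_left (n - i - j)).pow_right i).eq, mul_assoc, mul_assoc,
      ((c0.pow_left (n - i - j)).pow_right j).eq]
  rw [e]
  simp only [LinearMap.smul_apply, Pi.smul_apply, Module.End.mul_apply, sh₁_pow, sh₂_pow, zero_add]

/-- The recursive form of the Hurwitz product: the shift is a differential operator. -/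
theorem shift_mul (f g : Hurwitz lam A) :
    shift lam A (f * g) = shift lam A f * g + f * shift lam A g +
      lam • (shift lam A f * shift lam A g) := by
  apply ext'; intro n
  simp only [shift_apply, coeff_add, coeff_smul]
  simp only [mul_eq_pow]
  rw [pow_succ, Module.End.mul_apply]
  have : (lam • (sh₁ * sh₂) + (sh₂ + sh₁) : Module.End k (ℕ → ℕ → A)) (fun a b => f.coeff a * g.coeff b) =
      (fun a b => (shift lam A f).coeff a * g.coeff b) + (fun a b => f.coeff a * (shift lam A g).coeff b) +
        lam • (fun a b => (shift lam A f).coeff a * (shift lam A g).coeff b) := by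
    funext a b
    simp [sh₁, sh₂]
    ring
  rw [this, map_add, map_add, map_smul]
  rfl

theorem mul_succ_apply (f g : Hurwitz lam A) (n : ℕ) :
    (f * g).coeff (n + 1) = (shift lam A f * g).coeff n + (f * shift lam A g).coeff n +
      lam • (shift lam A f * shift lam A g).coeff n := by
  rw [← shift_apply lam (f * g) n, shift_mul]; rfl

theorem mul_add' (f g h : Hurwitz lam A) : f * (g + h) = f * g + f * h := by
  apply ext'; intro n
  simp only [mul_apply, coeff_add, mul_add, smul_add, Finset.sum_add_distrib]

theorem mul_comm' (f g : Hurwitz lam A) : f * g = g * f := by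
  apply ext'; intro n
  induction n generalizing f g with
  | zero => simp [mul_zero_apply, mul_comm]
  | succ n ih =>
    rw [mul_succ_apply, mul_succ_apply, ih (shift lam A f) g, ih f, ih (shift lam A f) (shift _ _ _)]
    rw [add_comm ((g * shift lam A f).coeff n)]

theorem smul_mul' (c : k) (f g : Hurwitz lam A) : (c • f) * g = c • (f * g) := by
  apply ext'; intro n
  simp only [mul_apply, coeff_smul, smul_mul_assoc, Finset.smul_sum]
  refine Finset.sum_congr rfl fun i _ => Finset.sum_congr rfl fun j _ => ?_
  rw [smul_comm (lam ^ i) c, smul_comm _ c]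

theorem add_mul' (f g h : Hurwitz lam A) : (f + g) * h = f * h + g * h := by
  rw [mul_comm', mul_add', mul_comm' lam h f, mul_comm' lam h g]

theorem mul_smul' (c : k) (f g : Hurwitz lam A) : f * (c • g) = c • (f * g) := by
  rw [mul_comm', smul_mul', mul_comm']

theorem mul_assoc' (f g h : Hurwitz lam A) : f * g * h = f * (g * h) := by
  apply ext'; intro n
  induction n generalizing f g h with
  | zero => simp [mul_zero_apply, mul_assoc]
  | succ n ih =>
    rw [mul_succ_apply, mul_succ_apply, shift_mul, shift_mul]
    simp only [add_mul', mul_add', smul_mul', mul_smul', coeff_add, coeff_smul, ih, smul_add]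
    abel

theorem one_mul' (f : Hurwitz lam A) : 1 * f = f := by
  have h1 : shift lam A 1 = 0 := by apply ext'; intro n; simp [one_apply]
  have h0 : ∀ g : Hurwitz lam A, 0 * g = 0 := by
    intro g; simpa using smul_mul' lam (0 : k) 0 g
  apply ext'; intro n
  induction n generalizing f with
  | zero => simp [mul_zero_apply, one_apply]
  | succ n ih => rw [mul_succ_apply, h1, h0, h0, ih]; simp

/-- The algebra of `lam`-Hurwitz series is a commutative ring. -/
instance : CommRing (Hurwitz lam A) where
  __ := (inferInstance : AddCommGroup (Hurwitz lam A))
  left_distrib := mul_add' lam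
  right_distrib := add_mul' lam
  zero_mul g := by simpa using smul_mul' lam (0 : k) 0 g
  mul_zero g := by simpa using mul_smul' lam (0 : k) g 0
  mul_assoc := mul_assoc' lam
  one_mul := one_mul' lam
  mul_one f := by rw [mul_comm', one_mul']
  mul_comm := mul_comm' lam

instance : Algebra k (Hurwitz lam A) :=
  Algebra.ofModule (smul_mul' lam) (mul_smul' lam)

variable (A) in
theorem isDifferential_shift : IsDifferential lam (shift lam A) :=
  ⟨by apply ext'; intro n; simp [one_apply], shift_mul lam⟩

variable (A) in
/-- The counit `A^ℕ → A`, `f ↦ f 0`, an algebra homomorphism. -/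
def counit : Hurwitz lam A →ₐ[k] A :=
  AlgHom.ofLinearMap (ev lam A 0) (by simp [one_apply]) (by simp [mul_zero_apply])

@[simp] theorem counit_apply (f : Hurwitz lam A) : counit lam A f = f.coeff 0 := rfl

variable {B : Type v} [CommRing B] [Algebra k B]

/-- The algebra homomorphism `A^ℕ → B^ℕ` induced by an algebra homomorphism `A → B`. -/
def map (h : A →ₐ[k] B) : Hurwitz lam A →ₐ[k] Hurwitz lam B :=
  AlgHom.ofLinearMap
    { toFun := fun f => ⟨fun n => h (f.coeff n)⟩
      map_add' := fun _ _ => by apply ext'; intro n; simp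
      map_smul' := fun _ _ => by apply ext'; intro n; simp }
    (by apply ext'; intro n; by_cases hn : n = 0 <;> simp [one_apply, hn])
    (by
      intro f g
      apply ext'; intro n
      simp [mul_apply, map_sum])

@[simp] theorem map_apply (h : A →ₐ[k] B) (f : Hurwitz lam A) (n : ℕ) :
    (map lam h f).coeff n = h (f.coeff n) := rfl

/-- For a differential algebra `(A, d)`, the algebra homomorphism `A → A^ℕ`,
`x ↦ (x, d x, d² x, …)`. -/
def orbit (d : Module.End k A) (hd : IsDifferential lam d) : A →ₐ[k] Hurwitz lam A :=
  AlgHom.ofLinearMap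
    { toFun := fun x => ⟨fun n => (d ^ n) x⟩
      map_add' := fun _ _ => by apply ext'; intro n; simp
      map_smul' := fun _ _ => by apply ext'; intro n; simp }
    (by
      apply ext'; intro n
      cases n with
      | zero => simp [one_apply]
      | succ n => simp [one_apply, pow_succ, hd.1])
    (by
      intro x y
      apply ext'; intro n
      induction n generalizing x y with
      | zero => simp [mul_zero_apply]
      | succ n ih =>
        have e : ∀ x : A, shift lam A (⟨fun n => (d ^ n) x⟩ : Hurwitz lam A) =
            (⟨fun n => (d ^ n) (d x)⟩ : Hurwitz lam A) := by
          intro x; apply ext'; intro n; simp [pow_succ]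
        rw [mul_succ_apply]
        simp only [LinearMap.coe_mk, AddHom.coe_mk] at ih ⊢
        rw [e, e, pow_succ, Module.End.mul_apply, hd.2, map_add, map_add, map_smul,
          ih, ih, ih])

@[simp] theorem orbit_apply (d : Module.End k A) (hd : IsDifferential lam d) (x : A) (n : ℕ) :
    (orbit lam d hd x).coeff n = (d ^ n) x := rfl

/-- The components of the coextension of `Q`: `Q̂₀(f) = Q(f₀)` and
`Q̂ₙ₊₁ = φ(∂)ₙ + Q̂ₙ ψ(∂)`. -/
def coextComp (φ ψ : k[X]) (Q : Module.End k A) : ℕ → (Hurwitz lam A →ₗ[k] A)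
  | 0 => Q ∘ₗ ev lam A 0
  | n + 1 => ev lam A n ∘ₗ aeval (shift lam A) φ +
      coextComp φ ψ Q n ∘ₗ aeval (shift lam A) ψ

/-- The coextension `Q̂` of an operator `Q` on `A` to `A^ℕ` attached to `φ`, `ψ`. -/
def coext (φ ψ : k[X]) (Q : Module.End k A) : Module.End k (Hurwitz lam A) where
  toFun f := ⟨fun n => coextComp lam φ ψ Q n f⟩
  map_add' _ _ := by apply ext'; intro n; simp
  map_smul' _ _ := by apply ext'; intro n; simp

/-- `coext` is the unique operator on `A^ℕ` which satisfies `Q̂(f)₀ = Q(f₀)` and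
`∂ Q̂ = φ(∂) + Q̂ ψ(∂)`. -/
theorem eq_coext_iff (φ ψ : k[X]) (Q : Module.End k A) (E : Module.End k (Hurwitz lam A)) :
    ((∀ f : Hurwitz lam A, (E f).coeff 0 = Q (f.coeff 0)) ∧ Coupled (omega φ ψ) (shift lam A) E) ↔
      E = coext lam φ ψ Q := by
  rw [coupled_omega_iff]
  constructor
  · rintro ⟨h0, h⟩
    have key : ∀ n (f : Hurwitz lam A), (E f).coeff n = coextComp lam φ ψ Q n f := by
      intro n
      induction n with
      | zero => intro f; simpa [coextComp] using h0 f
      | succ n ih =>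
        intro f
        have := congrArg (fun g => g.coeff n) (LinearMap.congr_fun h f)
        simp only [Module.End.mul_apply, shift_apply] at this
        rw [this]
        simp only [coextComp, LinearMap.add_apply, LinearMap.comp_apply, ← ih]
        rfl
    refine LinearMap.ext fun f => ext' lam fun n => ?_
    exact key n f
  · rintro rfl
    refine ⟨fun f => rfl, ?_⟩
    refine LinearMap.ext fun f => ext' lam fun n => rfl

variable {lam} in
theorem map_shift {B : Type v} [CommRing B] [Algebra k B] (h : A →ₐ[k] B) (p : k[X])
    (f : Hurwitz lam A) :
    map lam h (aeval (shift lam A) p f) = aeval (shift lam B) p (map lam h f) := by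
  induction p using Polynomial.induction_on generalizing f with
  | C c => simp [aeval_C, Module.algebraMap_end_apply]
  | add p q hp hq => simp [hp, hq]
  | monomial m c ih =>
    rw [pow_succ, ← mul_assoc, map_mul _ (C c * X ^ m), map_mul _ (C c * X ^ m),
      Module.End.mul_apply, Module.End.mul_apply, aeval_X, aeval_X, ih]
    rfl

theorem map_coext (φ ψ : k[X]) {B : Type v} [CommRing B] [Algebra k B] (Q : Module.End k A)
    (Q' : Module.End k B) (h : A →ₐ[k] B) (hQ : ∀ a, h (Q a) = Q' (h a)) (f : Hurwitz lam A) :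
    map lam h (coext lam φ ψ Q f) = coext lam φ ψ Q' (map lam h f) := by
  have key : ∀ n f, h (coextComp lam φ ψ Q n f) = coextComp lam φ ψ Q' n (map lam h f) := by
    intro n
    induction n with
    | zero => intro f; exact hQ _
    | succ n ih =>
      intro f
      simp only [coextComp, LinearMap.add_apply, LinearMap.comp_apply, _root_.map_add, ih]
      rw [map_shift h ψ f, ← map_shift h φ f]
      rfl
  exact ext' lam fun n => key n f

end Hurwitz

end Hurwitz

noncomputable section Shuffle

variable {k : Type u} [CommRing k]

/-- The tensor power `A^{⊗(n+1)} = A ⊗ (A ⊗ (⋯ ⊗ A))` over `k`. -/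
def tens (k : Type u) [CommRing k] (A : Type v) [CommRing A] [Algebra k A] : ℕ → ModuleCat.{v} k
  | 0 => ModuleCat.of k A
  | n + 1 => ModuleCat.of k (A ⊗[k] (tens k A n))

/-- The underlying module of the free Rota-Baxter algebra on `A`: the direct sum of all tensor
powers `A^{⊗ (n+1)}`, `n ∈ ℕ`. -/
def Sha {k : Type u} [CommRing k] (_lam : k) (A : Type v) [CommRing A] [Algebra k A] : Type v :=
  ⨁ n : ℕ, tens k A n

namespace Sha

variable (lam : k) (A : Type v) [CommRing A] [Algebra k A]

instance : AddCommGroup (Sha lam A) := inferInstanceAs (AddCommGroup (⨁ n : ℕ, tens k A n))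
instance : Module k (Sha lam A) := inferInstanceAs (Module k (⨁ n : ℕ, tens k A n))

/-- The inclusion of the summand `A^{⊗(n+1)}`. -/
def incl (n : ℕ) : tens k A n →ₗ[k] Sha lam A := DirectSum.lof k ℕ (fun n => tens k A n) n

/-- The linear map on `Sha lam A` with given restrictions to the tensor powers. -/
def desc {M : Type v} [AddCommGroup M] [Module k M] (F : ∀ n, tens k A n →ₗ[k] M) :
    Sha lam A →ₗ[k] M :=
  DirectSum.toModule k ℕ M F

@[simp] theorem desc_incl {M : Type v} [AddCommGroup M] [Module k M]
    (F : ∀ n, tens k A n →ₗ[k] M) (n : ℕ) (x : tens k A n) :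
    desc lam A F (incl lam A n x) = F n x := by
  unfold desc incl
  exact DirectSum.toModule_lof (M := fun n => tens k A n) k (φ := F) n x

variable {A} in
/-- The element `a ⊗ u` of `A^{⊗(n+2)}`, for `u` in `A^{⊗(n+1)}`. -/
def pre {n : ℕ} (a : A) (u : tens k A n) : tens k A (n + 1) := (a ⊗ₜ[k] u : A ⊗[k] (tens k A n))

variable {A} in
/-- Bilinear maps out of `A × A^{⊗(n+1)}` as linear maps out of `A^{⊗(n+2)}`. -/
def lift {n : ℕ} {M : Type v} [AddCommGroup M] [Module k M]
    (f : A →ₗ[k] tens k A n →ₗ[k] M) : tens k A (n + 1) →ₗ[k] M :=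
  (TensorProduct.lift f : A ⊗[k] (tens k A n) →ₗ[k] M)

@[simp] theorem lift_pre {n : ℕ} {M : Type v} [AddCommGroup M] [Module k M]
    (f : A →ₗ[k] tens k A n →ₗ[k] M) (a : A) (u : tens k A n) :
    lift f (pre a u) = f a u :=
  TensorProduct.lift.tmul a u

/-- The identification of `A` with its first tensor power. -/
def toTens : A ≃ₗ[k] tens k A 0 := LinearEquiv.refl k A

/-- The natural embedding `j_A : A → Sha(A)` onto the first summand, as a linear map. -/
def emb : A →ₗ[k] Sha lam A := incl lam A 0 ∘ₗ (toTens A).toLinearMap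

/-- The bilinear map `(a, u) ↦ a ⊗ u` from `A × Sha(A)` to `Sha(A)`. -/
def cons : A →ₗ[k] Sha lam A →ₗ[k] Sha lam A :=
  LinearMap.flip (desc lam A fun n =>
    (LinearMap.flip ((TensorProduct.mk k A (tens k A n)).compr₂
      (incl lam A (n + 1) : A ⊗[k] (tens k A n) →ₗ[k] Sha lam A))))

variable {A}

theorem cons_incl (a : A) (n : ℕ) (u : tens k A n) :
    cons lam A a (incl lam A n u) = incl lam A (n + 1) (pre a u) := by
  simp only [cons, LinearMap.flip_apply, desc_incl]
  rfl

theorem ind {p : Sha lam A → Prop} (h0 : ∀ a, p (emb lam A a))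
    (h1 : ∀ a u, p u → p (cons lam A a u)) (h2 : ∀ x y, p x → p y → p (x + y)) (x : Sha lam A) :
    p x := by
  have key : ∀ n (t : tens k A n), p (incl lam A n t) := by
    intro n
    induction n with
    | zero => exact h0
    | succ n ih =>
      intro t
      refine TensorProduct.induction_on (motive := fun t => p (incl lam A (n + 1) t))
        (t : A ⊗[k] (tens k A n)) ?_ ?_ ?_
      · have : p (emb lam A 0) := h0 0
        rw [map_zero] at this
        erw [map_zero]
        exact this
      · intro a u
        have := h1 a _ (ih u)
        rw [cons_incl] at this
        exact this
      · intro x y hx hy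
        erw [map_add]
        exact h2 _ _ hx hy
  refine DirectSum.induction_on (motive := p) x ?_ ?_ h2
  · have : p (emb lam A 0) := h0 0
    rw [map_zero] at this
    exact this
  · intro n t
    exact key n t

/-- Two linear maps on `Sha(A)` agree if they agree on `A` and if agreement at `u` implies
agreement at `a ⊗ u`. -/
theorem hom_ext {M : Type v} [AddCommGroup M] [Module k M] {f g : Sha lam A →ₗ[k] M}
    (h0 : ∀ a, f (emb lam A a) = g (emb lam A a))
    (h1 : ∀ a u, f u = g u → f (cons lam A a u) = g (cons lam A a u)) : f = g :=
  LinearMap.ext fun x => ind lam (p := fun x => f x = g x) h0 h1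
    (fun x y hx hy => by rw [map_add, map_add, hx, hy]) x

variable (A)

/-- The bilinear map `(a, b ⊗ v) ↦ ab ⊗ v`. -/
def mulLeft (m : ℕ) : A →ₗ[k] tens k A (m + 1) →ₗ[k] Sha lam A :=
  ((LinearMap.rTensorHom (tens k A m)).comp (LinearMap.mul k A)).compr₂
    (incl lam A (m + 1) : A ⊗[k] (tens k A m) →ₗ[k] Sha lam A)

variable {A} in
@[simp] theorem mulLeft_pre (m : ℕ) (a b : A) (v : tens k A m) :
    mulLeft lam A m a (pre b v) = incl lam A (m + 1) (pre (a * b) v) := rfl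

/-- For a bilinear map `B`, the bilinear map `(a ⊗ u, b ⊗ v) ↦ ab ⊗ B(u, v)`. -/
def consMul (n m : ℕ) (B : tens k A n →ₗ[k] tens k A m →ₗ[k] Sha lam A) :
    tens k A (n + 1) →ₗ[k] tens k A (m + 1) →ₗ[k] Sha lam A :=
  (TensorProduct.map₂ (LinearMap.mul k A) B).compr₂ (TensorProduct.lift (cons lam A))

variable {A} in
@[simp] theorem consMul_pre (n m : ℕ) (B : tens k A n →ₗ[k] tens k A m →ₗ[k] Sha lam A)
    (a b : A) (u : tens k A n) (v : tens k A m) :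
    consMul lam A n m B (pre a u) (pre b v) = cons lam A (a * b) (B u v) := rfl

/-- The linear map `u ↦ 1 ⊗ u`. -/
def preOne (n : ℕ) : tens k A n →ₗ[k] tens k A (n + 1) :=
  (TensorProduct.mk k A (tens k A n) 1 : tens k A n →ₗ[k] A ⊗[k] (tens k A n))

variable {A} in
@[simp] theorem preOne_apply (n : ℕ) (u : tens k A n) : preOne A n u = pre 1 u := rfl

/-- The mixable shuffle product on tensor powers:
`a · b = ab`, `a · (b ⊗ v) = ab ⊗ v`, `(a ⊗ u) · b = ab ⊗ u`, and
`(a ⊗ u) · (b ⊗ v) = ab ⊗ (u · (1 ⊗ v) + (1 ⊗ u) · v + lam (u · v))`. -/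
def mulTens : ∀ n m : ℕ, tens k A n →ₗ[k] tens k A m →ₗ[k] Sha lam A
  | 0, 0 => ((LinearMap.mul k A).compr₂ (emb lam A)).compl₁₂
      (toTens A).symm.toLinearMap (toTens A).symm.toLinearMap
  | 0, m + 1 => (mulLeft lam A m).comp (toTens A).symm.toLinearMap
  | n + 1, 0 => ((mulLeft lam A n).comp (toTens A).symm.toLinearMap).flip
  | n + 1, m + 1 => consMul lam A n m
      ((mulTens n (m + 1)).compl₂ (preOne A m) + (mulTens (n + 1) m).comp (preOne A n) +
        lam • mulTens n m)
termination_by n m => n + m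

/-- The mixable shuffle product of weight `lam` on `Sha(A)`, as a bilinear map. -/
def mulS : Sha lam A →ₗ[k] Sha lam A →ₗ[k] Sha lam A :=
  desc lam A fun n => LinearMap.flip (desc lam A fun m => (mulTens lam A n m).flip)

variable {A}

instance : Mul (Sha lam A) := ⟨fun x y => mulS lam A x y⟩

theorem mul_def (x y : Sha lam A) : x * y = mulS lam A x y := rfl

theorem incl_mul_incl (n m : ℕ) (u : tens k A n) (v : tens k A m) :
    incl lam A n u * incl lam A m v = mulTens lam A n m u v := by
  simp [mul_def, mulS]

theorem mulAdd (x y z : Sha lam A) : x * (y + z) = x * y + x * z := by simp [mul_def]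
theorem addMul (x y z : Sha lam A) : (x + y) * z = x * z + y * z := by simp [mul_def]
theorem smulMul (c : k) (x y : Sha lam A) : (c • x) * y = c • (x * y) := by simp [mul_def]
theorem mulSmul (c : k) (x y : Sha lam A) : x * (c • y) = c • (x * y) := by simp [mul_def]

theorem emb_mul_emb (a b : A) : emb lam A a * emb lam A b = emb lam A (a * b) := by
  change incl lam A 0 (toTens A a) * incl lam A 0 (toTens A b) = _
  rw [incl_mul_incl, mulTens]
  rfl

theorem emb_mul_cons (a b : A) (v : Sha lam A) :
    emb lam A a * cons lam A b v = cons lam A (a * b) v := by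
  have h : (mulS lam A (emb lam A a)).comp (cons lam A b) = cons lam A (a * b) := by
    refine DirectSum.linearMap_ext k fun m => LinearMap.ext fun v => ?_
    change incl lam A 0 (toTens A a) * cons lam A b (incl lam A m v) = cons lam A (a * b) (incl lam A m v)
    rw [cons_incl, cons_incl, incl_mul_incl, mulTens]
    rfl
  exact LinearMap.congr_fun h v

theorem cons_mul_emb (a b : A) (u : Sha lam A) :
    cons lam A a u * emb lam A b = cons lam A (b * a) u := by
  have h : ((mulS lam A).flip (emb lam A b)).comp (cons lam A a) = cons lam A (b * a) := by
    refine DirectSum.linearMap_ext k fun m => LinearMap.ext fun v => ?_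
    change cons lam A a (incl lam A m v) * incl lam A 0 (toTens A b) = cons lam A (b * a) (incl lam A m v)
    rw [cons_incl, cons_incl, incl_mul_incl, mulTens]
    rfl
  exact LinearMap.congr_fun h u

theorem cons_mul_cons (a b : A) (u v : Sha lam A) :
    cons lam A a u * cons lam A b v =
      cons lam A (a * b) (u * cons lam A 1 v + cons lam A 1 u * v + lam • (u * v)) := by
  have h : (mulS lam A).compl₁₂ (cons lam A a) (cons lam A b) =
      ((mulS lam A).compl₂ (cons lam A 1) + (mulS lam A).comp (cons lam A 1) +
        lam • mulS lam A).compr₂ (cons lam A (a * b)) := by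
    refine DirectSum.linearMap_ext k fun n => LinearMap.ext fun u =>
      DirectSum.linearMap_ext k fun m => LinearMap.ext fun v => ?_
    change cons lam A a (incl lam A n u) * cons lam A b (incl lam A m v) =
      cons lam A (a * b) (incl lam A n u * cons lam A 1 (incl lam A m v) +
        cons lam A 1 (incl lam A n u) * incl lam A m v + lam • (incl lam A n u * incl lam A m v))
    simp only [cons_incl, incl_mul_incl]
    rw [mulTens, consMul_pre]
    rfl
  exact LinearMap.congr_fun (LinearMap.congr_fun h u) v

theorem mulComm (x y : Sha lam A) : x * y = y * x := by
  revert y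
  refine ind lam (p := fun x => ∀ y, x * y = y * x) ?_ ?_ ?_ x
  · intro a y
    refine ind lam (p := fun y => emb lam A a * y = y * emb lam A a) ?_ ?_ ?_ y
    · intro b; rw [emb_mul_emb, emb_mul_emb, mul_comm]
    · intro b v _; rw [emb_mul_cons, cons_mul_emb]
    · intro y z hy hz; rw [mulAdd, addMul, hy, hz]
  · intro a u hu y
    revert a
    refine ind lam (p := fun y => ∀ a, cons lam A a u * y = y * cons lam A a u) ?_ ?_ ?_ y
    · intro b a; rw [emb_mul_cons, cons_mul_emb]
    · intro b v hv a
      rw [cons_mul_cons, cons_mul_cons, hu, hv, hu v, mul_comm a b,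
        add_comm (cons lam A 1 v * u)]
    · intro y z hy hz a; rw [mulAdd, addMul, hy, hz]
  · intro x z hx hz y; rw [mulAdd, addMul, hx, hz]

theorem mulAssoc (x y z : Sha lam A) : x * y * z = x * (y * z) := by
  revert y z
  refine ind lam (p := fun x => ∀ y z, x * y * z = x * (y * z)) ?_ ?_ ?_ x
  · intro a y z
    refine ind lam (p := fun y => emb lam A a * y * z = emb lam A a * (y * z)) ?_ ?_ ?_ y
    · intro b
      refine ind lam (p := fun z => emb lam A a * emb lam A b * z =
        emb lam A a * (emb lam A b * z)) ?_ ?_ ?_ z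
      · intro c; simp only [emb_mul_emb, mul_assoc]
      · intro c w _; simp only [emb_mul_emb, emb_mul_cons, mul_assoc]
      · intro z w hz hw; simp only [mulAdd, hz, hw]
    · intro b v _
      refine ind lam (p := fun z => emb lam A a * cons lam A b v * z =
        emb lam A a * (cons lam A b v * z)) ?_ ?_ ?_ z
      · intro c; simp only [emb_mul_cons, cons_mul_emb, mul_left_comm]
      · intro c w _; simp only [cons_mul_cons, emb_mul_cons, mul_assoc]
      · intro z w hz hw; simp only [mulAdd, hz, hw]
    · intro y w hy hw; simp only [mulAdd, addMul, hy, hw]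
  · intro a u hu y z
    revert a z
    refine ind lam (p := fun y => ∀ a z, cons lam A a u * y * z = cons lam A a u * (y * z))
      ?_ ?_ ?_ y
    · intro b a z
      refine ind lam (p := fun z => cons lam A a u * emb lam A b * z =
        cons lam A a u * (emb lam A b * z)) ?_ ?_ ?_ z
      · intro c; simp only [emb_mul_emb, cons_mul_emb, mul_left_comm, mul_comm]
      · intro c w _
        simp only [emb_mul_cons, cons_mul_emb, cons_mul_cons, mul_left_comm, mul_comm]
      · intro z w hz hw; simp only [mulAdd, hz, hw]
    · intro b v hv a z
      have key : ∀ a b, cons lam A a u * cons lam A b v * z =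
          cons lam A a u * (cons lam A b v * z) := by
        refine ind lam (p := fun z => ∀ a b, cons lam A a u * cons lam A b v * z =
          cons lam A a u * (cons lam A b v * z)) ?_ ?_ ?_ z
        · intro c a b; simp only [cons_mul_emb, cons_mul_cons, mul_left_comm]
        · intro c w hw a b
          have e1 := hw 1 1
          have P1 : ∀ x y, cons lam A 1 x * cons lam A 1 y = cons lam A 1
              (x * cons lam A 1 y + cons lam A 1 x * y + lam • (x * y)) := by
            intro x y; rw [cons_mul_cons, mul_one]
          rw [cons_mul_cons lam a b, cons_mul_cons lam (a * b) c, ← P1, cons_mul_cons lam b c,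
            cons_mul_cons lam a (b * c), ← P1, mul_assoc]
          congr 1
          simp only [addMul, mulAdd, smulMul, mulSmul, hu, hv, smul_add, e1]
          abel
        · intro z w hz hw a b; simp only [mulAdd, hz, hw]
      exact key a b
    · intro y w hy hw a z; simp only [mulAdd, addMul, hy, hw]
  · intro x w hx hw y z; simp only [addMul, hx, hw]

instance : One (Sha lam A) := ⟨emb lam A 1⟩

theorem one_def : (1 : Sha lam A) = emb lam A 1 := rfl

theorem oneMul (x : Sha lam A) : 1 * x = x := by
  refine ind lam (p := fun x => 1 * x = x) ?_ ?_ ?_ x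
  · intro a; rw [one_def, emb_mul_emb, one_mul]
  · intro a u _; rw [one_def, emb_mul_cons, one_mul]
  · intro x y hx hy; rw [mulAdd, hx, hy]

/-- `Sha(A)` with the mixable shuffle product is a commutative ring. -/
instance : CommRing (Sha lam A) where
  __ := (inferInstance : AddCommGroup (Sha lam A))
  left_distrib := mulAdd lam
  right_distrib := addMul lam
  zero_mul x := by simp [mul_def]
  mul_zero x := by simp [mul_def]
  mul_assoc := mulAssoc lam
  one_mul := oneMul lam
  mul_one x := by rw [mulComm, oneMul]
  mul_comm := mulComm lam

instance : Algebra k (Sha lam A) := Algebra.ofModule (smulMul lam) (mulSmul lam)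

variable (A) in
/-- The natural embedding `j_A : A → Sha(A)`. -/
def unit : A →ₐ[k] Sha lam A :=
  AlgHom.ofLinearMap (emb lam A) rfl (fun a b => (emb_mul_emb lam a b).symm)

@[simp] theorem unit_apply (a : A) : unit lam A a = emb lam A a := rfl

variable (A) in
/-- The Rota-Baxter operator `P_A : u ↦ 1 ⊗ u` of `Sha(A)`. -/
def opP : Module.End k (Sha lam A) := cons lam A 1

theorem opP_apply (u : Sha lam A) : opP lam A u = cons lam A 1 u := rfl

theorem opP_incl (n : ℕ) (u : tens k A n) :
    opP lam A (incl lam A n u) = incl lam A (n + 1) (pre 1 u) := cons_incl lam 1 n u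

variable (A) in
theorem isRotaBaxter_opP : IsRotaBaxter lam (opP lam A) := by
  intro x y
  simp only [opP_apply]
  rw [cons_mul_cons, mul_one, map_add, map_add, map_smul,
    add_comm (cons lam A 1 (x * cons lam A 1 y))]

/-- `a ⊗ u = a P_A(u)`. -/
theorem cons_eq (a : A) (u : Sha lam A) : cons lam A a u = emb lam A a * opP lam A u := by
  rw [opP_apply, emb_mul_cons, mul_one]

section Functoriality

variable {B : Type v} [CommRing B] [Algebra k B]

/-- The map `a₀ ⊗ ⋯ ⊗ aₙ ↦ h(a₀) ⊗ ⋯ ⊗ h(aₙ)` on tensor powers. -/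
def mapTens (h : A →ₗ[k] B) : ∀ n, tens k A n →ₗ[k] tens k B n
  | 0 => (toTens B).toLinearMap ∘ₗ h ∘ₗ (toTens A).symm.toLinearMap
  | n + 1 => (TensorProduct.map h (mapTens h n) :
      A ⊗[k] (tens k A n) →ₗ[k] B ⊗[k] (tens k B n))

/-- The map `a₀ ⊗ ⋯ ⊗ aₙ ↦ h(a₀) ⊗ ⋯ ⊗ h(aₙ)` from `Sha(A)` to `Sha(B)`, as a linear map. -/
def mapLin (h : A →ₗ[k] B) : Sha lam A →ₗ[k] Sha lam B :=
  desc lam A fun n => incl lam B n ∘ₗ mapTens h n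

theorem mapLin_emb (h : A →ₗ[k] B) (a : A) : mapLin lam h (emb lam A a) = emb lam B (h a) := by
  simp only [mapLin, emb, LinearMap.comp_apply, desc_incl, mapTens]
  rfl

theorem mapLin_cons (h : A →ₗ[k] B) (a : A) (u : Sha lam A) :
    mapLin lam h (cons lam A a u) = cons lam B (h a) (mapLin lam h u) := by
  have e : (mapLin lam h).comp (cons lam A a) = (cons lam B (h a)).comp (mapLin lam h) := by
    refine DirectSum.linearMap_ext k fun n => LinearMap.ext fun u => ?_
    change mapLin lam h (cons lam A a (incl lam A n u)) =
      cons lam B (h a) (mapLin lam h (incl lam A n u))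
    rw [cons_incl]
    simp only [mapLin, desc_incl, LinearMap.comp_apply]
    rw [cons_incl]
    rfl
  exact LinearMap.congr_fun e u

theorem mapLin_mul (h : A →ₐ[k] B) (x y : Sha lam A) :
    mapLin lam h.toLinearMap (x * y) = mapLin lam h.toLinearMap x * mapLin lam h.toLinearMap y := by
  set f := mapLin lam h.toLinearMap with hf
  have he : ∀ a, f (emb lam A a) = emb lam B (h a) := mapLin_emb lam _
  have hc : ∀ a u, f (cons lam A a u) = cons lam B (h a) (f u) := mapLin_cons lam _
  revert y
  refine ind lam (p := fun x => ∀ y, f (x * y) = f x * f y) ?_ ?_ ?_ x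
  · intro a y
    refine ind lam (p := fun y => f (emb lam A a * y) = f (emb lam A a) * f y) ?_ ?_ ?_ y
    · intro b; simp only [emb_mul_emb, he, map_mul]
    · intro b v _; simp only [emb_mul_cons, he, hc, map_mul]
    · intro y z hy hz; simp only [mul_add, map_add, hy, hz]
  · intro a u hu y
    revert a
    refine ind lam (p := fun y => ∀ a, f (cons lam A a u * y) = f (cons lam A a u) * f y)
      ?_ ?_ ?_ y
    · intro b a; simp only [cons_mul_emb, he, hc, map_mul]
    · intro b v hv a
      have hv1 := hv 1
      rw [hc, _root_.map_one h] at hv1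
      simp only [cons_mul_cons, hc, map_mul, map_add, map_smul, hu, _root_.map_one h, hv1]
    · intro y z hy hz a; simp only [mul_add, map_add, hy, hz]
  · intro x z hx hz y; simp only [add_mul, map_add, hx, hz]

/-- The algebra homomorphism `Sha(A) → Sha(B)` induced by an algebra homomorphism `A → B`. -/
def map (h : A →ₐ[k] B) : Sha lam A →ₐ[k] Sha lam B :=
  AlgHom.ofLinearMap (mapLin lam h.toLinearMap)
    (by rw [one_def, mapLin_emb, one_def]; simp) (mapLin_mul lam h)

@[simp] theorem map_emb (h : A →ₐ[k] B) (a : A) : map lam h (emb lam A a) = emb lam B (h a) :=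
  mapLin_emb lam _ a

@[simp] theorem map_cons (h : A →ₐ[k] B) (a : A) (u : Sha lam A) :
    map lam h (cons lam A a u) = cons lam B (h a) (map lam h u) :=
  mapLin_cons lam _ a u

theorem map_opP (h : A →ₐ[k] B) (u : Sha lam A) :
    map lam h (opP lam A u) = opP lam B (map lam h u) := by
  simp only [opP_apply, map_cons, map_one]

theorem algHom_ext {f g : Sha lam A →ₐ[k] B} (h0 : ∀ a, f (emb lam A a) = g (emb lam A a))
    (h1 : ∀ a u, f u = g u → f (cons lam A a u) = g (cons lam A a u)) : f = g :=
  AlgHom.toLinearMap_injective (hom_ext lam h0 h1)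

end Functoriality

section Evaluation

/-- For an operator `P` on `A`, the map
`a₀ ⊗ a₁ ⊗ ⋯ ⊗ aₙ ↦ a₀ P(a₁ P(⋯ P(aₙ) ⋯))` on tensor powers. -/
def evalTens (P : Module.End k A) : ∀ n, tens k A n →ₗ[k] A
  | 0 => (toTens A).symm.toLinearMap
  | n + 1 => lift ((LinearMap.mul k A).compl₂ (P ∘ₗ evalTens P n))

/-- The map `a₀ ⊗ a₁ ⊗ ⋯ ⊗ aₙ ↦ a₀ P(a₁ P(⋯ P(aₙ) ⋯))` from `Sha(A)` to `A`, as a linear map. -/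
def evalLin (P : Module.End k A) : Sha lam A →ₗ[k] A := desc lam A (evalTens P)

theorem evalLin_emb (P : Module.End k A) (a : A) : evalLin lam P (emb lam A a) = a := by
  simp only [evalLin, emb, LinearMap.comp_apply, desc_incl, evalTens]
  rfl

theorem evalLin_cons (P : Module.End k A) (a : A) (u : Sha lam A) :
    evalLin lam P (cons lam A a u) = a * P (evalLin lam P u) := by
  have e : (evalLin lam P).comp (cons lam A a) =
      (LinearMap.mul k A a).comp (P.comp (evalLin lam P)) := by
    refine DirectSum.linearMap_ext k fun n => LinearMap.ext fun u => ?_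
    change evalLin lam P (cons lam A a (incl lam A n u)) =
      a * P (evalLin lam P (incl lam A n u))
    rw [cons_incl]
    simp only [evalLin, desc_incl, evalTens, lift_pre]
    rfl
  exact LinearMap.congr_fun e u

theorem evalLin_mul (P : Module.End k A) (hP : IsRotaBaxter lam P) (x y : Sha lam A) :
    evalLin lam P (x * y) = evalLin lam P x * evalLin lam P y := by
  set f := evalLin lam P with hf
  have he : ∀ a, f (emb lam A a) = a := evalLin_emb lam P
  have hc : ∀ a u, f (cons lam A a u) = a * P (f u) := evalLin_cons lam P
  revert y
  refine ind lam (p := fun x => ∀ y, f (x * y) = f x * f y) ?_ ?_ ?_ x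
  · intro a y
    refine ind lam (p := fun y => f (emb lam A a * y) = f (emb lam A a) * f y) ?_ ?_ ?_ y
    · intro b; simp only [emb_mul_emb, he]
    · intro b v _; simp only [emb_mul_cons, he, hc, mul_assoc]
    · intro y z hy hz; simp only [mul_add, map_add, hy, hz]
  · intro a u hu y
    revert a
    refine ind lam (p := fun y => ∀ a, f (cons lam A a u * y) = f (cons lam A a u) * f y)
      ?_ ?_ ?_ y
    · intro b a; simp only [cons_mul_emb, he, hc]; ring
    · intro b v hv a
      have hv1 := hv 1
      rw [hc, one_mul] at hv1
      simp only [cons_mul_cons, hc, map_add, map_smul, hu, one_mul, hv1]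
      rw [show a * P (f u) * (b * P (f v)) = a * b * (P (f u) * P (f v)) by ring, hP,
        add_comm (P (P (f u) * f v)), mul_add, mul_add, mul_smul_comm]
    · intro y z hy hz a; simp only [mul_add, map_add, hy, hz]
  · intro x z hx hz y; simp only [add_mul, map_add, hx, hz]

/-- For a Rota-Baxter algebra `(A, P)`, the algebra homomorphism `Sha(A) → A`,
`a₀ ⊗ a₁ ⊗ ⋯ ⊗ aₙ ↦ a₀ P(a₁ P(⋯ P(aₙ) ⋯))`. -/
def eval (P : Module.End k A) (hP : IsRotaBaxter lam P) : Sha lam A →ₐ[k] A :=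
  AlgHom.ofLinearMap (evalLin lam P) (by rw [one_def, evalLin_emb]) (evalLin_mul lam P hP)

@[simp] theorem eval_emb (P : Module.End k A) (hP : IsRotaBaxter lam P) (a : A) :
    eval lam P hP (emb lam A a) = a := evalLin_emb lam P a

@[simp] theorem eval_cons (P : Module.End k A) (hP : IsRotaBaxter lam P) (a : A) (u : Sha lam A) :
    eval lam P hP (cons lam A a u) = a * P (eval lam P hP u) := evalLin_cons lam P a u

end Evaluation

section Extension

variable (φ ψ : k[X]) (q : Module.End k A)

variable (A) in
/-- The submodule `A ⊕ A^{⊗2} ⊕ ⋯ ⊕ A^{⊗(n+1)}` of `Sha(A)`. -/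
def fil (n : ℕ) : Submodule k (Sha lam A) := ⨆ i ≤ n, LinearMap.range (incl lam A i)

theorem incl_mem_fil {i n : ℕ} (h : i ≤ n) (t : tens k A i) : incl lam A i t ∈ fil lam A n :=
  (le_iSup₂_of_le (f := fun i (_ : i ≤ n) => LinearMap.range (incl lam A i)) i h le_rfl)
    (LinearMap.mem_range_self _ t)

theorem fil_mono {n m : ℕ} (h : n ≤ m) : fil lam A n ≤ fil lam A m :=
  iSup₂_le fun i hi => by
    rintro _ ⟨t, rfl⟩
    exact incl_mem_fil lam (hi.trans h) t

theorem cons_mem_fil (a : A) {n : ℕ} {u : Sha lam A} (hu : u ∈ fil lam A n) :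
    cons lam A a u ∈ fil lam A (n + 1) := by
  have : fil lam A n ≤ (fil lam A (n + 1)).comap (cons lam A a) :=
    iSup₂_le fun i hi => by
      rintro _ ⟨t, rfl⟩
      rw [Submodule.mem_comap, cons_incl]
      exact incl_mem_fil lam (by omega) _
  exact this hu

/-- Induction over the filtration of `Sha(A)`. -/
theorem fil_le {N : ℕ → Submodule k (Sha lam A)} (hN : Monotone N)
    (h0 : ∀ a, emb lam A a ∈ N 0)
    (h1 : ∀ n a u, u ∈ fil lam A n → u ∈ N n → cons lam A a u ∈ N (n + 1)) (n : ℕ) :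
    fil lam A n ≤ N n := by
  have key : ∀ i (t : tens k A i), incl lam A i t ∈ N i := by
    intro i
    induction i with
    | zero => exact h0
    | succ i ih =>
      intro t
      refine TensorProduct.induction_on (motive := fun t => incl lam A (i + 1) t ∈ N (i + 1))
        (t : A ⊗[k] (tens k A i)) ?_ ?_ ?_
      · erw [map_zero]; exact zero_mem _
      · intro a u
        have := h1 i a _ (incl_mem_fil lam le_rfl u) (ih u)
        rw [cons_incl] at this
        exact this
      · intro x y hx hy
        erw [map_add]
        exact add_mem hx hy
  refine iSup₂_le fun i hi => ?_
  rintro _ ⟨t, rfl⟩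
  exact hN hi (key i t)

theorem emb_mul_mem_fil (a : A) {n : ℕ} {u : Sha lam A} (hu : u ∈ fil lam A n) :
    emb lam A a * u ∈ fil lam A n := by
  have := fil_le lam (N := fun n => (fil lam A n).comap (LinearMap.mul k (Sha lam A) (emb lam A a)))
    (fun i j h => Submodule.comap_mono (fil_mono lam h))
    (fun b => by
      change emb lam A a * emb lam A b ∈ fil lam A 0
      rw [emb_mul_emb]; exact incl_mem_fil lam le_rfl _)
    (fun n b u hu _ => by
      change emb lam A a * cons lam A b u ∈ fil lam A (n + 1)
      rw [emb_mul_cons]; exact cons_mem_fil lam _ hu) n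
  exact this hu

theorem exists_mem_fil (u : Sha lam A) : ∃ n, u ∈ fil lam A n := by
  refine ind lam (p := fun u => ∃ n, u ∈ fil lam A n) ?_ ?_ ?_ u
  · intro a; exact ⟨0, incl_mem_fil lam le_rfl _⟩
  · rintro a u ⟨n, hn⟩; exact ⟨n + 1, cons_mem_fil lam a hn⟩
  · rintro x y ⟨n, hn⟩ ⟨m, hm⟩
    exact ⟨max n m, add_mem (fil_mono lam (le_max_left n m) hn)
      (fil_mono lam (le_max_right n m) hm)⟩

/-- The bilinear map `(a, u) ↦ q(a) ⊗ u + (a + lam q(a)) (φ(D) + P_A ψ(D))(u)`. -/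
def extForm (D : Module.End k (Sha lam A)) : A →ₗ[k] Sha lam A →ₗ[k] Sha lam A :=
  (cons lam A).comp q +
    (((LinearMap.mul k (Sha lam A)).comp (emb lam A)).comp (LinearMap.id + lam • q)).compl₂
      (aeval D φ + opP lam A * aeval D ψ)

theorem extForm_apply (D : Module.End k (Sha lam A)) (a : A) (u : Sha lam A) :
    extForm lam φ ψ q D a u = cons lam A (q a) u +
      emb lam A (a + lam • q a) * (aeval D φ u + opP lam A (aeval D ψ u)) := rfl

/-- One step of the recursive construction of the extension of `q`. -/
def extStep (D : Module.End k (Sha lam A)) : Module.End k (Sha lam A) :=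
  desc lam A fun
    | 0 => emb lam A ∘ₗ q ∘ₗ (toTens A).symm.toLinearMap
    | n + 1 => lift ((extForm lam φ ψ q D).compl₂ (incl lam A n))

theorem extStep_emb (D : Module.End k (Sha lam A)) (a : A) :
    extStep lam φ ψ q D (emb lam A a) = emb lam A (q a) := by
  simp only [extStep, emb, LinearMap.comp_apply, desc_incl]
  rfl

theorem extStep_cons (D : Module.End k (Sha lam A)) (a : A) (u : Sha lam A) :
    extStep lam φ ψ q D (cons lam A a u) = extForm lam φ ψ q D a u := by
  have e : (extStep lam φ ψ q D).comp (cons lam A a) = extForm lam φ ψ q D a := by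
    refine DirectSum.linearMap_ext k fun n => LinearMap.ext fun u => ?_
    change extStep lam φ ψ q D (cons lam A a (incl lam A n u)) =
      extForm lam φ ψ q D a (incl lam A n u)
    rw [cons_incl]
    simp only [extStep, desc_incl, lift_pre]
    rfl
  exact LinearMap.congr_fun e u

/-- The successive approximations of the extension of `q`; the `n`-th one is correct on
`A ⊕ ⋯ ⊕ A^{⊗n}`. -/
def extApprox : ℕ → Module.End k (Sha lam A)
  | 0 => 0
  | n + 1 => extStep lam φ ψ q (extApprox n)

/-- The extension `q̂` of an operator `q` on `A` to `Sha(A)` attached to `φ`, `ψ`. -/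
def extend (φ ψ : k[X]) (q : Module.End k A) : Module.End k (Sha lam A) :=
  desc lam A fun n => extApprox lam φ ψ q (n + 1) ∘ₗ incl lam A n

theorem aeval_mem_fil {D : Module.End k (Sha lam A)} {n : ℕ}
    (hD : ∀ u ∈ fil lam A n, D u ∈ fil lam A n) (p : k[X]) :
    ∀ u ∈ fil lam A n, aeval D p u ∈ fil lam A n := by
  induction p using Polynomial.induction_on with
  | C c => intro u hu; rw [aeval_C]; exact Submodule.smul_mem _ c hu
  | add p q hp hq => intro u hu; rw [map_add]; exact add_mem (hp u hu) (hq u hu)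
  | monomial m c ih =>
    intro u hu
    rw [pow_succ, ← mul_assoc, map_mul, Module.End.mul_apply, aeval_X]
    exact ih _ (hD u hu)

theorem aeval_eq_of_fil {D E : Module.End k (Sha lam A)} {n : ℕ}
    (hD : ∀ u ∈ fil lam A n, D u ∈ fil lam A n)
    (h : ∀ u ∈ fil lam A n, D u = E u) (p : k[X]) :
    ∀ u ∈ fil lam A n, aeval D p u = aeval E p u := by
  induction p using Polynomial.induction_on with
  | C c => intro u hu; rw [aeval_C, aeval_C]
  | add p q hp hq =>
    intro u hu; rw [map_add, map_add, LinearMap.add_apply, LinearMap.add_apply, hp u hu, hq u hu]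
  | monomial m c ih =>
    intro u hu
    rw [pow_succ, ← mul_assoc, map_mul _ (C c * X ^ m), map_mul _ (C c * X ^ m),
      Module.End.mul_apply, Module.End.mul_apply, aeval_X, aeval_X, ← h u hu]
    exact ih _ (hD u hu)

theorem extForm_mem_fil {D : Module.End k (Sha lam A)} {n : ℕ}
    (hD : ∀ u ∈ fil lam A n, D u ∈ fil lam A n) (a : A) :
    ∀ u ∈ fil lam A n, extForm lam φ ψ q D a u ∈ fil lam A (n + 1) := by
  intro u hu
  rw [extForm_apply]
  refine add_mem (cons_mem_fil lam _ hu) (emb_mul_mem_fil lam _ (add_mem ?_ ?_))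
  · exact fil_mono lam n.le_succ (aeval_mem_fil lam hD φ u hu)
  · exact cons_mem_fil lam _ (aeval_mem_fil lam hD ψ u hu)

theorem extForm_eq_of_fil {D E : Module.End k (Sha lam A)} {n : ℕ}
    (hD : ∀ u ∈ fil lam A n, D u ∈ fil lam A n)
    (h : ∀ u ∈ fil lam A n, D u = E u) (a : A) :
    ∀ u ∈ fil lam A n, extForm lam φ ψ q D a u = extForm lam φ ψ q E a u := by
  intro u hu
  rw [extForm_apply, extForm_apply, aeval_eq_of_fil lam hD h φ u hu,
    aeval_eq_of_fil lam hD h ψ u hu]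

theorem extApprox_mem_fil (j n : ℕ) :
    ∀ u ∈ fil lam A n, extApprox lam φ ψ q j u ∈ fil lam A n := by
  induction j generalizing n with
  | zero => intro u _; exact zero_mem _
  | succ j ih =>
    have := fil_le lam (N := fun n => (fil lam A n).comap (extApprox lam φ ψ q (j + 1)))
      (fun i j h => Submodule.comap_mono (fil_mono lam h))
      (fun a => by
        rw [Submodule.mem_comap, extApprox, extStep_emb]; exact incl_mem_fil lam le_rfl _)
      (fun n a u hu _ => by
        rw [Submodule.mem_comap, extApprox, extStep_cons]
        exact extForm_mem_fil lam φ ψ q (ih n) a u hu) n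
    exact this

theorem extApprox_succ_eq (n : ℕ) :
    ∀ i, ∀ u ∈ fil lam A n,
      extApprox lam φ ψ q (n + 1 + i) u = extApprox lam φ ψ q (n + 1) u := by
  induction n with
  | zero =>
    intro i
    have h : fil lam A 0 ≤ LinearMap.eqLocus (extApprox lam φ ψ q (0 + 1 + i))
        (extApprox lam φ ψ q (0 + 1)) :=
      iSup₂_le fun j hj => by
        obtain rfl : j = 0 := by omega
        rintro _ ⟨t, rfl⟩
        rw [LinearMap.mem_eqLocus, show 0 + 1 + i = i + 1 by omega]
        exact (extStep_emb lam φ ψ q _ ((toTens A).symm t)).trans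
          (extStep_emb lam φ ψ q _ ((toTens A).symm t)).symm
    exact fun u hu => h hu
  | succ n ih =>
    intro i
    have h := fil_le lam (N := fun m => if m ≤ n + 1 then
        LinearMap.eqLocus (extApprox lam φ ψ q (n + 1 + 1 + i)) (extApprox lam φ ψ q (n + 1 + 1))
        else ⊤)
      (fun a b hab => by
        dsimp only
        split_ifs with h1 h2 h2
        · exact le_rfl
        · exact le_top
        · omega
        · exact le_rfl)
      (fun a => by
        rw [if_pos (Nat.zero_le _), LinearMap.mem_eqLocus,
          show n + 1 + 1 + i = (n + 1 + i) + 1 by omega, extApprox, extApprox, extStep_emb,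
          extStep_emb])
      (fun m a u hu _ => by
        split_ifs with h1
        · rw [LinearMap.mem_eqLocus, show n + 1 + 1 + i = (n + 1 + i) + 1 by omega, extApprox,
            extApprox, extStep_cons, extStep_cons]
          exact extForm_eq_of_fil lam φ ψ q (extApprox_mem_fil lam φ ψ q _ n) (ih i) a u
            (fil_mono lam (by omega) hu)
        · trivial) (n + 1)
    rw [if_pos le_rfl] at h
    exact fun u hu => h hu

theorem ext_eq_approx (n : ℕ) :
    ∀ u ∈ fil lam A n, extend lam φ ψ q u = extApprox lam φ ψ q (n + 1) u := by
  have h : fil lam A n ≤ LinearMap.eqLocus (extend lam φ ψ q) (extApprox lam φ ψ q (n + 1)) :=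
    iSup₂_le fun i hi => by
      rintro _ ⟨t, rfl⟩
      rw [LinearMap.mem_eqLocus, extend, desc_incl, LinearMap.comp_apply]
      obtain ⟨j, rfl⟩ := Nat.exists_eq_add_of_le hi
      rw [show i + j + 1 = i + 1 + j by omega]
      exact (extApprox_succ_eq lam φ ψ q i j _ (incl_mem_fil lam le_rfl t)).symm
  exact fun u hu => h hu

theorem ext_mem_fil (n : ℕ) : ∀ u ∈ fil lam A n, extend lam φ ψ q u ∈ fil lam A n := by
  intro u hu
  rw [ext_eq_approx lam φ ψ q n u hu]
  exact extApprox_mem_fil lam φ ψ q _ n u hu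

theorem ext_emb (a : A) : extend lam φ ψ q (emb lam A a) = emb lam A (q a) := by
  rw [ext_eq_approx lam φ ψ q 0 (emb lam A a) (incl_mem_fil lam le_rfl (toTens A a))]
  exact extStep_emb lam φ ψ q _ a

theorem ext_cons (a : A) (u : Sha lam A) :
    extend lam φ ψ q (cons lam A a u) = cons lam A (q a) u +
      emb lam A (a + lam • q a) *
        (aeval (extend lam φ ψ q) φ u + opP lam A (aeval (extend lam φ ψ q) ψ u)) := by
  obtain ⟨n, hn⟩ := exists_mem_fil lam u
  rw [ext_eq_approx lam φ ψ q (n + 1) _ (cons_mem_fil lam a hn), extApprox, extStep_cons,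
    ← extForm_apply]
  exact (extForm_eq_of_fil lam φ ψ q (ext_mem_fil lam φ ψ q n) (ext_eq_approx lam φ ψ q n)
    a u hn).symm

/-- `extend` is the unique operator `D` on `Sha(A)` which extends `q`, satisfies
`D(a ⊗ u) = q(a) ⊗ u + (a + lam q(a)) (φ(D) + P_A ψ(D))(u)` for `u` in a tensor power, and
preserves each `A ⊕ ⋯ ⊕ A^{⊗n}`. -/
theorem eq_ext_iff (D : Module.End k (Sha lam A)) :
    ((∀ a, D (emb lam A a) = emb lam A (q a)) ∧
      (∀ (n : ℕ) (a : A) (u : tens k A n), D (incl lam A (n + 1) (pre a u)) =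
        incl lam A (n + 1) (pre (q a) u) + emb lam A (a + lam • q a) *
          (aeval D φ (incl lam A n u) + opP lam A (aeval D ψ (incl lam A n u)))) ∧
      (∀ n, ∀ u ∈ fil lam A n, D u ∈ fil lam A n)) ↔ D = extend lam φ ψ q := by
  constructor
  · rintro ⟨h0, h1, h2⟩
    have h1' : ∀ a u, D (cons lam A a u) = extForm lam φ ψ q D a u := by
      intro a u
      have e : D.comp (cons lam A a) = extForm lam φ ψ q D a := by
        refine DirectSum.linearMap_ext k fun n => LinearMap.ext fun u => ?_
        change D (cons lam A a (incl lam A n u)) = extForm lam φ ψ q D a (incl lam A n u)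
        rw [cons_incl, h1, extForm_apply, cons_incl]
      exact LinearMap.congr_fun e u
    have key : ∀ n, ∀ u ∈ fil lam A n, D u = extend lam φ ψ q u := by
      intro n
      induction n with
      | zero =>
        have h : fil lam A 0 ≤ LinearMap.eqLocus D (extend lam φ ψ q) :=
          iSup₂_le fun j hj => by
            obtain rfl : j = 0 := by omega
            rintro _ ⟨t, rfl⟩
            exact (h0 ((toTens A).symm t)).trans (ext_emb lam φ ψ q ((toTens A).symm t)).symm
        exact fun u hu => h hu
      | succ n ih =>
        have h := fil_le lam (N := fun m => if m ≤ n + 1 then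
            LinearMap.eqLocus D (extend lam φ ψ q) else ⊤)
          (fun a b hab => by
            dsimp only
            split_ifs with h1 h2 h2
            · exact le_rfl
            · exact le_top
            · omega
            · exact le_rfl)
          (fun a => by
            rw [if_pos (Nat.zero_le _), LinearMap.mem_eqLocus, h0, ext_emb])
          (fun m a u hu _ => by
            split_ifs with hm
            · rw [LinearMap.mem_eqLocus, h1', ext_cons, ← extForm_apply]
              exact extForm_eq_of_fil lam φ ψ q (h2 n) ih a u (fil_mono lam (by omega) hu)
            · trivial) (n + 1)
        rw [if_pos le_rfl] at h
        exact fun u hu => h hu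
    refine LinearMap.ext fun u => ?_
    obtain ⟨n, hn⟩ := exists_mem_fil lam u
    exact key n u hn
  · rintro rfl
    refine ⟨ext_emb lam φ ψ q, fun n a u => ?_, ext_mem_fil lam φ ψ q⟩
    rw [← cons_incl, ← cons_incl]
    exact ext_cons lam φ ψ q a _

variable {q} in
theorem coupled_ext (hq : q 1 = 0) : Coupled (omega φ ψ) (extend lam φ ψ q) (opP lam A) := by
  rw [coupled_omega_iff]
  refine LinearMap.ext fun u => ?_
  rw [Module.End.mul_apply, opP_apply, ext_cons, hq]
  simp only [map_zero, LinearMap.zero_apply, smul_zero, add_zero, zero_add, ← one_def, one_mul]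
  rfl

theorem map_aeval {B : Type v} [CommRing B] [Algebra k B] (f : Sha lam A →ₗ[k] Sha lam B)
    (D : Module.End k (Sha lam A)) (E : Module.End k (Sha lam B))
    (h : ∀ u, f (D u) = E (f u)) (p : k[X]) (u : Sha lam A) :
    f (aeval D p u) = aeval E p (f u) := by
  induction p using Polynomial.induction_on generalizing u with
  | C c => simp [aeval_C, Module.algebraMap_end_apply]
  | add p q hp hq => simp [hp, hq]
  | monomial m c ih =>
    rw [pow_succ, ← mul_assoc, map_mul _ (C c * X ^ m), map_mul _ (C c * X ^ m),
      Module.End.mul_apply, Module.End.mul_apply, aeval_X, aeval_X, ih, h]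

theorem map_ext {B : Type v} [CommRing B] [Algebra k B] (h : A →ₐ[k] B) (r : Module.End k B)
    (hqr : ∀ a, h (q a) = r (h a)) (u : Sha lam A) :
    map lam h (extend lam φ ψ q u) = extend lam φ ψ r (map lam h u) := by
  have key : ∀ j u, map lam h (extApprox lam φ ψ q j u) = extApprox lam φ ψ r j (map lam h u) := by
    intro j
    induction j with
    | zero => intro u; simp [extApprox]
    | succ j ih =>
      intro u
      refine ind lam (p := fun u => map lam h (extApprox lam φ ψ q (j + 1) u) =
        extApprox lam φ ψ r (j + 1) (map lam h u)) ?_ ?_ ?_ u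
      · intro a
        rw [extApprox, extApprox, extStep_emb, map_emb, map_emb, extStep_emb, hqr]
      · intro a u _
        rw [extApprox, extApprox, extStep_cons, map_cons, extStep_cons, extForm_apply,
          extForm_apply, _root_.map_add (map lam h), _root_.map_mul,
          _root_.map_add (map lam h) (aeval (extApprox lam φ ψ q j) φ u), map_opP, map_cons, map_emb, hqr]
        have e := fun p u => map_aeval lam (map lam h).toLinearMap _ _ ih p u
        simp only [AlgHom.toLinearMap_apply] at e
        rw [e, e, _root_.map_add h, _root_.map_smul, hqr]
      · intro x y hx hy; rw [_root_.map_add, _root_.map_add, hx, hy, _root_.map_add,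
          _root_.map_add]
  have hmem : ∀ n, ∀ u ∈ fil lam A n, map lam h u ∈ fil lam B n := by
    intro n
    have := fil_le lam (N := fun n => (fil lam B n).comap (map lam h).toLinearMap)
      (fun i j h => Submodule.comap_mono (fil_mono lam h))
      (fun a => by
        rw [Submodule.mem_comap, AlgHom.toLinearMap_apply, map_emb]
        exact incl_mem_fil lam le_rfl _)
      (fun n a u _ hu => by
        rw [Submodule.mem_comap, AlgHom.toLinearMap_apply, map_cons]
        exact cons_mem_fil lam _ hu) n
    exact this
  obtain ⟨n, hn⟩ := exists_mem_fil lam u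
  rw [ext_eq_approx lam φ ψ q n u hn, key, ext_eq_approx lam φ ψ r n _ (hmem n u hn)]

end Extension

end Sha

end Shuffle

noncomputable section Categories

variable (k : Type u) [CommRing k]

/-- Operated algebras: commutative `k`-algebras with a `k`-linear operator. -/
structure OpAlg where
  /-- The underlying algebra. -/
  alg : CommAlgCat.{v} k
  /-- The operator. -/
  op : Module.End k alg

/-- Algebras with two operators. -/
structure OpAlg₂ where
  /-- The underlying algebra. -/
  alg : CommAlgCat.{v} k
  /-- The first operator. -/
  op₁ : Module.End k alg
  /-- The second operator. -/
  op₂ : Module.End k alg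

variable {k}

namespace OpAlg

/-- Homomorphisms of operated algebras: algebra homomorphisms commuting with the operators. -/
@[ext] structure Hom (X Y : OpAlg.{u, v} k) where
  /-- The underlying algebra homomorphism. -/
  hom : X.alg ⟶ Y.alg
  comm : ∀ x : X.alg, hom.hom (X.op x) = Y.op (hom.hom x)

instance : Category (OpAlg.{u, v} k) where
  Hom X Y := Hom X Y
  id X := ⟨𝟙 X.alg, fun _ => rfl⟩
  comp f g := ⟨f.hom ≫ g.hom, fun x => by
    simp only [CommAlgCat.hom_comp, AlgHom.comp_apply, f.comm, g.comm]⟩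

@[ext] theorem hom_ext {X Y : OpAlg.{u, v} k} {f g : X ⟶ Y} (h : f.hom = g.hom) : f = g :=
  Hom.ext h

@[simp] theorem id_hom (X : OpAlg.{u, v} k) : Hom.hom (𝟙 X) = 𝟙 X.alg := rfl
@[simp] theorem comp_hom {X Y Z : OpAlg.{u, v} k} (f : X ⟶ Y) (g : Y ⟶ Z) :
    (f ≫ g).hom = f.hom ≫ g.hom := rfl

variable (k) in
/-- The forgetful functor from operated algebras to algebras. -/
def forgetOp : OpAlg.{u, v} k ⥤ CommAlgCat.{v} k where
  obj X := X.alg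
  map f := f.hom

/-- Operated algebras `(R, q)` with `q(1) = 0`. -/
def killsOne : ObjectProperty (OpAlg.{u, v} k) := fun X => X.op 1 = 0

/-- Differential algebras of weight `lam`. -/
def isDif (lam : k) : ObjectProperty (OpAlg.{u, v} k) := fun X => IsDifferential lam X.op

/-- Rota-Baxter algebras of weight `lam`. -/
def isRB (lam : k) : ObjectProperty (OpAlg.{u, v} k) := fun X => IsRotaBaxter lam X.op

theorem isDif_le (lam : k) : isDif.{u, v} lam ≤ killsOne := fun _ h => h.1

end OpAlg

namespace OpAlg₂

/-- Algebra homomorphisms commuting with both operators. -/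
@[ext] structure Hom (X Y : OpAlg₂.{u, v} k) where
  /-- The underlying algebra homomorphism. -/
  hom : X.alg ⟶ Y.alg
  comm₁ : ∀ x : X.alg, hom.hom (X.op₁ x) = Y.op₁ (hom.hom x)
  comm₂ : ∀ x : X.alg, hom.hom (X.op₂ x) = Y.op₂ (hom.hom x)

instance : Category (OpAlg₂.{u, v} k) where
  Hom X Y := Hom X Y
  id X := ⟨𝟙 X.alg, fun _ => rfl, fun _ => rfl⟩
  comp f g := ⟨f.hom ≫ g.hom,
    fun x => by simp only [CommAlgCat.hom_comp, AlgHom.comp_apply, f.comm₁, g.comm₁],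
    fun x => by simp only [CommAlgCat.hom_comp, AlgHom.comp_apply, f.comm₂, g.comm₂]⟩

@[ext] theorem hom_ext {X Y : OpAlg₂.{u, v} k} {f g : X ⟶ Y} (h : f.hom = g.hom) : f = g :=
  Hom.ext h

@[simp] theorem id_hom (X : OpAlg₂.{u, v} k) : Hom.hom (𝟙 X) = 𝟙 X.alg := rfl
@[simp] theorem comp_hom {X Y Z : OpAlg₂.{u, v} k} (f : X ⟶ Y) (g : Y ⟶ Z) :
    (f ≫ g).hom = f.hom ≫ g.hom := rfl

variable (k) in
/-- The functor which forgets the second operator. -/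
def fst : OpAlg₂.{u, v} k ⥤ OpAlg.{u, v} k where
  obj X := ⟨X.alg, X.op₁⟩
  map f := ⟨f.hom, f.comm₁⟩

variable (k) in
/-- The functor which forgets the first operator. -/
def snd : OpAlg₂.{u, v} k ⥤ OpAlg.{u, v} k where
  obj X := ⟨X.alg, X.op₂⟩
  map f := ⟨f.hom, f.comm₂⟩

variable (lam : k) (ω : FreeAlgebra k (Fin 2))

/-- Type `ω` operated differential algebras `(R, d, Q)` of weight `lam`. -/
def isODA : ObjectProperty (OpAlg₂.{u, v} k) := fun X =>
  IsDifferential lam X.op₁ ∧ Coupled ω X.op₁ X.op₂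

/-- Type `ω` operated Rota-Baxter algebras `(R, q, P)` of weight `lam`. -/
def isORB : ObjectProperty (OpAlg₂.{u, v} k) := fun X =>
  X.op₁ 1 = 0 ∧ IsRotaBaxter lam X.op₂ ∧ Coupled ω X.op₁ X.op₂

/-- Type `ω` differential Rota-Baxter algebras `(R, d, P)` of weight `lam`. -/
def isDRB : ObjectProperty (OpAlg₂.{u, v} k) := fun X =>
  IsDifferential lam X.op₁ ∧ IsRotaBaxter lam X.op₂ ∧ Coupled ω X.op₁ X.op₂

theorem isDRB_le_isODA : isDRB.{u, v} lam ω ≤ isODA lam ω := fun _ h => ⟨h.1, h.2.2⟩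

theorem isDRB_le_isORB : isDRB.{u, v} lam ω ≤ isORB lam ω := fun _ h => ⟨h.1.1, h.2⟩

end OpAlg₂

/-- The category `OA₀` of operated algebras whose operator vanishes at `1`. -/
abbrev OA₀ (k : Type u) [CommRing k] := (OpAlg.killsOne.{u, v} (k := k)).FullSubcategory

/-- The category `DIF` of differential algebras of weight `lam`. -/
abbrev DIF (lam : k) := (OpAlg.isDif.{u, v} lam).FullSubcategory

/-- The category `RBA` of Rota-Baxter algebras of weight `lam`. -/
abbrev RBA (lam : k) := (OpAlg.isRB.{u, v} lam).FullSubcategory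

/-- The category `ODA_ω`. -/
abbrev ODA (lam : k) (ω : FreeAlgebra k (Fin 2)) := (OpAlg₂.isODA.{u, v} lam ω).FullSubcategory

/-- The category `ORB_ω`. -/
abbrev ORB (lam : k) (ω : FreeAlgebra k (Fin 2)) := (OpAlg₂.isORB.{u, v} lam ω).FullSubcategory

/-- The category `DRB_ω`. -/
abbrev DRB (lam : k) (ω : FreeAlgebra k (Fin 2)) := (OpAlg₂.isDRB.{u, v} lam ω).FullSubcategory

variable (lam : k)

/-- The inclusion of `DRB_ω` in `ODA_ω`. -/
abbrev DRB.toODA (ω : FreeAlgebra k (Fin 2)) : DRB.{u, v} lam ω ⥤ ODA.{u, v} lam ω :=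
  ObjectProperty.ιOfLE (OpAlg₂.isDRB_le_isODA lam ω)

/-- The inclusion of `DRB_ω` in `ORB_ω`. -/
abbrev DRB.toORB (ω : FreeAlgebra k (Fin 2)) : DRB.{u, v} lam ω ⥤ ORB.{u, v} lam ω :=
  ObjectProperty.ιOfLE (OpAlg₂.isDRB_le_isORB lam ω)

/-- The inclusion of `RBA` in the category of operated algebras. -/
abbrev RBA.toOA : RBA.{u, v} lam ⥤ OpAlg.{u, v} k := (OpAlg.isRB lam).ι

/-- The inclusion of `DIF` in `OA₀`. -/
abbrev DIF.toOA₀ : DIF.{u, v} lam ⥤ OA₀.{u, v} k := ObjectProperty.ιOfLE (OpAlg.isDif_le lam)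

/-- The forgetful functor `DRB_ω → DIF`. -/
def DRB.toDIF (ω : FreeAlgebra k (Fin 2)) : DRB.{u, v} lam ω ⥤ DIF.{u, v} lam :=
  ObjectProperty.lift _ ((OpAlg₂.isDRB lam ω).ι ⋙ OpAlg₂.fst k) fun X => X.property.1

/-- The forgetful functor `DRB_ω → RBA`. -/
def DRB.toRBA (ω : FreeAlgebra k (Fin 2)) : DRB.{u, v} lam ω ⥤ RBA.{u, v} lam :=
  ObjectProperty.lift _ ((OpAlg₂.isDRB lam ω).ι ⋙ OpAlg₂.snd k) fun X => X.property.2.1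

/-- The forgetful functor `V : DIF → ALG`. -/
def DIF.forgetOp : DIF.{u, v} lam ⥤ CommAlgCat.{v} k := (OpAlg.isDif lam).ι ⋙ OpAlg.forgetOp k

/-- The forgetful functor `U : RBA → ALG`. -/
def RBA.forgetOp : RBA.{u, v} lam ⥤ CommAlgCat.{v} k := (OpAlg.isRB lam).ι ⋙ OpAlg.forgetOp k

/-- The functor `G : ALG → DIF`, `A ↦ (A^ℕ, ∂)`. -/
def hurwitzFunctor : CommAlgCat.{v} k ⥤ DIF.{u, v} lam where
  obj A := ⟨⟨CommAlgCat.of k (Hurwitz lam A), Hurwitz.shift lam A⟩,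
    Hurwitz.isDifferential_shift lam A⟩
  map f := ObjectProperty.homMk ⟨CommAlgCat.ofHom (Hurwitz.map lam f.hom), fun _ => rfl⟩

/-- The adjunction `V ⊣ G` between `DIF` and `ALG`. -/
def hurwitzAdj : DIF.forgetOp.{u, v} lam ⊣ hurwitzFunctor.{u, v} lam :=
  Adjunction.mkOfUnitCounit
    { unit :=
        { app := fun X => ObjectProperty.homMk
            ⟨CommAlgCat.ofHom (Hurwitz.orbit lam X.obj.op X.property), fun x => by
              apply Hurwitz.ext'
              intro n
              change (X.obj.op ^ n) (X.obj.op x) = (X.obj.op ^ (n + 1)) x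
              rw [pow_succ]; rfl⟩
          naturality := fun X Y f => by
            apply ObjectProperty.hom_ext
            apply OpAlg.hom_ext
            apply CommAlgCat.hom_ext
            apply AlgHom.ext
            intro x
            apply Hurwitz.ext'
            intro n
            change (Y.obj.op ^ n) (f.hom.hom.hom x) = f.hom.hom.hom ((X.obj.op ^ n) x)
            induction n generalizing x with
            | zero => rfl
            | succ n ih =>
              rw [pow_succ, pow_succ, Module.End.mul_apply, Module.End.mul_apply, ← ih,
                f.hom.comm] }
      counit :=
        { app := fun A => CommAlgCat.ofHom (Hurwitz.counit lam A)
          naturality := fun _ _ _ => rfl }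
      left_triangle := by
        ext X x
        rfl
      right_triangle := by
        ext A f
        apply Hurwitz.ext'
        intro n
        change ((Hurwitz.shift lam A ^ n) f).coeff 0 = Hurwitz.coeff f n
        have : ∀ (f : Hurwitz lam A) m,
            ((Hurwitz.shift lam A ^ n) f).coeff m = f.coeff (m + n) := by
          induction n with
          | zero => intro f m; rfl
          | succ n ih =>
            intro f m
            rw [pow_succ, Module.End.mul_apply, ih, Hurwitz.shift_apply]
            rfl
        exact (this f 0).trans (congrArg _ (zero_add n)) }

/-- The comonad `𝐂` on `ALG` given by the adjunction `V ⊣ G`, with functor `A ↦ A^ℕ`. -/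
def comonadC : Comonad (CommAlgCat.{v} k) := (hurwitzAdj.{u, v} lam).toComonad

/-- The functor `F : ALG → RBA`, `A ↦ (Sha(A), P_A)`. -/
def shaFunctor : CommAlgCat.{v} k ⥤ RBA.{u, v} lam where
  obj A := ⟨⟨CommAlgCat.of k (Sha lam A), Sha.opP lam A⟩, Sha.isRotaBaxter_opP lam A⟩
  map f := ObjectProperty.homMk
    ⟨CommAlgCat.ofHom (Sha.map lam f.hom), fun x => Sha.map_opP lam f.hom x⟩
  map_id A := by
    apply ObjectProperty.hom_ext
    apply OpAlg.hom_ext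
    apply CommAlgCat.hom_ext
    refine Sha.algHom_ext (A := A) (B := Sha lam A) lam ?_ ?_
    · intro a; exact Sha.map_emb lam (AlgHom.id k A) a
    · intro a u hu
      exact (Sha.map_cons lam (AlgHom.id k A) a u).trans (congrArg (Sha.cons lam A a) hu)
  map_comp {A B D} f g := by
    apply ObjectProperty.hom_ext
    apply OpAlg.hom_ext
    apply CommAlgCat.hom_ext
    refine Sha.algHom_ext (A := A) (B := Sha lam D) lam ?_ ?_
    · intro a
      change Sha.map lam (g.hom.comp f.hom) (Sha.emb lam A a) =
        Sha.map lam g.hom (Sha.map lam f.hom (Sha.emb lam A a))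
      simp
    · intro a u hu
      change Sha.map lam (g.hom.comp f.hom) (Sha.cons lam A a u) =
        Sha.map lam g.hom (Sha.map lam f.hom (Sha.cons lam A a u))
      change Sha.map lam (g.hom.comp f.hom) u = Sha.map lam g.hom (Sha.map lam f.hom u) at hu
      simp [hu]

/-- The adjunction `F ⊣ U` between `ALG` and `RBA`. -/
def shaAdj : shaFunctor.{u, v} lam ⊣ RBA.forgetOp.{u, v} lam :=
  Adjunction.mkOfUnitCounit
    { unit :=
        { app := fun A => CommAlgCat.ofHom (Sha.unit lam A)
          naturality := fun A B f => by
            apply CommAlgCat.hom_ext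
            apply AlgHom.ext
            intro a
            exact (Sha.map_emb lam f.hom a).symm }
      counit :=
        { app := fun X => ObjectProperty.homMk
            ⟨CommAlgCat.ofHom (Sha.eval lam X.obj.op X.property), fun u => by
              change Sha.eval lam X.obj.op X.property (Sha.cons lam X.obj.alg 1 u) =
                X.obj.op (Sha.eval lam X.obj.op X.property u)
              exact (Sha.eval_cons lam X.obj.op X.property 1 u).trans (one_mul _)⟩
          naturality := fun X Y f => by
            apply ObjectProperty.hom_ext
            apply OpAlg.hom_ext
            apply CommAlgCat.hom_ext
            refine Sha.algHom_ext (A := X.obj.alg) (B := Y.obj.alg) lam ?_ ?_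
            · intro a
              change Sha.eval lam Y.obj.op Y.property
                  (Sha.map lam f.hom.hom.hom (Sha.emb lam X.obj.alg a)) =
                f.hom.hom.hom (Sha.eval lam X.obj.op X.property (Sha.emb lam X.obj.alg a))
              rw [Sha.map_emb]
              exact (Sha.eval_emb lam Y.obj.op Y.property _).trans
                (congrArg f.hom.hom.hom (Sha.eval_emb lam X.obj.op X.property a).symm)
            · intro a u hu
              change Sha.eval lam Y.obj.op Y.property (Sha.map lam f.hom.hom.hom u) =
                f.hom.hom.hom (Sha.eval lam X.obj.op X.property u) at hu
              change Sha.eval lam Y.obj.op Y.property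
                  (Sha.map lam f.hom.hom.hom (Sha.cons lam X.obj.alg a u)) =
                f.hom.hom.hom (Sha.eval lam X.obj.op X.property (Sha.cons lam X.obj.alg a u))
              rw [Sha.map_cons]
              refine (Sha.eval_cons lam Y.obj.op Y.property _ _).trans ?_
              rw [hu, ← f.hom.comm, ← map_mul]
              exact congrArg f.hom.hom.hom (Sha.eval_cons lam X.obj.op X.property a u).symm }
      left_triangle := by
        apply NatTrans.ext
        funext A
        apply ObjectProperty.hom_ext
        apply OpAlg.hom_ext
        apply CommAlgCat.hom_ext
        refine Sha.algHom_ext (A := A) (B := Sha lam A) lam ?_ ?_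
        · intro a
          change Sha.eval lam (Sha.opP lam A) (Sha.isRotaBaxter_opP lam A)
            (Sha.map lam (Sha.unit lam A) (Sha.emb lam A a)) = Sha.emb lam A a
          rw [Sha.map_emb, Sha.eval_emb]
          rfl
        · intro a u hu
          change Sha.eval lam (Sha.opP lam A) (Sha.isRotaBaxter_opP lam A)
            (Sha.map lam (Sha.unit lam A) u) = u at hu
          change Sha.eval lam (Sha.opP lam A) (Sha.isRotaBaxter_opP lam A)
            (Sha.map lam (Sha.unit lam A) (Sha.cons lam A a u)) = Sha.cons lam A a u
          rw [Sha.map_cons, Sha.eval_cons, hu, Sha.cons_eq]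
          rfl
      right_triangle := by
        ext X x
        exact Sha.eval_emb lam X.obj.op X.property x }

/-- The monad `𝐓` on `ALG` given by the adjunction `F ⊣ U`, with functor `A ↦ Sha(A)`. -/
def monadT : CategoryTheory.Monad (CommAlgCat.{v} k) := (shaAdj.{u, v} lam).toMonad

variable (φ ψ : k[X])

/-- The functor `G_ω : OA → ODA_ω`, `(R, Q) ↦ (R^ℕ, ∂, Q̂)`. -/
def functorG : OpAlg.{u, v} k ⥤ ODA.{u, v} lam (omega φ ψ) where
  obj X := ⟨⟨CommAlgCat.of k (Hurwitz lam X.alg), Hurwitz.shift lam X.alg,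
      Hurwitz.coext lam φ ψ X.op⟩, Hurwitz.isDifferential_shift lam X.alg,
      ((Hurwitz.eq_coext_iff lam φ ψ X.op _).2 rfl).2⟩
  map f := ObjectProperty.homMk ⟨CommAlgCat.ofHom (Hurwitz.map lam f.hom.hom), fun _ => rfl,
    fun x => Hurwitz.map_coext lam φ ψ _ _ f.hom.hom f.comm x⟩

/-- The functor `F_ω : OA₀ → ORB_ω`, `(R, q) ↦ (Sha(R), q̂, P_R)`. -/
def functorF : OA₀.{u, v} k ⥤ ORB.{u, v} lam (omega φ ψ) where
  obj X := ⟨⟨CommAlgCat.of k (Sha lam X.obj.alg), Sha.extend lam φ ψ X.obj.op,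
      Sha.opP lam X.obj.alg⟩,
      (Sha.ext_emb lam φ ψ X.obj.op 1).trans ((congrArg _ X.property).trans (map_zero _)),
      Sha.isRotaBaxter_opP lam X.obj.alg, Sha.coupled_ext lam φ ψ X.property⟩
  map f := ObjectProperty.homMk ⟨CommAlgCat.ofHom (Sha.map lam f.hom.hom.hom),
    fun x => Sha.map_ext lam φ ψ _ f.hom.hom.hom _ f.hom.comm x,
    fun x => Sha.map_opP lam f.hom.hom.hom x⟩
  map_id X := by
    apply ObjectProperty.hom_ext
    apply OpAlg₂.hom_ext
    exact congrArg (fun f => f.hom.hom) ((shaFunctor lam).map_id X.obj.alg)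
  map_comp f g := by
    apply ObjectProperty.hom_ext
    apply OpAlg₂.hom_ext
    exact congrArg (fun f => f.hom.hom) ((shaFunctor lam).map_comp f.hom.hom g.hom.hom)

/-- For `(R, d, P)` in `DRB_ω`, the algebra homomorphism `θ : R → R^ℕ`, `θ(u)ₙ = dⁿ(u)`. -/
def orbitMap (ω : FreeAlgebra k (Fin 2)) (X : DRB.{u, v} lam ω) :
    (RBA.forgetOp lam).obj ((DRB.toRBA lam ω).obj X) ⟶
      (comonadC lam).obj ((RBA.forgetOp lam).obj ((DRB.toRBA lam ω).obj X)) :=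
  CommAlgCat.ofHom (Hurwitz.orbit lam X.obj.op₁ X.property.1)

/-- For `(R, d, P)` in `DRB_ω`, the algebra homomorphism `ϑ : Sha(R) → R`,
`ϑ(v₀ ⊗ v₁ ⊗ ⋯ ⊗ vₘ) = v₀ P(v₁ P(⋯ P(vₘ) ⋯))`. -/
def evalMap (ω : FreeAlgebra k (Fin 2)) (X : DRB.{u, v} lam ω) :
    (monadT lam).obj ((DIF.forgetOp lam).obj ((DRB.toDIF lam ω).obj X)) ⟶
      (DIF.forgetOp lam).obj ((DRB.toDIF lam ω).obj X) :=
  CommAlgCat.ofHom (Sha.eval lam X.obj.op₂ X.property.2.1)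

end Categories

section Liftings

universe v₁ v₂ v₃ u₁ u₂ u₃

variable {A : Type u₁} [Category.{v₁} A] {B : Type u₂} [Category.{v₂} B]
  {D : Type u₃} [Category.{v₃} D]

/-- `F` is an isomorphism of categories. -/
def IsCatIso (F : D ⥤ B) : Prop := ∃ G : B ⥤ D, F ⋙ G = 𝟭 D ∧ G ⋙ F = 𝟭 B

/-- The monad `T'` on `B` is a lifting of the monad `T` on `A` along `U : B ⥤ A`:
`U T' = T U`, `U η' = η U` and `U μ' = μ U`. -/
structure IsMonadLift (U : B ⥤ A) (T : CategoryTheory.Monad A) (T' : CategoryTheory.Monad B) : Prop where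
  comp : T'.toFunctor ⋙ U = U ⋙ T.toFunctor
  η (X : B) : U.map (T'.η.app X) ≫ eqToHom (Functor.congr_obj comp X) = T.η.app (U.obj X)
  μ (X : B) : U.map (T'.μ.app X) ≫ eqToHom (Functor.congr_obj comp X) =
    eqToHom ((Functor.congr_obj comp (T'.obj X)).trans
      (congrArg T.obj (Functor.congr_obj comp X))) ≫ T.μ.app (U.obj X)

/-- The comonad `C'` on `B` is a lifting of the comonad `C` on `A` along `U : B ⥤ A`:
`U C' = C U`, `U ε' = ε U` and `U δ' = δ U`. -/
structure IsComonadLift (U : B ⥤ A) (C : Comonad A) (C' : Comonad B) : Prop where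
  comp : C'.toFunctor ⋙ U = U ⋙ C.toFunctor
  ε (X : B) : U.map (C'.ε.app X) = eqToHom (Functor.congr_obj comp X) ≫ C.ε.app (U.obj X)
  δ (X : B) : U.map (C'.δ.app X) ≫
      eqToHom ((Functor.congr_obj comp (C'.obj X)).trans
        (congrArg C.obj (Functor.congr_obj comp X))) =
    eqToHom (Functor.congr_obj comp X) ≫ C.δ.app (U.obj X)

/-- Let `T'` be a lifting of `T` along `U : B ⥤ A`. The functor `K : D ⥤ B^{T'}` is an isomorphism
over `B`, where `D` lies over `B` through `V`, and is given by `K(X) = ⟨V(X), ϑ_X⟩`. -/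
structure IsAlgebraIso {U : B ⥤ A} {T : CategoryTheory.Monad A} {T' : CategoryTheory.Monad B} (hT : IsMonadLift U T T')
    (V : D ⥤ B) (ϑ : ∀ X : D, T.obj (U.obj (V.obj X)) ⟶ U.obj (V.obj X))
    (K : D ⥤ T'.Algebra) : Prop where
  isIso : IsCatIso K
  comp_forget : K ⋙ T'.forget = V
  str (X : D) :
    U.map (K.obj X).a ≫ eqToHom (congrArg U.obj (Functor.congr_obj comp_forget X)) =
      eqToHom ((Functor.congr_obj hT.comp (K.obj X).A).trans
        (congrArg (fun Y => T.obj (U.obj Y)) (Functor.congr_obj comp_forget X))) ≫ ϑ X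

/-- Let `C'` be a lifting of `C` along `U : B ⥤ A`. The functor `H : D ⥤ B_{C'}` is an isomorphism
over `B`, where `D` lies over `B` through `V`, and is given by `H(X) = ⟨V(X), θ_X⟩`. -/
structure IsCoalgebraIso {U : B ⥤ A} {C : Comonad A} {C' : Comonad B} (hC : IsComonadLift U C C')
    (V : D ⥤ B) (θ : ∀ X : D, U.obj (V.obj X) ⟶ C.obj (U.obj (V.obj X)))
    (H : D ⥤ C'.Coalgebra) : Prop where
  isIso : IsCatIso H
  comp_forget : H ⋙ C'.forget = V
  str (X : D) :
    U.map (H.obj X).a ≫ eqToHom ((Functor.congr_obj hC.comp (H.obj X).A).trans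
        (congrArg (fun Y => C.obj (U.obj Y)) (Functor.congr_obj comp_forget X))) =
      eqToHom (congrArg U.obj (Functor.congr_obj comp_forget X)) ≫ θ X

/-- A mixed distributive law of the monad `T` over the comonad `C`. -/
structure MixedDistribLaw (T : CategoryTheory.Monad A) (C : Comonad A) where
  /-- The natural transformation `β : T C → C T`. -/
  β : C.toFunctor ⋙ T.toFunctor ⟶ T.toFunctor ⋙ C.toFunctor
  unit (X : A) : T.η.app (C.obj X) ≫ β.app X = C.map (T.η.app X)
  counit (X : A) : β.app X ≫ C.ε.app (T.obj X) = T.map (C.ε.app X)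
  comul (X : A) : β.app X ≫ C.δ.app (T.obj X) =
    T.map (C.δ.app X) ≫ β.app (C.obj X) ≫ C.map (β.app X)
  mul (X : A) : T.μ.app (C.obj X) ≫ β.app X =
    T.map (β.app X) ≫ β.app (T.obj X) ≫ C.map (T.μ.app X)

namespace MixedDistribLaw

variable {T : CategoryTheory.Monad A} {C : Comonad A} (b : MixedDistribLaw T C)

theorem nat {X Y : A} (f : X ⟶ Y) :
    T.map (C.map f) ≫ b.β.app Y = b.β.app X ≫ C.map (T.map f) := b.β.naturality f

/-- The functor `⟨X, a⟩ ↦ ⟨T X, β_X ∘ T a⟩` on `C`-coalgebras. -/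
@[simps] def liftFunctor : C.Coalgebra ⥤ C.Coalgebra where
  obj X :=
    { A := T.obj X.A
      a := T.map X.a ≫ b.β.app X.A
      counit := by
        rw [Category.assoc, b.counit, ← T.map_comp, X.counit, T.map_id]
      coassoc := by
        rw [Category.assoc, b.comul, C.map_comp, Category.assoc, ← Category.assoc (T.map X.a),
          ← T.map_comp, X.coassoc, T.map_comp, Category.assoc, ← Category.assoc (T.map (C.map X.a)),
          b.nat, Category.assoc] }
  map f :=
    { f := T.map f.f
      h := by
        change (T.map _ ≫ b.β.app _) ≫ C.map (T.map f.f) = T.map f.f ≫ T.map _ ≫ b.β.app _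
        rw [Category.assoc, ← b.nat, ← Category.assoc, ← T.map_comp, f.h, T.map_comp,
          Category.assoc] }

/-- The lifting monad `T̃_β` of `T` on `C`-coalgebras given by the mixed distributive law `β`. -/
def liftMonad : CategoryTheory.Monad C.Coalgebra where
  toFunctor := b.liftFunctor
  η :=
    { app := fun X =>
        { f := T.η.app X.A
          h := by
            change X.a ≫ C.map (T.η.app X.A) = T.η.app X.A ≫ T.map X.a ≫ b.β.app X.A
            rw [← b.unit, ← Category.assoc, ← Category.assoc]
            congr 1
            exact T.η.naturality X.a }
      naturality := fun X Y f => by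
        ext
        exact T.η.naturality f.f }
  μ :=
    { app := fun X =>
        { f := T.μ.app X.A
          h := by
            change (T.map (T.map X.a ≫ b.β.app X.A) ≫ b.β.app (T.obj X.A)) ≫ C.map (T.μ.app X.A) =
              T.μ.app X.A ≫ T.map X.a ≫ b.β.app X.A
            rw [← Category.assoc (T.μ.app X.A), ← T.μ.naturality X.a, T.map_comp, Category.assoc,
              Category.assoc, Category.assoc, ← b.mul]
            rfl }
      naturality := fun X Y f => by
        ext
        exact T.μ.naturality f.f }
  assoc X := by
    ext
    exact T.assoc X.A
  left_unit X := by
    ext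
    exact T.left_unit X.A
  right_unit X := by
    ext
    exact T.right_unit X.A

theorem liftMonad_isMonadLift : IsMonadLift C.forget T b.liftMonad where
  comp := rfl
  η X := by
    exact Category.comp_id _
  μ X := by
    exact (Category.comp_id _).trans (Category.id_comp _).symm

end MixedDistribLaw

end Liftings

end DiffRB

open DiffRB

/-! Two dual rigidity principles carry the whole argument. A map h into Hurwitz series with h d = ∂
h satisfies h(x)_n = h(dⁿ x)_0, so it is determined by its zeroth component
(`Hurwitz.eq_of_intertwine`). If moreover d and P are coupled, the relation ω gives h P the
recursion that defines the coextension, so h P = Q̂ h holds as soon as it holds in degree zero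
(`Hurwitz.coext_intertwine`). Dually, an algebra homomorphism out of Ш(A) that commutes with the
Rota–Baxter operators is determined on A (`Sha.eq_of_intertwine`). If its target carries a
differential operator D coupled to the Rota–Baxter operator, then it carries d̂ to D as soon as it
does so on A (`Sha.extend_intertwine`), because a ⊗ u = a P(u) and the formula for d̂ is the product
rule for D combined with ω.

From (i) to (ii): by (i) the coextension of P_R makes Ш(R)^ℕ a Rota–Baxter algebra. By freeness, R →
R^ℕ → Ш(R)^ℕ extends to a Rota–Baxter homomorphism i on Ш(R), and i carries d̂ to ∂. The counit
splits i, so i is injective and d̂ inherits the product rule from ∂.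

From (ii) to (i): by (ii) the extension of ∂ to Ш(R^ℕ) is differential, so u ↦ (ϑ Ш(ε)(∂̂ⁿ u))_n is
an algebra homomorphism Ш(R^ℕ) → R^ℕ. It carries P_{R^ℕ} to P̂, and the embedding of R^ℕ splits it.
It is therefore surjective, and P̂ inherits the Rota–Baxter identity.

The same homomorphism without the final ϑ, namely u ↦ (Ш(ε)(∂̂ⁿ u))_n, is the mixed distributive
law; its axioms are comparisons in degree zero. A 𝐂-coalgebra is a differential algebra, with d the
degree one part of the structure map. A 𝐓-algebra is a Rota–Baxter algebra, with P(x) the value of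
the structure map at 1 ⊗ x. Given both, coupling is equivalent to θ being a morphism for P and P̂,
and to ϑ being a morphism for d̂ and d. This yields the isomorphisms of categories.

Conversely, each isomorphism of categories turns a (co)free object into an object of DRB_ω whose
underlying algebra is R^ℕ or Ш(R). The rigidity principles identify its operators with ∂ and P̂, or
with d̂ and P_R, and membership in DRB_ω gives (i) or (ii). -/

namespace DiffRB

noncomputable section

variable {k : Type u} [CommRing k]

/-! ### Polynomials in intertwined operators -/

/-- A linear map which intertwines two operators intertwines the values of polynomials at them. -/
theorem aeval_intertwine {M N : Type*} [AddCommGroup M] [Module k M] [AddCommGroup N] [Module k N]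
    (f : M →ₗ[k] N) (D : Module.End k M) (E : Module.End k N) (h : ∀ u, f (D u) = E (f u))
    (p : k[X]) (u : M) : f (aeval D p u) = aeval E p (f u) := by
  induction p using Polynomial.induction_on generalizing u with
  | C c => simp [aeval_C, Module.algebraMap_end_apply]
  | add p q hp hq => simp [hp, hq]
  | monomial m c ih =>
    rw [pow_succ, ← mul_assoc, map_mul _ (C c * X ^ m), map_mul _ (C c * X ^ m),
      Module.End.mul_apply, Module.End.mul_apply, aeval_X, aeval_X, ih, h]

/-- A linear map which intertwines two operators on a submodule stable under the first one
intertwines the values of polynomials at them on this submodule. -/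
theorem aeval_intertwine_of_mem {M N : Type*} [AddCommGroup M] [Module k M] [AddCommGroup N]
    [Module k N] (f : M →ₗ[k] N) (D : Module.End k M) (E : Module.End k N) (W : Submodule k M)
    (hW : ∀ u ∈ W, D u ∈ W) (h : ∀ u ∈ W, f (D u) = E (f u)) (p : k[X]) :
    ∀ u ∈ W, f (aeval D p u) = aeval E p (f u) := by
  induction p using Polynomial.induction_on with
  | C c => intro u _; simp [aeval_C, Module.algebraMap_end_apply]
  | add p q hp hq => intro u hu; simp [hp u hu, hq u hu]
  | monomial m c ih =>
    intro u hu
    rw [pow_succ, ← mul_assoc, map_mul _ (C c * X ^ m), map_mul _ (C c * X ^ m),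
      Module.End.mul_apply, Module.End.mul_apply, aeval_X, aeval_X, ih _ (hW u hu), h u hu]

theorem pow_intertwine {M N : Type*} [AddCommGroup M] [Module k M] [AddCommGroup N] [Module k N]
    (f : M →ₗ[k] N) (D : Module.End k M) (E : Module.End k N) (h : ∀ u, f (D u) = E (f u))
    (n : ℕ) (u : M) : f ((D ^ n) u) = (E ^ n) (f u) := by
  simpa using aeval_intertwine f D E h (X ^ n) u

theorem Coupled.apply {φ ψ : k[X]} {R : Type v} [CommRing R] [Algebra k R]
    {q Q : Module.End k R} (h : Coupled (omega φ ψ) q Q) (x : R) :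
    q (Q x) = aeval q φ x + Q (aeval q ψ x) :=
  LinearMap.congr_fun ((coupled_omega_iff φ ψ q Q).1 h) x

variable (lam : k)

/-! ### Transport of operator identities along injections and surjections -/

section Transport

variable {lam} {R S : Type v} [CommRing R] [Algebra k R] [CommRing S] [Algebra k S]

/-- An operator is differential if an injective algebra homomorphism carries it to a differential
operator. -/
theorem IsDifferential.of_injective (i : R →ₐ[k] S) (hi : Function.Injective i)
    {d : Module.End k R} {D : Module.End k S} (hD : IsDifferential lam D)
    (h : ∀ x, i (d x) = D (i x)) : IsDifferential lam d := by
  refine ⟨hi ?_, fun x y => hi ?_⟩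
  · rw [h, map_one, hD.1, map_zero]
  · simp only [h, map_mul, map_add, map_smul, hD.2]

/-- An operator is a Rota-Baxter operator if a surjective algebra homomorphism carries a
Rota-Baxter operator to it. -/
theorem IsRotaBaxter.of_surjective (i : R →ₐ[k] S) (hi : Function.Surjective i)
    {P : Module.End k R} {Q : Module.End k S} (hP : IsRotaBaxter lam P)
    (h : ∀ x, i (P x) = Q (i x)) : IsRotaBaxter lam Q := by
  intro x y
  obtain ⟨x, rfl⟩ := hi x
  obtain ⟨y, rfl⟩ := hi y
  simp only [← h, ← map_mul, ← map_add, ← map_smul, hP x y]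

end Transport

/-! ### Maps into Hurwitz series and coalgebra structures -/

namespace Hurwitz

variable {A : Type v} [CommRing A] [Algebra k A]

theorem shift_pow_coeff (f : Hurwitz lam A) (n m : ℕ) :
    ((shift lam A ^ n) f).coeff m = f.coeff (m + n) := by
  induction n generalizing f m with
  | zero => rfl
  | succ n ih => rw [pow_succ', Module.End.mul_apply, shift_apply, ih]; congr 1; omega

/-- A linear map into Hurwitz series which intertwines an operator with the shift is determined by
its zeroth component. -/
theorem coeff_eq_of_intertwine {M : Type*} [AddCommGroup M] [Module k M]
    (h : M →ₗ[k] Hurwitz lam A) (d : Module.End k M) (hd : ∀ x, h (d x) = shift lam A (h x))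
    (x : M) (n : ℕ) : (h x).coeff n = (h ((d ^ n) x)).coeff 0 := by
  rw [pow_intertwine h d _ hd, shift_pow_coeff, zero_add]

/-- The uniqueness half of cofreeness: the n-th coefficient at x is the zeroth coefficient at dⁿ x.
It reduces equalities of homomorphisms into Hurwitz series to degree zero. -/
theorem eq_of_intertwine {M : Type v} [CommRing M] [Algebra k M]
    {h h' : M →ₐ[k] Hurwitz lam A} (d : Module.End k M)
    (hd : ∀ x, h (d x) = shift lam A (h x)) (hd' : ∀ x, h' (d x) = shift lam A (h' x))
    (h0 : ∀ x, (h x).coeff 0 = (h' x).coeff 0) : h = h' :=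
  AlgHom.ext fun x => ext' lam fun n => by
    rw [← AlgHom.toLinearMap_apply h, coeff_eq_of_intertwine lam h.toLinearMap d hd,
      ← AlgHom.toLinearMap_apply h', coeff_eq_of_intertwine lam h'.toLinearMap d hd']
    exact h0 _

theorem orbit_intertwine (d : Module.End k A) (hd : IsDifferential lam d) (x : A) :
    orbit lam d hd (d x) = shift lam A (orbit lam d hd x) :=
  ext' lam fun n => by
    rw [shift_apply, orbit_apply, orbit_apply, pow_succ, Module.End.mul_apply]

theorem map_intertwine {B : Type v} [CommRing B] [Algebra k B] (h : A →ₐ[k] B)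
    (f : Hurwitz lam A) : map lam h (shift lam A f) = shift lam B (map lam h f) := rfl

/-- An intertwining map is compatible with the coextension if it is so in degree zero. -/
theorem coext_intertwine (φ ψ : k[X]) {S : Type v} [CommRing S] [Algebra k S]
    {d P : Module.End k S} (hdP : Coupled (omega φ ψ) d P) (h : S →ₗ[k] Hurwitz lam A)
    (hd : ∀ x, h (d x) = shift lam A (h x)) (Q : Module.End k A)
    (h0 : ∀ x, (h (P x)).coeff 0 = Q ((h x).coeff 0)) (x : S) :
    h (P x) = coext lam φ ψ Q (h x) := by
  have key : ∀ n x, (h (P x)).coeff n = coextComp lam φ ψ Q n (h x) := by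
    intro n
    induction n with
    | zero => exact h0
    | succ n ih =>
      intro x
      -- Coefficient n + 1 of h(P x) is coefficient n of h(d P x). Expanding d P by the coupling
      -- gives the recursion of `coextComp`, with polynomials in d turned into polynomials in ∂.
      rw [← shift_apply, ← hd, hdP.apply, map_add, coeff_add, ih,
        aeval_intertwine h _ _ hd, aeval_intertwine h _ _ hd]
      rfl
  exact ext' lam fun n => key n x

theorem coext_apply_zero (φ ψ : k[X]) (Q : Module.End k A) (f : Hurwitz lam A) :
    (coext lam φ ψ Q f).coeff 0 = Q (f.coeff 0) := rfl

theorem coupled_coext (φ ψ : k[X]) (Q : Module.End k A) :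
    Coupled (omega φ ψ) (shift lam A) (coext lam φ ψ Q) :=
  ((eq_coext_iff lam φ ψ Q _).2 rfl).2

/-- The operator `x ↦ c(x)₁` attached to a homomorphism `c : A → A^ℕ`. -/
def first (c : A →ₐ[k] Hurwitz lam A) : Module.End k A := ev lam A 1 ∘ₗ c.toLinearMap

theorem first_apply (c : A →ₐ[k] Hurwitz lam A) (x : A) : first lam c x = (c x).coeff 1 := rfl

theorem first_orbit (d : Module.End k A) (hd : IsDifferential lam d) :
    first lam (orbit lam d hd) = d := LinearMap.ext fun x => by simp [first_apply]

-- The degree one part of a Hurwitz product is f₁g₀ + f₀g₁ + λf₁g₁. With c(x)₀ = x this is the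
-- product rule; coassociativity plays no role here.
variable {lam} in
theorem isDifferential_first {c : A →ₐ[k] Hurwitz lam A} (hc : ∀ x, (c x).coeff 0 = x) :
    IsDifferential lam (first lam c) := by
  refine ⟨?_, fun x y => ?_⟩
  · rw [first_apply, map_one, one_apply, if_neg one_ne_zero]
  · simp only [first_apply, map_mul]
    rw [mul_succ_apply lam _ _ 0, mul_zero_apply, mul_zero_apply, mul_zero_apply]
    simp only [shift_apply, zero_add, hc]

variable {lam} in
/-- A counital and coassociative homomorphism `A → A^ℕ` comes from a differential operator. -/
theorem eq_orbit {c : A →ₐ[k] Hurwitz lam A} (hc : ∀ x, (c x).coeff 0 = x)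
    (hc' : ∀ x n m, (c ((c x).coeff n)).coeff m = (c x).coeff (m + n)) :
    c = orbit lam (first lam c) (isDifferential_first hc) := by
  refine eq_of_intertwine lam (first lam c) (fun x => ext' lam fun n => ?_)
    (orbit_intertwine lam _ _) (fun x => by rw [hc]; rfl)
  -- Coassociativity at n = 1: c(c(x)₁) is the shift of c(x).
  rw [first_apply, hc', shift_apply]

end Hurwitz

/-! ### Maps out of free Rota–Baxter algebras and algebra structures -/

namespace Sha

variable {A : Type v} [CommRing A] [Algebra k A]

theorem map_comp_apply {B D : Type v} [CommRing B] [Algebra k B] [CommRing D] [Algebra k D]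
    (g : B →ₐ[k] D) (f : A →ₐ[k] B) (u : Sha lam A) :
    map lam g (map lam f u) = map lam (g.comp f) u := by
  have : (map lam g).comp (map lam f) = map lam (g.comp f) :=
    algHom_ext lam (fun a => by simp) (fun a u hu => by
      simp only [AlgHom.comp_apply] at hu
      simp [hu])
  exact DFunLike.congr_fun this u

theorem map_id_apply (u : Sha lam A) : map lam (AlgHom.id k A) u = u := by
  have : map lam (AlgHom.id k A) = AlgHom.id k (Sha lam A) :=
    algHom_ext lam (fun a => by simp) (fun a u hu => by
      simp only [AlgHom.id_apply] at hu
      simp [hu])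
  exact DFunLike.congr_fun this u

/-- Homomorphisms out of `Sha(A)` compatible with an operator agree if they agree on `A`. -/
theorem eq_of_intertwine {S : Type v} [CommRing S] [Algebra k S] {f g : Sha lam A →ₐ[k] S}
    (P : Module.End k S) (hf : ∀ u, f (opP lam A u) = P (f u))
    (hg : ∀ u, g (opP lam A u) = P (g u)) (h0 : ∀ a, f (emb lam A a) = g (emb lam A a)) :
    f = g :=
  algHom_ext lam h0 fun a u hu => by rw [cons_eq, map_mul, map_mul, h0, hf, hg, hu]

theorem eval_opP (P : Module.End k A) (hP : IsRotaBaxter lam P) (u : Sha lam A) :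
    eval lam P hP (opP lam A u) = P (eval lam P hP u) := by
  rw [opP_apply, eval_cons, one_mul]

/-- The submodule `A ⊕ A^{⊗2} ⊕ ⋯ ⊕ A^{⊗(n+2)}` is generated by `A` and the elements `a ⊗ u` with
`u` in `A ⊕ ⋯ ⊕ A^{⊗(n+1)}`. -/
theorem fil_succ_le {n : ℕ} {W : Submodule k (Sha lam A)} (h0 : ∀ a, emb lam A a ∈ W)
    (h1 : ∀ a, ∀ u ∈ fil lam A n, cons lam A a u ∈ W) : fil lam A (n + 1) ≤ W := by
  -- `fil_le` asks for a monotone family over all degrees; the value ⊤ beyond n + 1 makes the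
  -- condition empty there.
  have h := fil_le lam (N := fun m => if m ≤ n + 1 then W else ⊤)
    (fun a b hab => by
      dsimp only
      split_ifs with h1 h2 h2
      · exact le_rfl
      · exact le_top
      · omega
      · exact le_rfl)
    (fun a => by rw [if_pos (Nat.zero_le _)]; exact h0 a)
    (fun m a u hu _ => by
      split_ifs with hm
      · exact h1 a u (fil_mono lam (by omega) hu)
      · trivial) (n + 1)
  rwa [if_pos le_rfl] at h

theorem fil_zero_le {W : Submodule k (Sha lam A)} (h0 : ∀ a, emb lam A a ∈ W) :
    fil lam A 0 ≤ W :=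
  iSup₂_le fun j hj => by
    obtain rfl : j = 0 := by omega
    rintro _ ⟨t, rfl⟩
    exact h0 ((toTens A).symm t)

/-- A homomorphism out of `Sha(A)` into a differential algebra with a coupled operator is
compatible with the extension if it is so on `A`. -/
theorem extend_intertwine (φ ψ : k[X]) {S : Type v} [CommRing S] [Algebra k S]
    {D P : Module.End k S} (hD : IsDifferential lam D) (hDP : Coupled (omega φ ψ) D P)
    (i : Sha lam A →ₐ[k] S) (hP : ∀ u, i (opP lam A u) = P (i u)) (d : Module.End k A)
    (h0 : ∀ a, i (emb lam A (d a)) = D (i (emb lam A a))) (u : Sha lam A) :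
    i (extend lam φ ψ d u) = D (i u) := by
  have emb_case : ∀ a, emb lam A a ∈
      LinearMap.eqLocus (i.toLinearMap ∘ₗ extend lam φ ψ d) (D ∘ₗ i.toLinearMap) := fun a => by
    simp [LinearMap.mem_eqLocus, ext_emb, h0]
  have key : ∀ n, fil lam A n ≤
      LinearMap.eqLocus (i.toLinearMap ∘ₗ extend lam φ ψ d) (D ∘ₗ i.toLinearMap) := by
    intro n
    induction n with
    | zero => exact fil_zero_le lam emb_case
    | succ n ih =>
      refine fil_succ_le lam emb_case fun a u hu => ?_
      -- The value of d̂ at a ⊗ u involves all powers of d̂ at u, so an induction hypothesis about u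
      -- alone would not suffice. The induction runs over the filtration because each of its terms
      -- is stable under d̂.
      have e := fun p => aeval_intertwine_of_mem i.toLinearMap (extend lam φ ψ d) D (fil lam A n)
        (ext_mem_fil lam φ ψ d n) (fun u hu => ih hu) p u hu
      simp only [AlgHom.toLinearMap_apply] at e
      simp only [LinearMap.mem_eqLocus, LinearMap.comp_apply, AlgHom.toLinearMap_apply]
      -- With a ⊗ u = a P(u), both sides become D(ia) P(iu) + (ia + λ D(ia)) (φ(D) + P ψ(D))(iu). On
      -- the right this is the product rule for D at ia · P(iu), followed by the coupling.
      rw [ext_cons, cons_eq, cons_eq, map_add (emb lam A), map_smul (emb lam A), map_add i,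
        map_mul i, map_mul i, map_mul i, hD.2, hP, hDP.apply, map_add i, map_add i, map_smul i, hP,
        e, e, h0]
      simp only [add_mul, mul_add, smul_mul_assoc, smul_add]
      abel
  obtain ⟨n, hn⟩ := exists_mem_fil lam u
  exact key n hn

/-- The operator `x ↦ a(1 ⊗ x)` attached to a homomorphism `a : Sha(A) → A`. -/
def structOp (a : Sha lam A →ₐ[k] A) : Module.End k A :=
  a.toLinearMap ∘ₗ opP lam A ∘ₗ emb lam A

theorem structOp_apply (a : Sha lam A →ₐ[k] A) (x : A) :
    structOp lam a x = a (opP lam A (emb lam A x)) := rfl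

theorem structOp_eval (P : Module.End k A) (hP : IsRotaBaxter lam P) :
    structOp lam (eval lam P hP) = P := LinearMap.ext fun x => by
  rw [structOp_apply, eval_opP, eval_emb]

/-- The multiplication of the monad `Sha`. -/
abbrev join (A : Type v) [CommRing A] [Algebra k A] : Sha lam (Sha lam A) →ₐ[k] Sha lam A :=
  eval lam (opP lam A) (isRotaBaxter_opP lam A)

-- Associativity tested on 1 ⊗ u in Ш(Ш(A)): the multiplication sends it to P_A(u), while Ш(a) sends
-- it to 1 ⊗ a(u).
variable {lam} in
theorem structOp_intertwine {a : Sha lam A →ₐ[k] A} (ha' : ∀ u, a (join lam A u) = a (map lam a u))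
    (u : Sha lam A) : a (opP lam A u) = structOp lam a (a u) := by
  have := ha' (opP lam _ (emb lam _ u))
  rwa [eval_opP, eval_emb, map_opP, map_emb] at this

-- By the unit law a is surjective, and it carries P_A to the operator in question, so the
-- Rota–Baxter identity descends from Ш(A).
variable {lam} in
theorem isRotaBaxter_structOp {a : Sha lam A →ₐ[k] A} (ha : ∀ x, a (emb lam A x) = x)
    (ha' : ∀ u, a (join lam A u) = a (map lam a u)) : IsRotaBaxter lam (structOp lam a) :=
  (isRotaBaxter_opP lam A).of_surjective a (fun x => ⟨_, ha x⟩) (structOp_intertwine ha')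

variable {lam} in
/-- An algebra over the monad `Sha` comes from a Rota-Baxter operator. -/
theorem eq_eval {a : Sha lam A →ₐ[k] A} (ha : ∀ x, a (emb lam A x) = x)
    (ha' : ∀ u, a (join lam A u) = a (map lam a u)) :
    a = eval lam (structOp lam a) (isRotaBaxter_structOp ha ha') :=
  eq_of_intertwine lam (structOp lam a) (structOp_intertwine ha') (eval_opP lam _ _)
    fun x => by rw [ha, eval_emb]

end Sha

/-! ### From coextensions to extensions -/

variable {lam} {φ ψ : k[X]}

/-- If the coextensions of Rota-Baxter operators are Rota-Baxter operators, then the extensions of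
differential operators are differential operators. -/
theorem isDifferential_extend_of_isRotaBaxter_coext
    (H : ∀ (R : Type v) [CommRing R] [Algebra k R] (P : Module.End k R),
      IsRotaBaxter lam P → IsRotaBaxter lam (Hurwitz.coext lam φ ψ P))
    (R : Type v) [CommRing R] [Algebra k R] (d : Module.End k R) (hd : IsDifferential lam d) :
    IsDifferential lam (Sha.extend lam φ ψ d) := by
  have hP := H (Sha lam R) (Sha.opP lam R) (Sha.isRotaBaxter_opP lam R)
  set P := Hurwitz.coext lam φ ψ (Sha.opP lam R)
  -- The Rota–Baxter homomorphism induced by R → R^ℕ → Ш(R)^ℕ. The hypothesis `H` enters here: the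
  -- target is a Rota–Baxter algebra under the coextension of P_R.
  let i : Sha lam R →ₐ[k] Hurwitz lam (Sha lam R) := (Sha.eval lam P hP).comp
    (Sha.map lam ((Hurwitz.map lam (Sha.unit lam R)).comp (Hurwitz.orbit lam d hd)))
  have hiP : ∀ u, i (Sha.opP lam R u) = P (i u) := fun u => by
    simp only [i, AlgHom.comp_apply, Sha.map_opP, Sha.eval_opP]
  have hi : ∀ a, i (Sha.emb lam R a) =
      Hurwitz.map lam (Sha.unit lam R) (Hurwitz.orbit lam d hd a) := fun a => by
    simp only [i, AlgHom.comp_apply, Sha.map_emb, Sha.eval_emb]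
  -- The counit carries P̂ to P_R, so the composite is an endomorphism of the free Rota–Baxter
  -- algebra that fixes R. It is the identity, hence i is injective.
  have hi0 : (Hurwitz.counit lam (Sha lam R)).comp i = AlgHom.id k _ :=
    Sha.eq_of_intertwine lam (Sha.opP lam R) (fun u => by
      simp only [AlgHom.comp_apply, hiP]; rfl) (fun u => rfl) (fun a => by
      simp [hi])
  refine IsDifferential.of_injective i (fun x y hxy => ?_) (Hurwitz.isDifferential_shift lam _)
    (Sha.extend_intertwine lam φ ψ (Hurwitz.isDifferential_shift lam _)
      (Hurwitz.coupled_coext lam φ ψ _) i hiP d fun a => ?_)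
  · exact (DFunLike.congr_fun hi0 x).symm.trans
      ((congrArg (Hurwitz.counit lam _) hxy).trans (DFunLike.congr_fun hi0 y))
  · rw [hi, hi, Hurwitz.orbit_intertwine, Hurwitz.map_intertwine]

/-! ### The mixed distributive law on elements -/

/-- The homomorphism `Sha(A^ℕ) → Sha(A)^ℕ`, `u ↦ (Sha(ε)(∂̂ⁿ u))ₙ`, where `∂̂` is the extension of
the shift. -/
def distrib (φ ψ : k[X]) (A : Type v) [CommRing A] [Algebra k A]
    (h : IsDifferential lam (Sha.extend lam φ ψ (Hurwitz.shift lam A))) :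
    Sha lam (Hurwitz lam A) →ₐ[k] Hurwitz lam (Sha lam A) :=
  (Hurwitz.map lam (Sha.map lam (Hurwitz.counit lam A))).comp (Hurwitz.orbit lam _ h)

section Distrib

variable {A : Type v} [CommRing A] [Algebra k A]
  (h : IsDifferential lam (Sha.extend lam φ ψ (Hurwitz.shift lam A)))

theorem distrib_coeff_zero (u : Sha lam (Hurwitz lam A)) :
    (distrib φ ψ A h u).coeff 0 = Sha.map lam (Hurwitz.counit lam A) u := rfl

theorem distrib_intertwine (u : Sha lam (Hurwitz lam A)) :
    distrib φ ψ A h (Sha.extend lam φ ψ (Hurwitz.shift lam A) u) =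
      Hurwitz.shift lam _ (distrib φ ψ A h u) := by
  simp only [distrib, AlgHom.comp_apply, Hurwitz.orbit_intertwine, Hurwitz.map_intertwine]

/-- The unit axiom. On A^ℕ the extension of ∂ is ∂ itself, so both sides intertwine shifts and only
degree zero has to be compared. -/
theorem distrib_emb (f : Hurwitz lam A) :
    distrib φ ψ A h (Sha.emb lam _ f) = Hurwitz.map lam (Sha.unit lam A) f :=
  DFunLike.congr_fun (Hurwitz.eq_of_intertwine lam
    (h := (distrib φ ψ A h).comp (Sha.unit lam _)) (Hurwitz.shift lam A)
    (fun x => by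
      simp only [AlgHom.comp_apply, Sha.unit_apply]
      rw [← distrib_intertwine, Sha.ext_emb])
    (fun x => Hurwitz.map_intertwine lam _ x)
    (fun x => by simp [distrib_coeff_zero])) f

/-- The form of cofreeness used for naturality, multiplication and the induced coalgebra structure:
once g and g' respect the operators, only degree zero, where the distributive law is Ш(ε), remains.
-/
theorem distrib_eq_of_intertwine {S : Type v} [CommRing S] [Algebra k S] {d : Module.End k S}
    {g : S →ₐ[k] Sha lam (Hurwitz lam A)} {g' : S →ₐ[k] Hurwitz lam (Sha lam A)}
    (hg : ∀ x, g (d x) = Sha.extend lam φ ψ (Hurwitz.shift lam A) (g x))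
    (hg' : ∀ x, g' (d x) = Hurwitz.shift lam _ (g' x))
    (h0 : ∀ x, Sha.map lam (Hurwitz.counit lam A) (g x) = (g' x).coeff 0) (x : S) :
    distrib φ ψ A h (g x) = g' x :=
  DFunLike.congr_fun (Hurwitz.eq_of_intertwine lam (h := (distrib φ ψ A h).comp g) d
    (fun x => by rw [AlgHom.comp_apply, hg, distrib_intertwine]; rfl) hg' h0) x

theorem map_orbit_intertwine {d : Module.End k A} (hd : IsDifferential lam d) (u : Sha lam A) :
    Sha.map lam (Hurwitz.orbit lam d hd) (Sha.extend lam φ ψ d u) =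
      Sha.extend lam φ ψ (Hurwitz.shift lam A) (Sha.map lam (Hurwitz.orbit lam d hd) u) :=
  Sha.map_ext lam φ ψ _ _ _ (Hurwitz.orbit_intertwine lam d hd) u

theorem map_counit_map_orbit {d : Module.End k A} (hd : IsDifferential lam d) (u : Sha lam A) :
    Sha.map lam (Hurwitz.counit lam A) (Sha.map lam (Hurwitz.orbit lam d hd) u) = u := by
  rw [Sha.map_comp_apply,
    show (Hurwitz.counit lam A).comp (Hurwitz.orbit lam d hd) = AlgHom.id k A from rfl,
    Sha.map_id_apply]

/-- The coalgebra structure on `Sha(A)` given by `distrib` is that of the extension. -/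
theorem distrib_map_orbit {d : Module.End k A} (hd : IsDifferential lam d)
    (hd' : IsDifferential lam (Sha.extend lam φ ψ d)) (u : Sha lam A) :
    distrib φ ψ A h (Sha.map lam (Hurwitz.orbit lam d hd) u) = Hurwitz.orbit lam _ hd' u :=
  distrib_eq_of_intertwine h (d := Sha.extend lam φ ψ d) (map_orbit_intertwine hd)
    (Hurwitz.orbit_intertwine lam _ hd') (map_counit_map_orbit hd) u

theorem distrib_naturality {B : Type v} [CommRing B] [Algebra k B]
    (h' : IsDifferential lam (Sha.extend lam φ ψ (Hurwitz.shift lam B))) (f : A →ₐ[k] B)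
    (u : Sha lam (Hurwitz lam A)) :
    distrib φ ψ B h' (Sha.map lam (Hurwitz.map lam f) u) =
      Hurwitz.map lam (Sha.map lam f) (distrib φ ψ A h u) :=
  distrib_eq_of_intertwine h' (d := Sha.extend lam φ ψ (Hurwitz.shift lam A))
    (g' := (Hurwitz.map lam (Sha.map lam f)).comp (distrib φ ψ A h))
    (Sha.map_ext lam φ ψ _ _ _ (Hurwitz.map_intertwine lam f))
    (fun x => by rw [AlgHom.comp_apply, distrib_intertwine]; rfl)
    (fun x => by
      rw [AlgHom.comp_apply, Hurwitz.map_apply, distrib_coeff_zero, Sha.map_comp_apply,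
        Sha.map_comp_apply]
      rfl) u

/-- The comultiplication is θ for the operator ∂, so by `distrib_map_orbit` the inner composite on
the right is θ for ∂̂. What remains is naturality of θ along the distributive law, which intertwines
∂̂ with ∂. -/
theorem distrib_comul
    (h' : IsDifferential lam (Sha.extend lam φ ψ (Hurwitz.shift lam (Hurwitz lam A))))
    (u : Sha lam (Hurwitz lam A)) :
    Hurwitz.orbit lam _ (Hurwitz.isDifferential_shift lam (Sha lam A)) (distrib φ ψ A h u) =
      Hurwitz.map lam (distrib φ ψ A h) (distrib φ ψ (Hurwitz lam A) h'
        (Sha.map lam (Hurwitz.orbit lam _ (Hurwitz.isDifferential_shift lam A)) u)) := by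
  rw [distrib_map_orbit h' _ h]
  exact DFunLike.congr_fun (Hurwitz.eq_of_intertwine lam
    (h := (Hurwitz.orbit lam _ (Hurwitz.isDifferential_shift lam (Sha lam A))).comp
      (distrib φ ψ A h))
    (h' := (Hurwitz.map lam (distrib φ ψ A h)).comp (Hurwitz.orbit lam _ h))
    (Sha.extend lam φ ψ (Hurwitz.shift lam A))
    (fun x => by
      simp only [AlgHom.comp_apply, distrib_intertwine, Hurwitz.orbit_intertwine])
    (fun x => by
      simp only [AlgHom.comp_apply, Hurwitz.map_intertwine, Hurwitz.orbit_intertwine])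
    (fun x => rfl)) u

/-- The multiplication is a Rota–Baxter homomorphism and restricts to the identity on the inner
Ш(A). As d̂ is differential and coupled to P_A, agreement on these generators is enough. -/
theorem join_intertwine {d : Module.End k A} (hd : IsDifferential lam d)
    (hd' : IsDifferential lam (Sha.extend lam φ ψ d)) (u : Sha lam (Sha lam A)) :
    Sha.join lam A (Sha.extend lam φ ψ (Sha.extend lam φ ψ d) u) =
      Sha.extend lam φ ψ d (Sha.join lam A u) :=
  Sha.extend_intertwine lam φ ψ hd' (Sha.coupled_ext lam φ ψ hd.1) _ (Sha.eval_opP lam _ _) _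
    (fun a => by rw [Sha.eval_emb, Sha.eval_emb]) u

theorem map_join {B : Type v} [CommRing B] [Algebra k B] (f : A →ₐ[k] B)
    (u : Sha lam (Sha lam A)) :
    Sha.map lam f (Sha.join lam A u) = Sha.join lam B (Sha.map lam (Sha.map lam f) u) :=
  DFunLike.congr_fun (Sha.eq_of_intertwine lam (f := (Sha.map lam f).comp (Sha.join lam A))
    (g := (Sha.join lam B).comp (Sha.map lam (Sha.map lam f))) (Sha.opP lam B)
    (fun u => by simp only [AlgHom.comp_apply, Sha.eval_opP, Sha.map_opP])
    (fun u => by simp only [AlgHom.comp_apply, Sha.eval_opP, Sha.map_opP])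
    (fun a => by simp only [AlgHom.comp_apply, Sha.eval_emb, Sha.map_emb])) u

/-- Both sides intertwine the twofold extension of ∂ with the shift, and in degree zero the claim is
naturality of the multiplication along ε. The twofold extension enters only as an operator, so its
product rule is not required. -/
theorem distrib_join
    (h' : IsDifferential lam (Sha.extend lam φ ψ (Hurwitz.shift lam (Sha lam A))))
    (u : Sha lam (Sha lam (Hurwitz lam A))) :
    distrib φ ψ A h (Sha.join lam _ u) =
      Hurwitz.map lam (Sha.join lam A)
        (distrib φ ψ (Sha lam A) h' (Sha.map lam (distrib φ ψ A h) u)) :=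
  distrib_eq_of_intertwine h
    (d := Sha.extend lam φ ψ (Sha.extend lam φ ψ (Hurwitz.shift lam A)))
    (g' := (Hurwitz.map lam (Sha.join lam A)).comp ((distrib φ ψ (Sha lam A) h').comp
      (Sha.map lam (distrib φ ψ A h))))
    (join_intertwine (Hurwitz.isDifferential_shift lam A) h)
    (fun x => by
      simp only [AlgHom.comp_apply]
      rw [Sha.map_ext lam φ ψ _ _ _ (distrib_intertwine h), distrib_intertwine,
        Hurwitz.map_intertwine])
    (fun x => by
      simp only [AlgHom.comp_apply, Hurwitz.map_apply]
      rw [distrib_coeff_zero, Sha.map_comp_apply, map_join]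
      rfl) u

end Distrib

/-! ### From extensions to coextensions -/

/-- If the extensions of differential operators are differential operators, then the coextensions
of Rota-Baxter operators are Rota-Baxter operators. -/
theorem isRotaBaxter_coext_of_isDifferential_extend
    (H : ∀ (R : Type v) [CommRing R] [Algebra k R] (d : Module.End k R),
      IsDifferential lam d → IsDifferential lam (Sha.extend lam φ ψ d))
    (R : Type v) [CommRing R] [Algebra k R] (P : Module.End k R) (hP : IsRotaBaxter lam P) :
    IsRotaBaxter lam (Hurwitz.coext lam φ ψ P) := by
  have hd := Hurwitz.isDifferential_shift lam R
  -- In degree zero Ξ is ϑ ∘ Ш(ε), which carries P_{R^ℕ} to P; hence Ξ carries P_{R^ℕ} to the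
  -- coextension of P. Multiplicativity of Ξ rests on ∂̂ being differential.
  let Ξ : Sha lam (Hurwitz lam R) →ₐ[k] Hurwitz lam R :=
    (Hurwitz.map lam (Sha.eval lam P hP)).comp (distrib φ ψ R (H _ _ hd))
  refine (Sha.isRotaBaxter_opP lam (Hurwitz lam R)).of_surjective Ξ
    (fun f => ⟨Sha.emb lam _ f, ?_⟩)
    (Hurwitz.coext_intertwine lam φ ψ (Sha.coupled_ext lam φ ψ hd.1) Ξ.toLinearMap
      (fun u => ?_) P fun u => ?_)
  -- Surjectivity: the embedding of R^ℕ in Ш(R^ℕ) is a section of Ξ.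
  · simp only [Ξ, AlgHom.comp_apply, distrib_emb]
    exact Hurwitz.ext' lam fun n => by simp
  · simp only [Ξ, AlgHom.toLinearMap_apply, AlgHom.comp_apply, distrib_intertwine,
      Hurwitz.map_intertwine]
  · simp only [Ξ, AlgHom.toLinearMap_apply, AlgHom.comp_apply, Hurwitz.map_apply,
      distrib_coeff_zero, Sha.map_opP, Sha.eval_opP]

end

/-! ### Isomorphisms of categories and (co)free objects -/

noncomputable section Categories

section General

universe v₁ v₂ v₃ u₁ u₂ u₃

variable {A : Type u₁} [Category.{v₁} A] {B : Type u₂} [Category.{v₂} B]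
  {D : Type u₃} [Category.{v₃} D]

/-- A fully faithful functor which is bijective on objects is an isomorphism of categories. -/
theorem IsCatIso.of_bijective (F : D ⥤ B) [F.Full] [F.Faithful] (g : B → D)
    (hg : ∀ X, g (F.obj X) = X) (hg' : ∀ Y, F.obj (g Y) = Y) : IsCatIso F := by
  -- Conjugating by the object equalities before lifting through fullness makes both composites
  -- strictly equal to identity functors.
  let G : B ⥤ D :=
    { obj := g
      map := fun {X Y} f => F.preimage (eqToHom (hg' X) ≫ f ≫ eqToHom (hg' Y).symm)
      map_id := fun X => F.map_injective (by simp)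
      map_comp := fun f f' => F.map_injective (by simp) }
  refine ⟨G, CategoryTheory.Functor.ext hg fun X Y f => F.map_injective ?_, CategoryTheory.Functor.ext hg' fun X Y f => ?_⟩
  · simp [G, eqToHom_map]
  · simp [G]

/-- The free algebra on `X`, seen in `D` through the isomorphism `K`. -/
theorem IsAlgebraIso.exists_free {U : B ⥤ A} {T : CategoryTheory.Monad A}
    {T' : CategoryTheory.Monad B} {hT : IsMonadLift U T T'} {V : D ⥤ B}
    {ϑ : ∀ X : D, T.obj (U.obj (V.obj X)) ⟶ U.obj (V.obj X)} {K : D ⥤ T'.Algebra}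
    (h : IsAlgebraIso hT V ϑ K) (X : B) :
    ∃ (Y : D) (m : X ⟶ V.obj Y) (i : T.obj (U.obj X) ≅ U.obj (V.obj Y)),
      U.map m = T.η.app (U.obj X) ≫ i.hom ∧
        T.μ.app (U.obj X) ≫ i.hom = T.map i.hom ≫ ϑ Y := by
  obtain ⟨G, -, hG⟩ := h.isIso
  -- The structure equation is stated for any Z equal to K(Y), so that it can be moved to the free
  -- algebra by eliminating an equality between variables.
  have str : ∀ (Y : D) (Z : T'.Algebra) (e : K.obj Y = Z) (e₁ : Z.A = V.obj Y)
      (e₂ : U.obj (T'.obj Z.A) = T.obj (U.obj (V.obj Y))),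
      U.map Z.a ≫ eqToHom (congrArg U.obj e₁) = eqToHom e₂ ≫ ϑ Y := by
    rintro Y _ rfl e₁ e₂
    exact h.str Y
  have hY : K.obj (G.obj (T'.free.obj X)) = T'.free.obj X := Functor.congr_obj hG _
  set Y := G.obj (T'.free.obj X)
  have hA : T'.obj X = V.obj Y :=
    (congrArg (fun Z : T'.Algebra => Z.A) hY).symm.trans (Functor.congr_obj h.comp_forget Y)
  have hX : U.obj (T'.obj X) = T.obj (U.obj X) := Functor.congr_obj hT.comp X
  -- The two resulting equations mention T only: m lies over the unit, and i is an isomorphism from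
  -- the free T-algebra to ϑ. This lets the lifting to DIF and the lifting to coalgebras be treated
  -- alike.
  refine ⟨Y, T'.η.app X ≫ eqToHom hA, eqToIso (hX.symm.trans (congrArg U.obj hA)), ?_, ?_⟩
  · rw [← hT.η]
    simp [eqToHom_map]
  · have hs := str Y _ hY hA ((Functor.congr_obj hT.comp (T'.obj X)).trans
      (congrArg (fun Y => T.obj (U.obj Y)) hA))
    have hμ := hT.μ X
    change U.map (T'.μ.app X) ≫ _ = _ at hs
    rw [← cancel_epi (eqToHom ((Functor.congr_obj hT.comp (T'.obj X)).trans
      (congrArg T.obj hX))), ← Category.assoc, ← hμ]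
    simp only [eqToIso.hom, eqToHom_map, Category.assoc, eqToHom_trans, eqToHom_trans_assoc]
    exact hs

/-- The cofree coalgebra on `X`, seen in `D` through the isomorphism `H`. -/
theorem IsCoalgebraIso.exists_cofree {U : B ⥤ A} {C : Comonad A}
    {C' : Comonad B} {hC : IsComonadLift U C C'} {V : D ⥤ B}
    {θ : ∀ X : D, U.obj (V.obj X) ⟶ C.obj (U.obj (V.obj X))} {H : D ⥤ C'.Coalgebra}
    (h : IsCoalgebraIso hC V θ H) (X : B) :
    ∃ (Y : D) (m : V.obj Y ⟶ X) (i : C.obj (U.obj X) ≅ U.obj (V.obj Y)),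
      i.hom ≫ U.map m = C.ε.app (U.obj X) ∧
        C.δ.app (U.obj X) ≫ C.map i.hom = i.hom ≫ θ Y := by
  obtain ⟨G, -, hG⟩ := h.isIso
  have str : ∀ (Y : D) (Z : C'.Coalgebra) (e : H.obj Y = Z) (e₁ : Z.A = V.obj Y)
      (e₂ : U.obj (C'.obj Z.A) = C.obj (U.obj (V.obj Y))),
      U.map Z.a ≫ eqToHom e₂ = eqToHom (congrArg U.obj e₁) ≫ θ Y := by
    rintro Y _ rfl e₁ e₂
    exact h.str Y
  have hY : H.obj (G.obj (C'.cofree.obj X)) = C'.cofree.obj X := Functor.congr_obj hG _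
  set Y := G.obj (C'.cofree.obj X)
  have hA : C'.obj X = V.obj Y :=
    (congrArg (fun Z : C'.Coalgebra => Z.A) hY).symm.trans (Functor.congr_obj h.comp_forget Y)
  have hX : U.obj (C'.obj X) = C.obj (U.obj X) := Functor.congr_obj hC.comp X
  refine ⟨Y, eqToHom hA.symm ≫ C'.ε.app X, eqToIso (hX.symm.trans (congrArg U.obj hA)), ?_, ?_⟩
  · rw [U.map_comp, hC.ε]
    simp [eqToHom_map]
  · have hs := str Y _ hY hA ((Functor.congr_obj hC.comp (C'.obj X)).trans
      (congrArg (fun Y => C.obj (U.obj Y)) hA))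
    have hδ := hC.δ X
    change U.map (C'.δ.app X) ≫ _ = _ at hs
    rw [← cancel_epi (eqToHom hX), ← Category.assoc, ← hδ]
    simp only [eqToIso.hom, eqToHom_map, Category.assoc, eqToHom_trans, eqToHom_trans_assoc]
    exact hs

end General
end Categories

/-! ### Recovering (i) and (ii) from the categorical statements -/

noncomputable section Consequences

variable {k : Type u} [CommRing k] {lam : k} {φ ψ : k[X]}

/-- An injective homomorphism from `Sha(R)` to a differential Rota-Baxter algebra which commutes
with the Rota-Baxter operators and extends a homomorphism of differential algebras on `R` forces the
extension of the operator of `R` to be a differential operator. -/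
theorem isDifferential_extend_of_iso {X : DIF.{u, v} lam} {Y : DRB.{u, v} lam (omega φ ψ)}
    (i : (monadT lam).obj X.obj.alg ≅ Y.obj.alg)
    (hη : ∀ x, i.hom.hom (Sha.emb lam _ (X.obj.op x)) = Y.obj.op₁ (i.hom.hom (Sha.emb lam _ x)))
    (hμ : (monadT lam).μ.app X.obj.alg ≫ i.hom =
      (monadT lam).map i.hom ≫ evalMap lam (omega φ ψ) Y) :
    IsDifferential lam (Sha.extend lam φ ψ X.obj.op) := by
  let j : Sha lam X.obj.alg →ₐ[k] Y.obj.alg := i.hom.hom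
  have hμ' : ∀ u, j (Sha.join lam _ u) =
      Sha.eval lam Y.obj.op₂ Y.property.2.1 (Sha.map lam j u) := fun u =>
    DFunLike.congr_fun (congrArg CommAlgCat.Hom.hom hμ) u
  have hinj : Function.Injective j := (CommAlgCat.algEquivOfIso i).injective
  refine IsDifferential.of_injective j hinj Y.property.1
    (Sha.extend_intertwine lam φ ψ Y.property.1 Y.property.2.2 j (fun u => ?_) X.obj.op hη)
  -- Compatibility with the multiplications, tested on 1 ⊗ u in Ш(Ш(R)), says that j commutes with
  -- the Rota–Baxter operators.
  have := hμ' (Sha.opP lam _ (Sha.emb lam _ u))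
  rwa [Sha.eval_opP, Sha.eval_emb, Sha.map_opP, Sha.eval_opP, Sha.map_emb, Sha.eval_emb] at this

/-- Apply the previous criterion to the free T'-algebra on (R, d). Its unit is a morphism of DIF
lying over the embedding of R, which gives the compatibility with d on generators. -/
theorem isDifferential_extend_of_isAlgebraIso {T' : CategoryTheory.Monad (DIF.{u, v} lam)}
    {hT : IsMonadLift (DIF.forgetOp lam) (monadT lam) T'}
    {K : DRB.{u, v} lam (omega φ ψ) ⥤ T'.Algebra}
    (h : IsAlgebraIso hT (DRB.toDIF lam (omega φ ψ)) (evalMap lam (omega φ ψ)) K)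
    (R : Type v) [CommRing R] [Algebra k R] (d : Module.End k R) (hd : IsDifferential lam d) :
    IsDifferential lam (Sha.extend lam φ ψ d) := by
  obtain ⟨Y, m, i, hm, hμ⟩ := h.exists_free ⟨⟨CommAlgCat.of k R, d⟩, hd⟩
  refine isDifferential_extend_of_iso (X := ⟨⟨CommAlgCat.of k R, d⟩, hd⟩) (Y := Y) i
    (fun x => ?_) hμ
  have hm' : ∀ x : R, m.hom.hom.hom x = i.hom.hom (Sha.emb lam R x) :=
    DFunLike.congr_fun (congrArg CommAlgCat.Hom.hom hm)
  exact ((hm' (d x)).symm.trans (m.hom.comm x)).trans (congrArg Y.obj.op₁ (hm' x))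

/-- Now the free algebra is taken on the coalgebra ⟨R, θ⟩, and its unit is a coalgebra morphism.
Degree one of the coalgebra condition says that it commutes with the differential operators. -/
theorem isDifferential_extend_of_mixedDistribLaw
    {b : MixedDistribLaw (monadT.{u, v} lam) (comonadC lam)}
    {K : DRB.{u, v} lam (omega φ ψ) ⥤ b.liftMonad.Algebra}
    (h : IsAlgebraIso b.liftMonad_isMonadLift
      (DRB.toDIF lam (omega φ ψ) ⋙ Comonad.comparison (hurwitzAdj lam))
      (evalMap lam (omega φ ψ)) K)
    (R : Type v) [CommRing R] [Algebra k R] (d : Module.End k R) (hd : IsDifferential lam d) :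
    IsDifferential lam (Sha.extend lam φ ψ d) := by
  let X : DIF.{u, v} lam := ⟨⟨CommAlgCat.of k R, d⟩, hd⟩
  obtain ⟨Y, m, i, hm, hμ⟩ := h.exists_free ((Comonad.comparison (hurwitzAdj lam)).obj X)
  refine isDifferential_extend_of_iso (X := X) (Y := Y) i (fun x => ?_) hμ
  have hm' : ∀ x : R, m.f.hom x = i.hom.hom (Sha.emb lam R x) :=
    DFunLike.congr_fun (congrArg CommAlgCat.Hom.hom hm)
  have hc : ∀ x : R, Hurwitz.map lam m.f.hom (Hurwitz.orbit lam d hd x) =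
      Hurwitz.orbit lam Y.obj.op₁ Y.property.1 (m.f.hom x) :=
    DFunLike.congr_fun (congrArg CommAlgCat.Hom.hom m.h)
  have h1 : m.f.hom ((d ^ 1) x) = (Y.obj.op₁ ^ 1) (m.f.hom x) :=
    congrArg (fun f => f.coeff 1) (hc x)
  rw [pow_one, pow_one] at h1
  exact ((hm' (d x)).symm.trans h1).trans (congrArg Y.obj.op₁ (hm' x))

/-- The cofree coalgebra on (R, P) is an object of DRB_ω with underlying algebra R^ℕ up to e. Its
differential operator is ∂, its Rota–Baxter operator lies over P in degree zero, and the coupling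
then forces the latter to be the coextension. -/
theorem isRotaBaxter_coext_of_isCoalgebraIso {C' : Comonad (RBA.{u, v} lam)}
    {hC : IsComonadLift (RBA.forgetOp lam) (comonadC lam) C'}
    {H : DRB.{u, v} lam (omega φ ψ) ⥤ C'.Coalgebra}
    (h : IsCoalgebraIso hC (DRB.toRBA lam (omega φ ψ)) (orbitMap lam (omega φ ψ)) H)
    (R : Type v) [CommRing R] [Algebra k R] (P : Module.End k R) (hP : IsRotaBaxter lam P) :
    IsRotaBaxter lam (Hurwitz.coext lam φ ψ P) := by
  obtain ⟨Y, m, i, hm, hδ⟩ := h.exists_cofree ⟨⟨CommAlgCat.of k R, P⟩, hP⟩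
  let e : Hurwitz lam R ≃ₐ[k] Y.obj.alg := CommAlgCat.algEquivOfIso i
  have hm' : ∀ f : Hurwitz lam R, m.hom.hom.hom (e f) = f.coeff 0 :=
    DFunLike.congr_fun (congrArg CommAlgCat.Hom.hom hm)
  have hδ' : ∀ f : Hurwitz lam R, Hurwitz.map lam (e : Hurwitz lam R →ₐ[k] Y.obj.alg)
      (Hurwitz.orbit lam _ (Hurwitz.isDifferential_shift lam R) f) =
      Hurwitz.orbit lam Y.obj.op₁ Y.property.1 (e f) :=
    DFunLike.congr_fun (congrArg CommAlgCat.Hom.hom hδ)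
  -- Degree one of the compatibility of e with the comultiplication and θ.
  have hd : ∀ f, e (Hurwitz.shift lam R f) = Y.obj.op₁ (e f) := fun f => by
    have h1 : e ((Hurwitz.shift lam R ^ 1) f) = (Y.obj.op₁ ^ 1) (e f) :=
      congrArg (fun f => f.coeff 1) (hδ' f)
    rwa [pow_one, pow_one] at h1
  refine Y.property.2.1.of_surjective (e.symm : Y.obj.alg →ₐ[k] Hurwitz lam R) e.symm.surjective
    (Hurwitz.coext_intertwine lam φ ψ Y.property.2.2 e.symm.toLinearMap (fun x => ?_) P fun x => ?_)
  · obtain ⟨f, rfl⟩ := e.surjective x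
    rw [← hd]
    simp
  · obtain ⟨f, rfl⟩ := e.surjective x
    -- Since m is a morphism of RBA and m ∘ e is the counit, this is the degree zero condition for
    -- the coextension.
    have hmP : m.hom.hom.hom (Y.obj.op₂ (e f)) = P (m.hom.hom.hom (e f)) := m.hom.comm (e f)
    rw [hm', ← e.apply_symm_apply (Y.obj.op₂ (e f)), hm'] at hmP
    simpa using hmP

end Consequences

/-! ### Coupling in terms of θ and ϑ, and the lifted comonad -/

noncomputable section Constructions

variable {k : Type u} [CommRing k] {lam : k} {φ ψ : k[X]}

/-- Faithfulness lets every axiom of a lifted structure be read off from the corresponding axiom on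
ALG. -/
theorem forgetOp_dif_map_injective {X Y : DIF.{u, v} lam} {f g : X ⟶ Y}
    (h : (DIF.forgetOp lam).map f = (DIF.forgetOp lam).map g) : f = g :=
  ObjectProperty.hom_ext _ (OpAlg.hom_ext h)

theorem forgetOp_rba_map_injective {X Y : RBA.{u, v} lam} {f g : X ⟶ Y}
    (h : (RBA.forgetOp lam).map f = (RBA.forgetOp lam).map g) : f = g :=
  ObjectProperty.hom_ext _ (OpAlg.hom_ext h)

theorem Hurwitz.map_orbit {A B : Type v} [CommRing A] [Algebra k A] [CommRing B] [Algebra k B]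
    {d : Module.End k A} (hd : IsDifferential lam d) {e : Module.End k B}
    (he : IsDifferential lam e) (f : A →ₐ[k] B) (h : ∀ x, f (d x) = e (f x)) (x : A) :
    Hurwitz.map lam f (Hurwitz.orbit lam d hd x) = Hurwitz.orbit lam e he (f x) :=
  Hurwitz.ext' lam fun n => pow_intertwine f.toLinearMap d e h n x

theorem Sha.eval_map {A B : Type v} [CommRing A] [Algebra k A] [CommRing B] [Algebra k B]
    {P : Module.End k A} (hP : IsRotaBaxter lam P) {Q : Module.End k B}
    (hQ : IsRotaBaxter lam Q) (f : A →ₐ[k] B) (h : ∀ x, f (P x) = Q (f x)) (u : Sha lam A) :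
    f (Sha.eval lam P hP u) = Sha.eval lam Q hQ (Sha.map lam f u) :=
  DFunLike.congr_fun (Sha.eq_of_intertwine lam (f := f.comp (Sha.eval lam P hP))
    (g := (Sha.eval lam Q hQ).comp (Sha.map lam f)) Q
    (fun u => by simp only [AlgHom.comp_apply, Sha.eval_opP, h])
    (fun u => by simp only [AlgHom.comp_apply, Sha.eval_opP, Sha.map_opP])
    (fun a => by simp only [AlgHom.comp_apply, Sha.eval_emb, Sha.map_emb])) u

/-- θ intertwines d with ∂ and has the identity as zeroth component, so the degree zero condition is
trivial. Thus coupling makes θ a morphism of RBA. -/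
theorem orbit_coext {A : Type v} [CommRing A] [Algebra k A] {d : Module.End k A}
    (hd : IsDifferential lam d) {P : Module.End k A} (h : Coupled (omega φ ψ) d P) (x : A) :
    Hurwitz.orbit lam d hd (P x) = Hurwitz.coext lam φ ψ P (Hurwitz.orbit lam d hd x) :=
  Hurwitz.coext_intertwine lam φ ψ h (Hurwitz.orbit lam d hd).toLinearMap
    (Hurwitz.orbit_intertwine lam d hd) P (fun _ => rfl) x

/-- Degree one of the hypothesis is the coupling: shifting gives θ(d P x) on one side and φ(∂) + P̂
ψ(∂) at θ(x) on the other, and the zeroth coefficient turns ∂ into d and P̂ into P. -/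
theorem coupled_of_orbit_coext {A : Type v} [CommRing A] [Algebra k A] {d : Module.End k A}
    (hd : IsDifferential lam d) {P : Module.End k A}
    (h : ∀ x, Hurwitz.orbit lam d hd (P x) =
      Hurwitz.coext lam φ ψ P (Hurwitz.orbit lam d hd x)) : Coupled (omega φ ψ) d P := by
  rw [coupled_omega_iff]
  refine LinearMap.ext fun x => ?_
  have h1 := congrArg (fun f => f.coeff 0) (congrArg (Hurwitz.shift lam A) (h x))
  have e := fun p => aeval_intertwine (Hurwitz.orbit lam d hd).toLinearMap d (Hurwitz.shift lam A)
    (Hurwitz.orbit_intertwine lam d hd) p x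
  simp only [AlgHom.toLinearMap_apply] at e
  rw [← Hurwitz.orbit_intertwine, (Hurwitz.coupled_coext lam φ ψ P).apply, Hurwitz.coeff_add,
    Hurwitz.coext_apply_zero, ← e, ← e] at h1
  exact h1

theorem eval_extend {A : Type v} [CommRing A] [Algebra k A] {d : Module.End k A}
    (hd : IsDifferential lam d) {P : Module.End k A} (hP : IsRotaBaxter lam P)
    (h : Coupled (omega φ ψ) d P) (u : Sha lam A) :
    Sha.eval lam P hP (Sha.extend lam φ ψ d u) = d (Sha.eval lam P hP u) :=
  Sha.extend_intertwine lam φ ψ hd h _ (Sha.eval_opP lam P hP) d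
    (fun a => by rw [Sha.eval_emb, Sha.eval_emb]) u

/-- Evaluate at 1 ⊗ x. In Ш(A) the extension is coupled to P_A, and ϑ carries this relation to the
one for d and P. -/
theorem coupled_of_eval_extend {A : Type v} [CommRing A] [Algebra k A] {d : Module.End k A}
    (hd : IsDifferential lam d) {P : Module.End k A} (hP : IsRotaBaxter lam P)
    (h : ∀ u, Sha.eval lam P hP (Sha.extend lam φ ψ d u) = d (Sha.eval lam P hP u)) :
    Coupled (omega φ ψ) d P := by
  rw [coupled_omega_iff]
  refine LinearMap.ext fun x => ?_
  have h1 := h (Sha.opP lam A (Sha.emb lam A x))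
  have e := fun p => aeval_intertwine (Sha.eval lam P hP).toLinearMap _ d h p (Sha.emb lam A x)
  simp only [AlgHom.toLinearMap_apply] at e
  rw [(Sha.coupled_ext lam φ ψ hd.1).apply, map_add, Sha.eval_opP, Sha.eval_opP, e, e,
    Sha.eval_emb] at h1
  exact h1.symm

section Coalgebras

variable (H : ∀ (R : Type v) [CommRing R] [Algebra k R] (P : Module.End k R),
  IsRotaBaxter lam P → IsRotaBaxter lam (Hurwitz.coext lam φ ψ P))

/-- The lifting of `𝐂` to Rota-Baxter algebras with functor `(R, P) ↦ (R^ℕ, P̂)`. -/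
def liftC : Comonad (RBA.{u, v} lam) where
  obj X := ⟨⟨CommAlgCat.of k (Hurwitz lam X.obj.alg), Hurwitz.coext lam φ ψ X.obj.op⟩,
    H _ _ X.property⟩
  map f := ObjectProperty.homMk ⟨CommAlgCat.ofHom (Hurwitz.map lam f.hom.hom.hom),
    fun x => Hurwitz.map_coext lam φ ψ _ _ f.hom.hom.hom f.hom.comm x⟩
  ε :=
    { app := fun X => ObjectProperty.homMk ⟨(comonadC lam).ε.app X.obj.alg, fun _ => rfl⟩
      naturality := fun _ _ _ => rfl }
  δ :=
    -- The comultiplication is θ for ∂, and ∂ is coupled to P̂, so it carries P̂ to the coextension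
    -- of P̂.
    { app := fun X => ObjectProperty.homMk ⟨(comonadC lam).δ.app X.obj.alg, fun x =>
        orbit_coext (Hurwitz.isDifferential_shift lam _) (Hurwitz.coupled_coext lam φ ψ _) x⟩
      naturality := fun X Y f =>
        forgetOp_rba_map_injective ((comonadC lam).δ.naturality f.hom.hom) }
  coassoc X := forgetOp_rba_map_injective ((comonadC lam).coassoc X.obj.alg)
  left_counit X := forgetOp_rba_map_injective ((comonadC lam).left_counit X.obj.alg)
  right_counit X := forgetOp_rba_map_injective ((comonadC lam).right_counit X.obj.alg)

theorem liftC_isComonadLift : IsComonadLift (RBA.forgetOp.{u, v} lam) (comonadC lam) (liftC H) where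
  comp := rfl
  ε _ := (Category.id_comp _).symm
  δ _ := (Category.comp_id _).trans (Category.id_comp _).symm

/-- The functor `(R, d, P) ↦ ⟨(R, P), θ⟩`. -/
def toCoalgebra : DRB.{u, v} lam (omega φ ψ) ⥤ (liftC H).Coalgebra where
  obj X :=
    { A := (DRB.toRBA lam (omega φ ψ)).obj X
      a := ObjectProperty.homMk ⟨orbitMap lam (omega φ ψ) X,
        orbit_coext X.property.1 X.property.2.2⟩
      counit := rfl
      -- Coassociativity is naturality of θ along θ itself, viewed as a morphism (R, d) → (R^ℕ, ∂).
      coassoc := forgetOp_rba_map_injective <| CommAlgCat.hom_ext <| AlgHom.ext fun x =>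
        (Hurwitz.map_orbit X.property.1 (Hurwitz.isDifferential_shift lam _)
          (Hurwitz.orbit lam X.obj.op₁ X.property.1)
          (Hurwitz.orbit_intertwine lam _ X.property.1) x).symm }
  map {X Y} f :=
    { f := (DRB.toRBA lam (omega φ ψ)).map f
      h := forgetOp_rba_map_injective <| CommAlgCat.hom_ext <| AlgHom.ext fun x =>
        Hurwitz.map_orbit X.property.1 Y.property.1 f.hom.hom.hom f.hom.comm₁ x }

end Coalgebras

/-! ### Coalgebra and algebra axioms in coordinates -/

section Structures

theorem comonadC_coalgebra_coeff_zero {A : CommAlgCat.{v} k} {c : A ⟶ (comonadC lam).obj A}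
    (h : c ≫ (comonadC lam).ε.app A = 𝟙 A) (x : A) :
    (c.hom x : Hurwitz lam A).coeff 0 = x :=
  DFunLike.congr_fun (congrArg CommAlgCat.Hom.hom h) x

/-- The n-th term of the comultiplication at f is ∂ⁿ f, whose m-th coefficient is f at m + n. -/
theorem comonadC_coalgebra_coeff_coeff {A : CommAlgCat.{v} k} {c : A ⟶ (comonadC lam).obj A}
    (h : c ≫ (comonadC lam).δ.app A = c ≫ (comonadC lam).map c) (x : A) (n m : ℕ) :
    (c.hom ((c.hom x : Hurwitz lam A).coeff n) : Hurwitz lam A).coeff m =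
      (c.hom x : Hurwitz lam A).coeff (m + n) := by
  have h1 : Hurwitz.orbit lam _ (Hurwitz.isDifferential_shift lam A) (c.hom x) =
    Hurwitz.map lam c.hom (c.hom x) := DFunLike.congr_fun (congrArg CommAlgCat.Hom.hom h) x
  have h2 := congrArg (fun f => (f.coeff n).coeff m) h1
  exact h2.symm.trans (Hurwitz.shift_pow_coeff lam _ n m)

theorem monadT_algebra_emb {A : CommAlgCat.{v} k} {a : (monadT lam).obj A ⟶ A}
    (h : (monadT lam).η.app A ≫ a = 𝟙 A) (x : A) : a.hom (Sha.emb lam A x) = x :=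
  DFunLike.congr_fun (congrArg CommAlgCat.Hom.hom h) x

theorem monadT_algebra_join {A : CommAlgCat.{v} k} {a : (monadT lam).obj A ⟶ A}
    (h : (monadT lam).μ.app A ≫ a = (monadT lam).map a ≫ a) (u : Sha lam (Sha lam A)) :
    a.hom (Sha.join lam A u) = a.hom (Sha.map lam a.hom u) :=
  DFunLike.congr_fun (congrArg CommAlgCat.Hom.hom h) u

end Structures

/-! ### Coalgebras of the lifted comonad -/

section CoalgebraIso

variable (H : ∀ (R : Type v) [CommRing R] [Algebra k R] (P : Module.End k R),
  IsRotaBaxter lam P → IsRotaBaxter lam (Hurwitz.coext lam φ ψ P))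

theorem liftC_coalgebra_counit (Z : (liftC H).Coalgebra) (x : Z.A.obj.alg) :
    (Z.a.hom.hom.hom x : Hurwitz lam Z.A.obj.alg).coeff 0 = x :=
  comonadC_coalgebra_coeff_zero (c := (RBA.forgetOp lam).map Z.a)
    (congrArg (RBA.forgetOp lam).map Z.counit) x

theorem liftC_coalgebra_eq (Z : (liftC H).Coalgebra) :
    Z.a.hom.hom.hom = Hurwitz.orbit (A := Z.A.obj.alg) lam (Hurwitz.first lam Z.a.hom.hom.hom)
      (Hurwitz.isDifferential_first (liftC_coalgebra_counit H Z)) :=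
  Hurwitz.eq_orbit (liftC_coalgebra_counit H Z) fun x n m =>
    comonadC_coalgebra_coeff_coeff (c := (RBA.forgetOp lam).map Z.a)
      (congrArg (RBA.forgetOp lam).map Z.coassoc) x n m

/-- The differential Rota-Baxter algebra attached to a coalgebra. -/
def ofCoalgebra (Z : (liftC H).Coalgebra) : DRB.{u, v} lam (omega φ ψ) :=
  ⟨⟨Z.A.obj.alg, Hurwitz.first (A := Z.A.obj.alg) lam Z.a.hom.hom.hom, Z.A.obj.op⟩,
    Hurwitz.isDifferential_first (liftC_coalgebra_counit H Z), Z.A.property,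
    coupled_of_orbit_coext (A := Z.A.obj.alg)
      (Hurwitz.isDifferential_first (liftC_coalgebra_counit H Z))
      fun x => by
        -- Once θ is recognised as the structure map, the condition to check is that this map is a
        -- morphism of RBA.
        rw [← liftC_coalgebra_eq H Z]
        exact Z.a.hom.comm x⟩

instance : (toCoalgebra H).Faithful where
  map_injective h := ObjectProperty.hom_ext _ (OpAlg₂.hom_ext
    (congrArg (fun f => f.f.hom.hom) h))

instance : (toCoalgebra H).Full where
  map_surjective {X Y} f := by
    have h : ∀ x : X.obj.alg, Hurwitz.map lam f.f.hom.hom.hom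
        (Hurwitz.orbit lam X.obj.op₁ X.property.1 x) =
        Hurwitz.orbit lam Y.obj.op₁ Y.property.1 (f.f.hom.hom.hom x) :=
      DFunLike.congr_fun (congrArg (fun f => f.hom.hom.hom) f.h)
    refine ⟨ObjectProperty.homMk ⟨f.f.hom.hom, fun x => ?_, f.f.hom.comm⟩, rfl⟩
    -- Compatibility with d is the degree one part of the coalgebra morphism condition.
    exact congrArg (fun f => f.coeff 1) (h x)

theorem toCoalgebra_isCoalgebraIso :
    IsCoalgebraIso (liftC_isComonadLift H) (DRB.toRBA lam (omega φ ψ))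
      (orbitMap lam (omega φ ψ)) (toCoalgebra H) where
  isIso := .of_bijective _ (ofCoalgebra H)
    (fun X => by
      have h : Hurwitz.first lam (Hurwitz.orbit lam X.obj.op₁ X.property.1) = X.obj.op₁ :=
        Hurwitz.first_orbit lam _ _
      obtain ⟨⟨A, d, P⟩, hX⟩ := X
      simp only [ofCoalgebra, toCoalgebra]
      congr 2)
    (fun Z => by
      have h := liftC_coalgebra_eq H Z
      obtain ⟨A, a, h1, h2⟩ := Z
      simp only [toCoalgebra]
      congr 1
      exact forgetOp_rba_map_injective (CommAlgCat.hom_ext h.symm))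
  comp_forget := rfl
  str _ := (Category.comp_id _).trans (Category.id_comp _).symm

end CoalgebraIso

end Constructions

/-- Two algebras over a monad lifted along a mixed distributive law are equal if they have the same
underlying object and the same structure maps. -/
theorem liftMonad_algebra_ext {𝒜 : Type*} [Category 𝒜] {T : CategoryTheory.Monad 𝒜}
    {C : Comonad 𝒜} {b : MixedDistribLaw T C} {A : 𝒜} {c c' : A ⟶ C.obj A} {f f' : T.obj A ⟶ A}
    {p q p' q' h h' r s r' s'} (hc : c = c') (hf : f = f') :
    (⟨⟨A, c, p, q⟩, ⟨f, h⟩, r, s⟩ : b.liftMonad.Algebra) = ⟨⟨A, c', p', q'⟩, ⟨f', h'⟩, r', s'⟩ := by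
  subst hc hf
  rfl

/-! ### The lifted monad and its algebras -/

noncomputable section AlgebraConstructions

variable {k : Type u} [CommRing k] {lam : k} {φ ψ : k[X]}

section Algebras

variable (H : ∀ (R : Type v) [CommRing R] [Algebra k R] (d : Module.End k R),
  IsDifferential lam d → IsDifferential lam (Sha.extend lam φ ψ d))

/-- The lifting of `𝐓` to differential algebras with functor `(R, d) ↦ (Sha(R), d̂)`. -/
def liftT : CategoryTheory.Monad (DIF.{u, v} lam) where
  obj X := ⟨⟨CommAlgCat.of k (Sha lam X.obj.alg), Sha.extend lam φ ψ X.obj.op⟩,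
    H _ _ X.property⟩
  map f := ObjectProperty.homMk ⟨CommAlgCat.ofHom (Sha.map lam f.hom.hom.hom),
    fun x => Sha.map_ext lam φ ψ _ f.hom.hom.hom _ f.hom.comm x⟩
  map_id X := forgetOp_dif_map_injective ((monadT lam).map_id X.obj.alg)
  map_comp f g := forgetOp_dif_map_injective ((monadT lam).map_comp f.hom.hom g.hom.hom)
  η :=
    { app := fun X => ObjectProperty.homMk ⟨(monadT lam).η.app X.obj.alg, fun x =>
        (Sha.ext_emb lam φ ψ X.obj.op x).symm⟩
      naturality := fun _ _ f =>
        forgetOp_dif_map_injective ((monadT lam).η.naturality f.hom.hom) }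
  μ :=
    { app := fun X => ObjectProperty.homMk ⟨(monadT lam).μ.app X.obj.alg, fun u =>
        join_intertwine X.property (H _ _ X.property) u⟩
      naturality := fun _ _ f =>
        forgetOp_dif_map_injective ((monadT lam).μ.naturality f.hom.hom) }
  assoc X := forgetOp_dif_map_injective ((monadT lam).assoc X.obj.alg)
  left_unit X := forgetOp_dif_map_injective ((monadT lam).left_unit X.obj.alg)
  right_unit X := forgetOp_dif_map_injective ((monadT lam).right_unit X.obj.alg)

theorem liftT_isMonadLift : IsMonadLift (DIF.forgetOp.{u, v} lam) (monadT lam) (liftT H) where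
  comp := rfl
  η _ := Category.comp_id _
  μ _ := (Category.comp_id _).trans (Category.id_comp _).symm

theorem evalMap_unit (X : DRB.{u, v} lam (omega φ ψ)) :
    (monadT lam).η.app X.obj.alg ≫ evalMap lam (omega φ ψ) X = 𝟙 X.obj.alg :=
  CommAlgCat.hom_ext <| AlgHom.ext fun x =>
    Sha.eval_emb lam X.obj.op₂ X.property.2.1 x

/-- ϑ is itself a Rota–Baxter homomorphism Ш(R) → R, so associativity is naturality of evaluation
along ϑ. -/
theorem evalMap_assoc (X : DRB.{u, v} lam (omega φ ψ)) :
    (monadT lam).μ.app X.obj.alg ≫ evalMap lam (omega φ ψ) X =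
      (monadT lam).map (evalMap lam (omega φ ψ) X) ≫ evalMap lam (omega φ ψ) X :=
  CommAlgCat.hom_ext <| AlgHom.ext fun u =>
    Sha.eval_map (Sha.isRotaBaxter_opP lam X.obj.alg) X.property.2.1
      (Sha.eval lam X.obj.op₂ X.property.2.1) (Sha.eval_opP lam _ _) u

theorem evalMap_naturality {X Y : DRB.{u, v} lam (omega φ ψ)} (f : X ⟶ Y) :
    (monadT lam).map f.hom.hom ≫ evalMap lam (omega φ ψ) Y =
      evalMap lam (omega φ ψ) X ≫ f.hom.hom :=
  CommAlgCat.hom_ext <| AlgHom.ext fun u =>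
    (Sha.eval_map X.property.2.1 Y.property.2.1 f.hom.hom.hom f.hom.comm₂ u).symm

/-- An algebra homomorphism compatible with the evaluations commutes with the Rota-Baxter
operators. -/
theorem comm_of_evalMap {X Y : DRB.{u, v} lam (omega φ ψ)} (f : X.obj.alg ⟶ Y.obj.alg)
    (h : (monadT lam).map f ≫ evalMap lam (omega φ ψ) Y = evalMap lam (omega φ ψ) X ≫ f)
    (x : X.obj.alg) : f.hom (X.obj.op₂ x) = Y.obj.op₂ (f.hom x) := by
  have h1 : Sha.eval lam Y.obj.op₂ Y.property.2.1
      (Sha.map lam f.hom (Sha.opP lam _ (Sha.emb lam _ x))) =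
      f.hom (Sha.eval lam X.obj.op₂ X.property.2.1 (Sha.opP lam _ (Sha.emb lam _ x))) :=
    DFunLike.congr_fun (congrArg CommAlgCat.Hom.hom h) (Sha.opP lam _ (Sha.emb lam _ x))
  rw [Sha.map_opP, Sha.map_emb, Sha.eval_opP, Sha.eval_opP, Sha.eval_emb, Sha.eval_emb] at h1
  exact h1.symm

/-- The functor `(R, d, P) ↦ ⟨(R, d), ϑ⟩`. -/
def toAlgebra : DRB.{u, v} lam (omega φ ψ) ⥤ (liftT H).Algebra where
  obj X :=
    { A := (DRB.toDIF lam (omega φ ψ)).obj X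
      a := ObjectProperty.homMk ⟨evalMap lam (omega φ ψ) X,
        eval_extend X.property.1 X.property.2.1 X.property.2.2⟩
      unit := forgetOp_dif_map_injective (evalMap_unit X)
      assoc := forgetOp_dif_map_injective (evalMap_assoc X) }
  map f :=
    { f := (DRB.toDIF lam (omega φ ψ)).map f
      h := forgetOp_dif_map_injective (evalMap_naturality f) }

theorem liftT_algebra_emb (Z : (liftT H).Algebra) (x : Z.A.obj.alg) :
    Z.a.hom.hom.hom (Sha.emb lam Z.A.obj.alg x) = x :=
  monadT_algebra_emb (a := (DIF.forgetOp lam).map Z.a)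
    (congrArg (DIF.forgetOp lam).map Z.unit) x

theorem liftT_algebra_join (Z : (liftT H).Algebra) (u : Sha lam (Sha lam Z.A.obj.alg)) :
    Z.a.hom.hom.hom (Sha.join lam Z.A.obj.alg u) =
      Z.a.hom.hom.hom (Sha.map lam Z.a.hom.hom.hom u) :=
  monadT_algebra_join (a := (DIF.forgetOp lam).map Z.a)
    (congrArg (DIF.forgetOp lam).map Z.assoc) u

theorem liftT_algebra_eq (Z : (liftT H).Algebra) :
    Z.a.hom.hom.hom = Sha.eval (A := Z.A.obj.alg) lam (Sha.structOp lam Z.a.hom.hom.hom)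
      (Sha.isRotaBaxter_structOp (liftT_algebra_emb H Z) (liftT_algebra_join H Z)) :=
  Sha.eq_eval (liftT_algebra_emb H Z) (liftT_algebra_join H Z)

/-- The differential Rota-Baxter algebra attached to an algebra over the lifted monad. -/
def ofAlgebra (Z : (liftT H).Algebra) : DRB.{u, v} lam (omega φ ψ) :=
  ⟨⟨Z.A.obj.alg, Z.A.obj.op, Sha.structOp (A := Z.A.obj.alg) lam Z.a.hom.hom.hom⟩,
    Z.A.property,
    Sha.isRotaBaxter_structOp (liftT_algebra_emb H Z) (liftT_algebra_join H Z),
    coupled_of_eval_extend (A := Z.A.obj.alg) Z.A.property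
      (Sha.isRotaBaxter_structOp (liftT_algebra_emb H Z) (liftT_algebra_join H Z))
      fun u => by
        rw [← liftT_algebra_eq H Z]
        exact Z.a.hom.comm u⟩

instance : (toAlgebra H).Faithful where
  map_injective h := ObjectProperty.hom_ext _ (OpAlg₂.hom_ext
    (congrArg (fun f => f.f.hom.hom) h))

instance : (toAlgebra H).Full where
  map_surjective f :=
    ⟨ObjectProperty.homMk ⟨f.f.hom.hom, f.f.hom.comm,
      comm_of_evalMap f.f.hom.hom (congrArg (DIF.forgetOp lam).map f.h)⟩, rfl⟩

theorem toAlgebra_isAlgebraIso :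
    IsAlgebraIso (liftT_isMonadLift H) (DRB.toDIF lam (omega φ ψ))
      (evalMap lam (omega φ ψ)) (toAlgebra H) where
  isIso := .of_bijective _ (ofAlgebra H)
    (fun X => by
      have h : Sha.structOp lam (Sha.eval lam X.obj.op₂ X.property.2.1) = X.obj.op₂ :=
        Sha.structOp_eval lam _ _
      obtain ⟨⟨A, d, P⟩, hX⟩ := X
      simp only [ofAlgebra, toAlgebra]
      congr 2)
    (fun Z => by
      have h := liftT_algebra_eq H Z
      obtain ⟨A, a, h1, h2⟩ := Z
      simp only [toAlgebra]
      congr 1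
      exact forgetOp_dif_map_injective (CommAlgCat.hom_ext h.symm))
  comp_forget := rfl
  str _ := (Category.comp_id _).trans (Category.id_comp _).symm

end Algebras

/-! ### Algebras over the monad lifted along the mixed distributive law -/

section Mixed

variable (H : ∀ (R : Type v) [CommRing R] [Algebra k R] (d : Module.End k R),
  IsDifferential lam d → IsDifferential lam (Sha.extend lam φ ψ d))

/-- The mixed distributive law of `𝐓` over `𝐂` with components `Sha(A^ℕ) → Sha(A)^ℕ`,
`u ↦ (Sha(ε)(∂̂ⁿ u))ₙ`. -/
def mixedLaw : MixedDistribLaw (monadT.{u, v} lam) (comonadC lam) where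
  β :=
    { app := fun A => CommAlgCat.ofHom
        (distrib φ ψ A (H _ _ (Hurwitz.isDifferential_shift lam A)))
      naturality := fun A B f => CommAlgCat.hom_ext <| AlgHom.ext fun u =>
        distrib_naturality (H _ _ (Hurwitz.isDifferential_shift lam A))
          (H _ _ (Hurwitz.isDifferential_shift lam B)) f.hom u }
  unit A := CommAlgCat.hom_ext <| AlgHom.ext fun f =>
    distrib_emb (H _ _ (Hurwitz.isDifferential_shift lam A)) f
  counit A := CommAlgCat.hom_ext <| AlgHom.ext fun u =>
    distrib_coeff_zero (H _ _ (Hurwitz.isDifferential_shift lam A)) u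
  comul A := CommAlgCat.hom_ext <| AlgHom.ext fun u =>
    distrib_comul (H _ _ (Hurwitz.isDifferential_shift lam A))
      (H _ _ (Hurwitz.isDifferential_shift lam (Hurwitz lam A))) u
  mul A := CommAlgCat.hom_ext <| AlgHom.ext fun u =>
    distrib_join (H _ _ (Hurwitz.isDifferential_shift lam A))
      (H _ _ (Hurwitz.isDifferential_shift lam (Sha lam A))) u

/-- The structure map of the lifting of `𝐓` at a coalgebra `⟨A, θ⟩` given by a differential
operator. -/
theorem mixedLaw_structure {A : CommAlgCat.{v} k} {d : Module.End k A}
    (hd : IsDifferential lam d) :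
    (monadT lam).map (CommAlgCat.ofHom (Hurwitz.orbit lam d hd) : A ⟶ (comonadC lam).obj A) ≫
        (mixedLaw H).β.app A =
      CommAlgCat.ofHom (Hurwitz.orbit lam _ (H _ _ hd)) :=
  CommAlgCat.hom_ext <| AlgHom.ext fun u =>
    distrib_map_orbit (H _ _ (Hurwitz.isDifferential_shift lam A)) hd (H _ _ hd) u

/-- The functor `(R, d, P) ↦ ⟨⟨R, θ⟩, ϑ⟩`. -/
def toMixedAlgebra : DRB.{u, v} lam (omega φ ψ) ⥤ (mixedLaw H).liftMonad.Algebra where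
  obj X :=
    { A := (DRB.toDIF lam (omega φ ψ) ⋙ Comonad.comparison (hurwitzAdj lam)).obj X
      a :=
        { f := evalMap lam (omega φ ψ) X
          h := by
            -- The lifted monad sends ⟨R, θ⟩ to Ш(R) with θ for d̂. The condition on ϑ then becomes
            -- naturality of θ, and coupling provides ϑ d̂ = d ϑ.
            refine (congrArg (· ≫ (comonadC lam).map (evalMap lam (omega φ ψ) X))
              (mixedLaw_structure H X.property.1)).trans ?_
            exact CommAlgCat.hom_ext <| AlgHom.ext fun u =>
              Hurwitz.map_orbit (H _ _ X.property.1) X.property.1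
                (Sha.eval lam X.obj.op₂ X.property.2.1)
                (eval_extend X.property.1 X.property.2.1 X.property.2.2) u }
      unit := Comonad.Coalgebra.Hom.ext (evalMap_unit X)
      assoc := Comonad.Coalgebra.Hom.ext (evalMap_assoc X) }
  map f :=
    { f := (DRB.toDIF lam (omega φ ψ) ⋙ Comonad.comparison (hurwitzAdj lam)).map f
      h := Comonad.Coalgebra.Hom.ext (evalMap_naturality f) }

section Inverse

variable (Z : (mixedLaw H).liftMonad.Algebra)

theorem mixed_coalgebra_coeff_zero (x : Z.A.A) : (Z.A.a.hom x : Hurwitz lam Z.A.A).coeff 0 = x :=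
  comonadC_coalgebra_coeff_zero Z.A.counit x

theorem mixed_coalgebra_eq :
    Z.A.a.hom = Hurwitz.orbit (A := Z.A.A) lam (Hurwitz.first lam Z.A.a.hom)
      (Hurwitz.isDifferential_first (mixed_coalgebra_coeff_zero H Z)) :=
  Hurwitz.eq_orbit (mixed_coalgebra_coeff_zero H Z)
    (comonadC_coalgebra_coeff_coeff Z.A.coassoc)

theorem mixed_algebra_emb (x : Z.A.A) : Z.a.f.hom (Sha.emb lam Z.A.A x) = x :=
  monadT_algebra_emb (a := Z.a.f) (congrArg Comonad.Coalgebra.Hom.f Z.unit) x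

theorem mixed_algebra_join (u : Sha lam (Sha lam Z.A.A)) :
    Z.a.f.hom (Sha.join lam Z.A.A u) = Z.a.f.hom (Sha.map lam Z.a.f.hom u) :=
  monadT_algebra_join (a := Z.a.f) (congrArg Comonad.Coalgebra.Hom.f Z.assoc) u

theorem mixed_algebra_eq :
    Z.a.f.hom = Sha.eval (A := Z.A.A) lam (Sha.structOp lam Z.a.f.hom)
      (Sha.isRotaBaxter_structOp (mixed_algebra_emb H Z) (mixed_algebra_join H Z)) :=
  Sha.eq_eval (mixed_algebra_emb H Z) (mixed_algebra_join H Z)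

/-- The algebra structure is a coalgebra morphism from Ш(A), whose coalgebra structure is θ for d̂,
to A. Degree one of that condition is the commutation with d̂ and d. -/
theorem mixed_algebra_intertwine (u : Sha lam Z.A.A) :
    Z.a.f.hom (Sha.extend lam φ ψ (Hurwitz.first (A := Z.A.A) lam Z.A.a.hom) u) =
      Hurwitz.first (A := Z.A.A) lam Z.A.a.hom (Z.a.f.hom u) := by
  have hd := Hurwitz.isDifferential_first (A := Z.A.A) (mixed_coalgebra_coeff_zero H Z)
  have e : Z.A.a = CommAlgCat.ofHom (Hurwitz.orbit (A := Z.A.A) lam _ hd) :=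
    CommAlgCat.hom_ext (mixed_coalgebra_eq H Z)
  have h1 : ((monadT lam).map Z.A.a ≫ (mixedLaw H).β.app Z.A.A) ≫ (comonadC lam).map Z.a.f =
    Z.a.f ≫ Z.A.a := Z.a.h
  have h2 : (monadT lam).map Z.A.a ≫ (mixedLaw H).β.app Z.A.A =
      CommAlgCat.ofHom (Hurwitz.orbit lam _ (H _ _ hd)) :=
    (congrArg (fun c => (monadT lam).map c ≫ (mixedLaw H).β.app Z.A.A) e).trans
      (mixedLaw_structure H hd)
  rw [h2] at h1
  exact congrArg (fun f : Hurwitz lam Z.A.A => f.coeff 1)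
    (DFunLike.congr_fun (congrArg CommAlgCat.Hom.hom h1) u)

/-- The differential Rota-Baxter algebra attached to an algebra over the monad lifted along the
mixed distributive law. -/
def ofMixedAlgebra : DRB.{u, v} lam (omega φ ψ) :=
  ⟨⟨Z.A.A, Hurwitz.first (A := Z.A.A) lam Z.A.a.hom,
      Sha.structOp (A := Z.A.A) lam Z.a.f.hom⟩,
    Hurwitz.isDifferential_first (mixed_coalgebra_coeff_zero H Z),
    Sha.isRotaBaxter_structOp (mixed_algebra_emb H Z) (mixed_algebra_join H Z),
    coupled_of_eval_extend (A := Z.A.A)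
      (Hurwitz.isDifferential_first (mixed_coalgebra_coeff_zero H Z))
      (Sha.isRotaBaxter_structOp (mixed_algebra_emb H Z) (mixed_algebra_join H Z))
      fun u => by
        rw [← mixed_algebra_eq H Z]
        exact mixed_algebra_intertwine H Z u⟩

end Inverse

instance : (toMixedAlgebra H).Faithful where
  map_injective h := ObjectProperty.hom_ext _ (OpAlg₂.hom_ext
    (congrArg (fun f => f.f.f) h))

instance : (toMixedAlgebra H).Full where
  map_surjective {X Y} f := by
    have h : ∀ x : X.obj.alg, Hurwitz.map lam f.f.f.hom
        (Hurwitz.orbit lam X.obj.op₁ X.property.1 x) =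
        Hurwitz.orbit lam Y.obj.op₁ Y.property.1 (f.f.f.hom x) :=
      DFunLike.congr_fun (congrArg CommAlgCat.Hom.hom f.f.h)
    exact ⟨ObjectProperty.homMk ⟨f.f.f, fun x => congrArg (fun f => f.coeff 1) (h x),
      comm_of_evalMap f.f.f (congrArg Comonad.Coalgebra.Hom.f f.h)⟩, rfl⟩

theorem toMixedAlgebra_isAlgebraIso :
    IsAlgebraIso (mixedLaw H).liftMonad_isMonadLift
      (DRB.toDIF lam (omega φ ψ) ⋙ Comonad.comparison (hurwitzAdj lam))
      (evalMap lam (omega φ ψ)) (toMixedAlgebra H) where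
  isIso := .of_bijective _ (ofMixedAlgebra H)
    (fun X => by
      have h : Hurwitz.first lam (Hurwitz.orbit lam X.obj.op₁ X.property.1) = X.obj.op₁ :=
        Hurwitz.first_orbit lam _ _
      have h' : Sha.structOp lam (Sha.eval lam X.obj.op₂ X.property.2.1) = X.obj.op₂ :=
        Sha.structOp_eval lam _ _
      obtain ⟨⟨A, d, P⟩, hX⟩ := X
      simp only [ofMixedAlgebra, toMixedAlgebra]
      congr 2)
    (fun Z => liftMonad_algebra_ext (CommAlgCat.hom_ext (mixed_coalgebra_eq H Z).symm)
        (CommAlgCat.hom_ext (mixed_algebra_eq H Z).symm))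
  comp_forget := rfl
  str _ := (Category.comp_id _).trans (Category.id_comp _).symm

end Mixed

end AlgebraConstructions

end DiffRB

/-! ### The equivalences -/

theorem mainTheorem1 {k : Type u} [CommRing k] (lam : k) (φ ψ : k[X]) :
    List.TFAE [
      -- (i) the coextension of every Rota-Baxter operator is a Rota-Baxter operator
      ∀ (R : Type v) [CommRing R] [Algebra k R] (P : Module.End k R),
        IsRotaBaxter lam P → IsRotaBaxter lam (Hurwitz.coext lam φ ψ P),
      -- (ii) the extension of every differential operator is a differential operator
      ∀ (R : Type v) [CommRing R] [Algebra k R] (d : Module.End k R),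
        IsDifferential lam d → IsDifferential lam (Sha.extend lam φ ψ d),
      -- (iii) `G_ω` restricts to a functor `RBA → DRB_ω`
      ∃ G : RBA.{u, v} lam ⥤ DRB.{u, v} lam (omega φ ψ),
        G ⋙ DRB.toODA lam (omega φ ψ) = RBA.toOA lam ⋙ functorG lam φ ψ,
      -- (iv) `F_ω` restricts to a functor `DIF → DRB_ω`
      ∃ F : DIF.{u, v} lam ⥤ DRB.{u, v} lam (omega φ ψ),
        F ⋙ DRB.toORB lam (omega φ ψ) = DIF.toOA₀ lam ⋙ functorF lam φ ψ,
      -- (v) `𝐂` lifts to `RBA` with category of coalgebras `DRB_ω`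
      ∃ (C' : Comonad (RBA.{u, v} lam))
        (hC : IsComonadLift (RBA.forgetOp lam) (comonadC lam) C')
        (H : DRB.{u, v} lam (omega φ ψ) ⥤ C'.Coalgebra),
        IsCoalgebraIso hC (DRB.toRBA lam (omega φ ψ)) (orbitMap lam (omega φ ψ)) H,
      -- (vi) `𝐓` lifts to `DIF` with category of algebras `DRB_ω`
      ∃ (T' : CategoryTheory.Monad (DIF.{u, v} lam))
        (hT : IsMonadLift (DIF.forgetOp lam) (monadT lam) T')
        (K : DRB.{u, v} lam (omega φ ψ) ⥤ T'.Algebra),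
        IsAlgebraIso hT (DRB.toDIF lam (omega φ ψ)) (evalMap lam (omega φ ψ)) K,
      -- (vii) a mixed distributive law of `𝐓` over `𝐂` whose category of algebras is `DRB_ω`
      ∃ (b : MixedDistribLaw (monadT.{u, v} lam) (comonadC lam))
        (K : DRB.{u, v} lam (omega φ ψ) ⥤ b.liftMonad.Algebra),
        IsAlgebraIso b.liftMonad_isMonadLift
          (DRB.toDIF lam (omega φ ψ) ⋙ Comonad.comparison (hurwitzAdj lam))
          (evalMap lam (omega φ ψ)) K] := by
  tfae_have 1 → 2 := fun H R _ _ d hd => isDifferential_extend_of_isRotaBaxter_coext H R d hd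
  tfae_have 2 → 1 := fun H R _ _ P hP => isRotaBaxter_coext_of_isDifferential_extend H R P hP
  -- DRB_ω is a full subcategory, so restricting the functor is a condition on objects only.
  tfae_have 1 → 3 := fun H =>
    ⟨(OpAlg₂.isDRB lam (omega φ ψ)).lift
      (RBA.toOA lam ⋙ functorG lam φ ψ ⋙ (OpAlg₂.isODA lam (omega φ ψ)).ι) fun X =>
        ⟨Hurwitz.isDifferential_shift lam X.obj.alg, H _ _ X.property,
          Hurwitz.coupled_coext lam φ ψ X.obj.op⟩, rfl⟩
  tfae_have 3 → 1 := fun ⟨G, hG⟩ R _ _ P hP => by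
    let X : RBA.{u, v} lam := ⟨⟨CommAlgCat.of k R, P⟩, hP⟩
    -- The restricted functor agrees with G_ω on objects, so the image of (R, P) under G_ω inherits
    -- membership in DRB_ω.
    have e := congrArg (fun Y => Y.obj) (Functor.congr_obj hG X)
    have h : OpAlg₂.isDRB lam (omega φ ψ) ((RBA.toOA lam ⋙ functorG lam φ ψ).obj X).obj :=
      e ▸ (G.obj X).property
    exact h.2.1
  tfae_have 2 → 4 := fun H =>
    ⟨(OpAlg₂.isDRB lam (omega φ ψ)).lift
      (DIF.toOA₀ lam ⋙ functorF lam φ ψ ⋙ (OpAlg₂.isORB lam (omega φ ψ)).ι) fun X =>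
        ⟨H _ _ X.property, Sha.isRotaBaxter_opP lam X.obj.alg,
          Sha.coupled_ext lam φ ψ X.property.1⟩, rfl⟩
  tfae_have 4 → 2 := fun ⟨F, hF⟩ R _ _ d hd => by
    let X : DIF.{u, v} lam := ⟨⟨CommAlgCat.of k R, d⟩, hd⟩
    have e := congrArg (fun Y => Y.obj) (Functor.congr_obj hF X)
    have h : OpAlg₂.isDRB lam (omega φ ψ) ((DIF.toOA₀ lam ⋙ functorF lam φ ψ).obj X).obj :=
      e ▸ (F.obj X).property
    exact h.1
  -- The comonad side is tied to (i), and the two monad sides to (ii).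
  tfae_have 1 → 5 := fun H =>
    ⟨liftC H, liftC_isComonadLift H, toCoalgebra H, toCoalgebra_isCoalgebraIso H⟩
  tfae_have 5 → 1 := fun ⟨_, _, _, h⟩ R _ _ P hP => isRotaBaxter_coext_of_isCoalgebraIso h R P hP
  tfae_have 2 → 6 := fun H =>
    ⟨liftT H, liftT_isMonadLift H, toAlgebra H, toAlgebra_isAlgebraIso H⟩
  tfae_have 6 → 2 := fun ⟨_, _, _, h⟩ R _ _ d hd => isDifferential_extend_of_isAlgebraIso h R d hd
  tfae_have 2 → 7 := fun H => ⟨mixedLaw H, toMixedAlgebra H, toMixedAlgebra_isAlgebraIso H⟩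
  tfae_have 7 → 2 := fun ⟨_, _, h⟩ R _ _ d hd => isDifferential_extend_of_mixedDistribLaw h R d hd
  tfae_finish
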